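/- **Setting.** Let $d\ge 1$, $n\in\mathbb N$, and let $\mathcal H$ be either $L^2(\mathbb R^d,dx;\mathbb C^n)$ or $\ell^2(\mathbb Z^d;\mathbb C^n)$. Write $|\cdot|$ for the Euclidean and $|\cdot|_\infty$ for the sup norm, $\langle x\rangle=\sqrt{1+|x|^2}$; $\Lambda_L(x)=\{y:|y-x|_\infty<L/2\}$ is the open cube of side $L$ centered at $x\in\mathbb Z^d$, $\overline\Lambda_L(x)$ the closed cube, $\chi_{x,L}$ the characteristic function of $\Lambda_L(x)$ and $\chi_x=\chi_{x,1}$. Fix $b\ge 3$ (usually $b=3$ on $\mathbb R^d$) and let $\Gamma_{x,L}$ be the characteristic function of the belt $\overline\Lambda_{L-1}(x)\setminus\Lambda_{L-b}(x)$. Fix $\kappa>d/2$, let $T$ be multiplication by $\langle x\rangle^\kappa$, $\mathcal H_+=D(T)$ with norm $\|T\phi\|$, and $\mathcal H_-=\{\psi: T^{-1}\psi\in\mathcal H\}$. Let $(\Omega,\mathcal F,\mathbb P)$ be a probability space with an ergodic measure preserving action $\tau$ of $\mathbb Z^d$, and let $H_\omega$ ($\omega\in\Omega$) be self-adjoint operators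 on $\mathcal H$ such that $\omega\mapsto f(H_\omega)$ is weakly measurable for all bounded Borel $f:\mathbb R\to\mathbb R$ and $U(y)H_\omega U(y)^*=H_{\tau_y\omega}$ for all $y\in\mathbb Z^d$, where $(U(y)\phi)(x)=c_y(x)\phi(x-y)$ with measurable $c_y$, $|c_y|=1$ (translations if $c_y=1$; magnetic translations are included). Put $P_{B,\omega}=\chi_B(H_\omega)$, $P_{\lambda,\omega}=P_{\{\lambda\},\omega}$ and $\mu_\omega(B)=\operatorname{tr}\{T^{-1}P_{B,\omega}T^{-1}\}$ for Borel sets $B$. Let $\mathcal I\subseteq\mathbb R$ be an open interval, and for $x\in\mathbb Z^d$ and $L\in 2\mathbb N$, $L>0$, let $H_{\omega,x,L}$ be self-adjoint operators (finite volume operators) on the space of square integrable $\mathbb C^n$-valued functions on $\Lambda_L(x)$. Assume: 1. Almost surely, $D_+^\omega=\{\phi\in D(H_\omega)\cap\mathcal H_+: H_\omega\phi\in\mathcal H_+\}$ is dense in $\mathcal H_+$ and a core for $H_\omega$. 2. There are a nonrandom bounded continuous $f\ge 0$ and $C<\infty$ such that almost surely $f>0$ on $\sigma(H_\omega)\cap\mathcal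 I$ and $\operatorname{tr}\{T^{-1}f(H_\omega)T^{-1}\}\le C$. 3. For every compact interval $I_0\subset\mathcal I$ there is a constant $\gamma$ such that almost surely, for all $E\in I_0$, all generalized eigenfunctions $\psi$ of $H_\omega$ with generalized eigenvalue $E$ (that is, $0\ne\psi\in\mathcal H_-$ and $\langle H_\omega\phi,\psi\rangle=E\langle\phi,\psi\rangle$ for all $\phi\in D_+^\omega$), all $x\in\mathbb Z^d$ and all $L\in2\mathbb N$, $L>0$, with $E\notin\sigma(H_{\omega,x,L})$, $$\|\chi_x\psi\|\le\gamma\,\|\Gamma_{x,L}(H_{\omega,x,L}-E)^{-1}\chi_x\|\,\|\Gamma_{x,L}\psi\|.$$ **Region of complete localization.** $\Lambda_L(x)$ is $(\omega,m,E)$-regular if $E\notin\sigma(H_{\omega,x,L})$ and $\|\Gamma_{x,L}(H_{\omega,x,L}-E)^{-1}\chi_{x,L/3}\|\le e^{-mL/2}$. Let $R(m,L,I,x,y)$ be the event that for every $E'\in I$ at least one of $\Lambda_L(x)$, $\Lambda_L(y)$ is $(\omega,m,E')$-regular. Fix $\varrho>0$. Then $\Xi$ is the set of $E\in\mathcal I$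 for which there is an open interval $I\subset\mathcal I$ containing $E$ such that for all $\zeta\in(0,1)$ and $\alpha\in(1,\zeta^{-1})$ there are $L_0\in6\mathbb N$ and $m>0$ for which the scales $L_{k+1}=\max\{L\in6\mathbb N:L\le L_k^\alpha\}$ are strictly increasing and $$\mathbb P\{R(m,L_k,I,x,y)\}\ge1-e^{-L_k^\zeta}\quad\text{for all }k\ge0\text{ and }x,y\in\mathbb Z^d\text{ with }|x-y|_\infty>L_k+\varrho$$ (if the event is not measurable, this means that its complement has outer measure at most $e^{-L_k^\zeta}$). **Corollary 3.3.** The set $\Xi$ is open, and: (i) For $\mathbb P$-a.e. $\omega$, $H_\omega$ has pure point spectrum in $\Xi$ (the range of $P_{\Xi,\omega}$ is contained in the closed linear span of the eigenvectors of $H_\omega$ with eigenvalues in $\Xi$), and every eigenfunction $\phi$ with eigenvalue in $\Xi$ decays faster than any sub-exponential: for every $\zeta\in(0,1)$ there is $C<\infty$ with $\|\chi_x\phi\|\le Ce^{-|x|^\zeta}$ for all $x\in\mathbb Z^d$. (ii) For every nonempty bounded open interval $I$ with $\overline I\subset\Xi$, the (almost everywhere) measurable function $\omega\mapsto\|\mu_\omega(\{\lambda\})\operatorname{tr}P_{\lambda,\omega}\|_{L^\infty(I,d\mu_\omega(\lambda))}$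 satisfies $$\mathbb E\left\{\big\|\mu_\omega(\{\lambda\})\,(\operatorname{tr}P_{\lambda,\omega})\big\|_{L^\infty(I,d\mu_\omega(\lambda))}\right\}\le C_I<\infty.$$ (iii) For $\mathbb P$-a.e. $\omega$, all eigenvalues of $H_\omega$ in $\Xi$ have finite multiplicity. -/

import Mathlib

open MeasureTheory Set Filter Topology
open scoped ENNReal NNReal

namespace RandomLoc

noncomputable section

/-! ### Unbounded operators and their spectral families -/

section Abstract

variable {𝓗 : Type*} [NormedAddCommGroup 𝓗] [InnerProductSpace ℂ 𝓗] [CompleteSpace 𝓗]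

/-- A projection-valued measure on the Borel sets of the real line.  The values of `proj` on
sets that are not Borel are irrelevant. -/
structure SpectralFamily (𝓗 : Type*) [NormedAddCommGroup 𝓗] [InnerProductSpace ℂ 𝓗]
    [CompleteSpace 𝓗] where
  proj : Set ℝ → 𝓗 →L[ℂ] 𝓗
  isStarProjection : ∀ B, MeasurableSet B → IsStarProjection (proj B)
  univ : proj univ = 1
  inter : ∀ B C, MeasurableSet B → MeasurableSet C → proj (B ∩ C) = proj B * proj C
  hasSum_iUnion : ∀ B : ℕ → Set ℝ, (∀ i, MeasurableSet (B i)) →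
    Pairwise (Function.onFun Disjoint B) →
      ∀ φ : 𝓗, HasSum (fun i => proj (B i) φ) (proj (⋃ i, B i) φ)

namespace SpectralFamily

variable (P : SpectralFamily 𝓗)

theorem proj_empty (φ : 𝓗) : P.proj ∅ φ = 0 := by
  have h := P.hasSum_iUnion (fun _ => ∅) (fun _ => MeasurableSet.empty)
    (fun i j _ => by simp [Function.onFun]) φ
  exact (summable_const_iff (P.proj ∅ φ)).1 h.summable

theorem inner_proj_self {B : Set ℝ} (hB : MeasurableSet B) (φ : 𝓗) :
    (inner ℂ φ (P.proj B φ)).re = ‖P.proj B φ‖ ^ 2 := by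
  have h := P.isStarProjection B hB
  have h1 : P.proj B (P.proj B φ) = P.proj B φ := by
    have := h.isIdempotentElem
    exact congrArg (fun A : 𝓗 →L[ℂ] 𝓗 => A φ) this
  have h2 : ContinuousLinearMap.adjoint (P.proj B) = P.proj B := h.isSelfAdjoint
  have h3 : inner ℂ φ (P.proj B φ) = inner ℂ (P.proj B φ) (P.proj B φ) := by
    conv_lhs => rw [← h1]
    rw [← ContinuousLinearMap.adjoint_inner_left, h2]
  rw [h3, inner_self_eq_norm_sq_to_K]
  norm_cast

/-- The scalar spectral measure `B ↦ ⟨φ, P_B φ⟩ = ‖P_B φ‖²` of the vector `φ`. -/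
def measure (φ : 𝓗) : Measure ℝ :=
  Measure.ofMeasurable (fun B _ => ENNReal.ofReal (‖P.proj B φ‖ ^ 2))
    (by simp [P.proj_empty])
    (by
      intro B hB hd
      have h := P.hasSum_iUnion B hB hd φ
      have h1 : HasSum (fun i => ‖P.proj (B i) φ‖ ^ 2) (‖P.proj (⋃ i, B i) φ‖ ^ 2) := by
        have h2 := (h.mapL (innerSL ℂ φ)).mapL Complex.reCLM
        simp only [innerSL_apply_apply, Complex.reCLM_apply] at h2
        rw [P.inner_proj_self (MeasurableSet.iUnion hB)] at h2
        simpa only [P.inner_proj_self (hB _)] using h2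
      rw [← h1.tsum_eq, ENNReal.ofReal_tsum_of_nonneg (fun i => by positivity) h1.summable])

theorem measure_apply (φ : 𝓗) {B : Set ℝ} (hB : MeasurableSet B) :
    P.measure φ B = ENNReal.ofReal (‖P.proj B φ‖ ^ 2) :=
  Measure.ofMeasurable_apply B hB

end SpectralFamily

/-- `P` is the spectral family of the operator `A`, i.e. `A = ∫ t dP(t)`: the domain of `A` is
`{φ | ∫ t² d⟨φ, P(t) φ⟩ < ∞}`, and `⟨φ, A φ⟩ = ∫ t d⟨φ, P(t) φ⟩` on it.  A self-adjoint operator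
has exactly one spectral family, and is determined by it. -/
structure IsSpectralFamilyOf (P : SpectralFamily 𝓗) (A : 𝓗 →ₗ.[ℂ] 𝓗) : Prop where
  mem_domain_iff : ∀ φ : 𝓗, φ ∈ A.domain ↔ ∫⁻ t, ENNReal.ofReal (t ^ 2) ∂(P.measure φ) < ∞
  inner_eq : ∀ φ : A.domain,
    inner ℂ (φ : 𝓗) (A φ) = ((∫ t, t ∂(P.measure (φ : 𝓗)) : ℝ) : ℂ)

/-- `R` is the (bounded, everywhere defined) inverse `(A - E)⁻¹`; such an `R` is unique, and it
exists if and only if `E` is not in the spectrum of `A`. -/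
def IsResolventAt (A : 𝓗 →ₗ.[ℂ] 𝓗) (E : ℝ) (R : 𝓗 →L[ℂ] 𝓗) : Prop :=
  (∀ φ : 𝓗, ∃ h : R φ ∈ A.domain, A ⟨R φ, h⟩ - (E : ℂ) • R φ = φ) ∧
    ∀ φ : A.domain, R (A φ - (E : ℂ) • (φ : 𝓗)) = φ

/-- The real part of the spectrum of an operator (all of the spectrum, if it is self-adjoint). -/
def realSpectrum (A : 𝓗 →ₗ.[ℂ] 𝓗) : Set ℝ :=
  {E | ¬ ∃ R : 𝓗 →L[ℂ] 𝓗, IsResolventAt A E R}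

/-- The eigenspace `{φ ∈ D(A) | A φ = E φ}`. -/
def eigenspace (A : 𝓗 →ₗ.[ℂ] 𝓗) (E : ℝ) : Submodule ℂ 𝓗 :=
  A.graph.comap (LinearMap.prod LinearMap.id ((E : ℂ) • LinearMap.id))

/-- The operator `A` with spectral family `P` has pure point spectrum in the Borel set `S`:
the spectral subspace of `S` is spanned by eigenvectors with eigenvalues in `S`. -/
def HasPurePointSpectrumIn (A : 𝓗 →ₗ.[ℂ] 𝓗) (P : SpectralFamily 𝓗) (S : Set ℝ) : Prop :=
  ∀ φ : 𝓗, P.proj S φ ∈ (⨆ E ∈ S, eigenspace A E).topologicalClosure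

/-- Index set of a fixed orthonormal basis. -/
def basisIndex (𝓗 : Type*) [NormedAddCommGroup 𝓗] [InnerProductSpace ℂ 𝓗] [CompleteSpace 𝓗] :
    Set 𝓗 :=
  (exists_hilbertBasis ℂ 𝓗).choose

/-- A fixed orthonormal basis; the trace of a positive operator does not depend on it. -/
def stdBasis (𝓗 : Type*) [NormedAddCommGroup 𝓗] [InnerProductSpace ℂ 𝓗] [CompleteSpace 𝓗] :
    HilbertBasis (basisIndex 𝓗) ℂ 𝓗 :=
  (exists_hilbertBasis ℂ 𝓗).choose_spec.choose

/-- The trace, in `[0, ∞]`, of a positive operator. -/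
def posTrace (A : 𝓗 →L[ℂ] 𝓗) : ℝ≥0∞ :=
  ∑' i, ENNReal.ofReal (inner ℂ (stdBasis 𝓗 i) (A (stdBasis 𝓗 i))).re

end Abstract

/-! ### The Hilbert spaces, boxes, weights and multiplication operators -/

/-- The Hilbert space of `ℂⁿ`-valued square integrable functions for a measure on `ℝᵈ`. -/
abbrev HSpace {d : ℕ} (ν : Measure (Fin d → ℝ)) (n : ℕ) : Type :=
  Lp (EuclideanSpace ℂ (Fin n)) 2 ν

/-- The point of `ℝᵈ` with the given integer coordinates. -/
def pt {d : ℕ} (x : Fin d → ℤ) : Fin d → ℝ := fun i => (x i : ℝ)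

/-- The two kinds of models: on `ℝᵈ`, and on `ℤᵈ`. -/
inductive Ambient
  | continuum
  | lattice

/-- Lebesgue measure on `ℝᵈ`, respectively the counting measure of `ℤᵈ ⊆ ℝᵈ`; the space
`L²` is then `L²(ℝᵈ, dx; ℂⁿ)`, respectively `ℓ²(ℤᵈ; ℂⁿ)`. -/
def Ambient.measure (𝔞 : Ambient) (d : ℕ) : Measure (Fin d → ℝ) :=
  match 𝔞 with
  | .continuum => volume
  | .lattice => Measure.sum fun k : Fin d → ℤ => Measure.dirac (pt k)

/-- The open cube of side `L` centered at `x` (the norm of `Fin d → ℝ` is the sup norm). -/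
def box {d : ℕ} (x : Fin d → ℤ) (L : ℝ) : Set (Fin d → ℝ) := Metric.ball (pt x) (L / 2)

/-- The closed cube of side `L` centered at `x`. -/
def closedBox {d : ℕ} (x : Fin d → ℤ) (L : ℝ) : Set (Fin d → ℝ) :=
  Metric.closedBall (pt x) (L / 2)

/-- The belt of width parameter `b` in the cube of side `L` centered at `x`. -/
def belt {d : ℕ} (b : ℝ) (x : Fin d → ℤ) (L : ℝ) : Set (Fin d → ℝ) :=
  closedBox x (L - 1) \ box x (L - b)

/-- The Euclidean length of a vector. -/
def eucl {d : ℕ} (x : Fin d → ℝ) : ℝ := Real.sqrt (∑ i, x i ^ 2)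

/-- `⟨x⟩ = √(1 + |x|²)`. -/
def jap {d : ℕ} (x : Fin d → ℝ) : ℝ := Real.sqrt (1 + eucl x ^ 2)

open Classical in
/-- Multiplication by the essentially bounded function `g` (`0` if `g` is not such a function). -/
def mulOp {d : ℕ} (ν : Measure (Fin d → ℝ)) (n : ℕ) (g : (Fin d → ℝ) → ℂ) :
    HSpace ν n →L[ℂ] HSpace ν n :=
  if hg : MemLp g ∞ ν then
    (ContinuousLinearMap.lsmul ℂ ℂ).holderL ν ∞ 2 2 (hg.toLp g)
  else 0

theorem mulOp_apply {d : ℕ} (ν : Measure (Fin d → ℝ)) (n : ℕ) {g : (Fin d → ℝ) → ℂ}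
    (hg : MemLp g ∞ ν) (φ : HSpace ν n) :
    mulOp ν n g φ =ᵐ[ν] fun x => g x • φ x := by
  rw [mulOp, dif_pos hg]
  have h := (ContinuousLinearMap.lsmul ℂ ℂ).coeFn_holder (r := 2) (hg.toLp g) φ
  filter_upwards [h, hg.coeFn_toLp] with x h1 h2
  have h3 : ((ContinuousLinearMap.lsmul ℂ ℂ).holderL ν ∞ 2 2 (hg.toLp g)) φ
      = (ContinuousLinearMap.lsmul ℂ ℂ).holder 2 (hg.toLp g) φ := rfl
  rw [h3, h1, h2]
  rfl

/-- Multiplication by the characteristic function of `S`. -/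
def cutoff {d : ℕ} (ν : Measure (Fin d → ℝ)) (n : ℕ) (S : Set (Fin d → ℝ)) :
    HSpace ν n →L[ℂ] HSpace ν n :=
  mulOp ν n (S.indicator 1)

/-- The operator `T⁻¹`: multiplication by `⟨x⟩^(-κ)`. -/
def Tinv {d : ℕ} (κ : ℝ) (ν : Measure (Fin d → ℝ)) (n : ℕ) : HSpace ν n →L[ℂ] HSpace ν n :=
  mulOp ν n (fun x => ((jap x ^ (-κ) : ℝ) : ℂ))

/-- The measure `B ↦ tr (T⁻¹ P_B T⁻¹)`. -/
def traceMeasure {d n : ℕ} {ν : Measure (Fin d → ℝ)} (κ : ℝ)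
    (P : SpectralFamily (HSpace ν n)) : Measure ℝ :=
  Measure.sum fun i => P.measure (Tinv κ ν n (stdBasis (HSpace ν n) i))

theorem inner_Tinv_left {d n : ℕ} {ν : Measure (Fin d → ℝ)} (κ : ℝ) (φ ψ : HSpace ν n) :
    inner ℂ (Tinv κ ν n φ) ψ = inner ℂ φ (Tinv κ ν n ψ) := by
  by_cases hg : MemLp (fun x : Fin d → ℝ => ((jap x ^ (-κ) : ℝ) : ℂ)) ∞ ν
  · rw [L2.inner_def, L2.inner_def]
    refine integral_congr_ae ?_
    filter_upwards [mulOp_apply ν n hg φ, mulOp_apply ν n hg ψ] with x h1 h2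
    rw [Tinv, h1, h2, inner_smul_left, inner_smul_right, Complex.conj_ofReal]
  · simp [Tinv, mulOp, dif_neg hg]

theorem traceMeasure_apply {d n : ℕ} {ν : Measure (Fin d → ℝ)} (κ : ℝ)
    (P : SpectralFamily (HSpace ν n)) {B : Set ℝ} (hB : MeasurableSet B) :
    traceMeasure κ P B = posTrace (Tinv κ ν n * P.proj B * Tinv κ ν n) := by
  rw [traceMeasure, Measure.sum_apply _ hB, posTrace]
  refine tsum_congr fun i => ?_
  rw [P.measure_apply _ hB, ← P.inner_proj_self hB, inner_Tinv_left]
  rfl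

/-- The space `𝓗₊`: the domain of the multiplication operator `T = ⟨x⟩^κ`. -/
def HPlus {d : ℕ} (κ : ℝ) (ν : Measure (Fin d → ℝ)) (n : ℕ) : Submodule ℂ (HSpace ν n) where
  carrier := {φ | MemLp (fun x => jap x ^ κ • φ x) 2 ν}
  add_mem' {φ ψ} hφ hψ := by
    refine (memLp_congr_ae ?_).1 (MemLp.add hφ hψ)
    filter_upwards [Lp.coeFn_add φ ψ] with x hx
    rw [hx]
    simp only [Pi.add_apply, smul_add]
  zero_mem' := by
    refine (memLp_congr_ae ?_).1 (MemLp.zero (μ := ν) (p := 2) (ε := EuclideanSpace ℂ (Fin n)))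
    filter_upwards [Lp.coeFn_zero (EuclideanSpace ℂ (Fin n)) 2 ν] with x hx
    rw [hx]
    simp only [Pi.zero_apply, smul_zero]
  smul_mem' c φ hφ := by
    refine (memLp_congr_ae ?_).1 (MemLp.const_smul hφ c)
    filter_upwards [Lp.coeFn_smul c φ] with x hx
    rw [hx]
    simp only [Pi.smul_apply]
    exact smul_comm _ _ _

/-- `‖1_S ψ‖`, the norm being that of `L²(ν)`. -/
def localNorm {d n : ℕ} (ν : Measure (Fin d → ℝ)) (S : Set (Fin d → ℝ))
    (ψ : (Fin d → ℝ) → EuclideanSpace ℂ (Fin n)) : ℝ :=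
  (eLpNorm (S.indicator ψ) 2 ν).toReal

/-! ### Generalized eigenfunctions -/

section GenEig

variable {d n : ℕ} {ν : Measure (Fin d → ℝ)}

/-- The set `{φ ∈ D(A) ∩ 𝓗₊ | A φ ∈ 𝓗₊}`. -/
def DPlus (κ : ℝ) (A : HSpace ν n →ₗ.[ℂ] HSpace ν n) : Submodule ℂ (HSpace ν n) :=
  (A.graph ⊓ (HPlus κ ν n).prod (HPlus κ ν n)).map (LinearMap.fst ℂ _ _)

/-- `ψ` is a generalized eigenfunction of `A` with generalized eigenvalue `E`: a nonzero element
of the weighted space `𝓗₋ = L²(⟨x⟩^(-2κ) dν)` with `⟨A φ, ψ⟩ = E ⟨φ, ψ⟩` for all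
`φ ∈ D(A) ∩ 𝓗₊` such that `A φ ∈ 𝓗₊`. -/
structure IsGenEigenfunction (κ : ℝ) (A : HSpace ν n →ₗ.[ℂ] HSpace ν n) (E : ℝ)
    (ψ : (Fin d → ℝ) → EuclideanSpace ℂ (Fin n)) : Prop where
  memLp : MemLp (fun x => jap x ^ (-κ) • ψ x) 2 ν
  ne_zero : ¬ ψ =ᵐ[ν] 0
  eq : ∀ φ η : HSpace ν n, (φ, η) ∈ A.graph → φ ∈ HPlus κ ν n → η ∈ HPlus κ ν n →
    ∫ x, inner ℂ (η x) (ψ x) ∂ν = (E : ℂ) * ∫ x, inner ℂ (φ x) (ψ x) ∂ν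

end GenEig

/-! ### Random operators, finite volume operators, standing assumptions -/

section Random

variable {Ω : Type*} [MeasurableSpace Ω]

/-- A measurable, `ℤᵈ`-covariant family of self-adjoint operators on the Hilbert space of the
model.  The spectral family `spec ω` is the one of `op ω`, and is determined by it.  Measurability
means that of `ω ↦ ⟨φ, f(H_ω) φ⟩ = ∫ f d⟨φ, P_ω φ⟩` for every bounded Borel function `f`.
The unitary `transl y` is `(U(y)φ)(x) = c_y(x) φ(x - y)` with `|c_y| = 1`: for `c_y = 1` these are
the translations, and for suitable `c_y` the magnetic translations. -/
structure RandomOperator (𝔞 : Ambient) (d n : ℕ) (Ω : Type*) [MeasurableSpace Ω]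
    [VAdd (Fin d → ℤ) Ω] where
  op : Ω → HSpace (𝔞.measure d) n →ₗ.[ℂ] HSpace (𝔞.measure d) n
  isSelfAdjoint : ∀ ω, IsSelfAdjoint (op ω)
  spec : Ω → SpectralFamily (HSpace (𝔞.measure d) n)
  isSpectralFamilyOf : ∀ ω, IsSpectralFamilyOf (spec ω) (op ω)
  measurable_inner : ∀ f : ℝ → ℝ, Measurable f → (∃ C, ∀ t, |f t| ≤ C) →
    ∀ φ, Measurable fun ω => ∫ t, f t ∂((spec ω).measure φ)
  phase : (Fin d → ℤ) → (Fin d → ℝ) → ℂ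
  measurable_phase : ∀ y, Measurable (phase y)
  norm_phase : ∀ y x, ‖phase y x‖ = 1
  transl : (Fin d → ℤ) → HSpace (𝔞.measure d) n ≃ₗᵢ[ℂ] HSpace (𝔞.measure d) n
  transl_apply : ∀ y φ,
    transl y φ =ᵐ[𝔞.measure d] fun x => phase y x • φ (x - pt y)
  covariance : ∀ y ω φ η, (φ, η) ∈ (op ω).graph ↔
    (transl y φ, transl y η) ∈ (op (y +ᵥ ω)).graph

/-- Finite volume operators: a self-adjoint operator on `L²` of each cube `Λ_L(x)`, for `x ∈ ℤᵈ`
and positive even `L`, and each `ω`. -/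
structure FiniteVolume (𝔞 : Ambient) (d n : ℕ) (Ω : Type*) where
  op : Ω → ∀ (x : Fin d → ℤ) (L : ℕ),
    HSpace ((𝔞.measure d).restrict (box x L)) n →ₗ.[ℂ]
      HSpace ((𝔞.measure d).restrict (box x L)) n
  isSelfAdjoint : ∀ ω x L, 0 < L → Even L → IsSelfAdjoint (op ω x L)

variable {𝔞 : Ambient} {d n : ℕ} [VAdd (Fin d → ℤ) Ω]

/-- Almost surely, `D₊ = {φ ∈ D(H_ω) ∩ 𝓗₊ | H_ω φ ∈ 𝓗₊}` is dense in `𝓗₊` and is an operator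
core for `H_ω`. -/
def HasCoreAssumption (κ : ℝ) (H : RandomOperator 𝔞 d n Ω) (ℙ : Measure Ω) : Prop :=
  ∀ᵐ ω ∂ℙ, (H.op ω).HasCore (DPlus κ (H.op ω)) ∧
    ∀ φ ∈ HPlus κ (𝔞.measure d) n, ∀ ε : ℝ≥0∞, 0 < ε → ∃ η ∈ DPlus κ (H.op ω),
      eLpNorm (fun x => jap x ^ κ • (φ x - η x)) 2 (𝔞.measure d) < ε

/-- The trace estimate: for a nonrandom nonnegative bounded continuous function `f` which is
strictly positive on the part of the spectrum of `H_ω` in the energy interval,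
`tr (T⁻¹ f(H_ω) T⁻¹) = ∫ f dμ_ω` is almost surely bounded by a nonrandom constant. -/
def TraceAssumption (κ : ℝ) (𝓘 : Set ℝ) (H : RandomOperator 𝔞 d n Ω) (ℙ : Measure Ω) : Prop :=
  ∃ f : ℝ → ℝ, Continuous f ∧ (∃ M, ∀ t, f t ≤ M) ∧ (∀ t, 0 ≤ f t) ∧ ∃ C : ℝ≥0, ∀ᵐ ω ∂ℙ,
    (∀ t ∈ 𝓘 ∩ realSpectrum (H.op ω), 0 < f t) ∧
      ∫⁻ t, ENNReal.ofReal (f t) ∂(traceMeasure κ (H.spec ω)) ≤ C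

/-- The eigenfunction decay inequality in the energy interval `𝓘`:
`‖χ_x ψ‖ ≤ γ ‖Γ_{x,L} (H_{ω,x,L} - E)⁻¹ χ_x‖ ‖Γ_{x,L} ψ‖`
for generalized eigenfunctions `ψ` with generalized eigenvalue `E ∉ σ(H_{ω,x,L})` in a compact
interval of energies, with `γ` depending only on that interval. -/
def EDIAssumption (κ b : ℝ) (𝓘 : Set ℝ) (H : RandomOperator 𝔞 d n Ω)
    (F : FiniteVolume 𝔞 d n Ω) (ℙ : Measure Ω) : Prop :=
  ∀ E₁ E₂ : ℝ, Icc E₁ E₂ ⊆ 𝓘 → ∃ γ : ℝ, ∀ᵐ ω ∂ℙ, ∀ E ∈ Icc E₁ E₂, ∀ ψ,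
    IsGenEigenfunction κ (H.op ω) E ψ →
    ∀ (x : Fin d → ℤ) (L : ℕ), 0 < L → Even L → ∀ R, IsResolventAt (F.op ω x L) E R →
      localNorm (𝔞.measure d) (box x 1) ψ ≤
        γ * ‖cutoff _ n (belt b x L) * R * cutoff _ n (box x 1)‖ *
          localNorm (𝔞.measure d) (belt b x L) ψ

/-! ### The region of complete localization -/

/-- The box `Λ_L(x)` is `(ω, m, E)`-regular. -/
def IsRegular (b : ℝ) (F : FiniteVolume 𝔞 d n Ω) (ω : Ω) (m E : ℝ) (x : Fin d → ℤ) (L : ℕ) :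
    Prop :=
  ∃ R, IsResolventAt (F.op ω x L) E R ∧
    ‖cutoff _ n (belt b x L) * R * cutoff _ n (box x ((L : ℝ) / 3))‖ ≤
      Real.exp (-m * ((L : ℝ) / 2))

/-- The event that for every energy in `I` one of the two boxes `Λ_L(x)`, `Λ_L(y)` is regular. -/
def goodEvent (b : ℝ) (F : FiniteVolume 𝔞 d n Ω) (m : ℝ) (L : ℕ) (I : Set ℝ)
    (x y : Fin d → ℤ) : Set Ω :=
  {ω | ∀ E ∈ I, IsRegular b F ω m E x L ∨ IsRegular b F ω m E y L}

/-- The length scales `L_{k+1} = [L_k^α]_{6ℕ}`, where `[K]_{6ℕ}` is the largest multiple of `6`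
that is at most `K`. -/
def scale (α : ℝ) (L₀ : ℕ) : ℕ → ℕ
  | 0 => L₀
  | k + 1 => 6 * ⌊((scale α L₀ k : ℕ) : ℝ) ^ α / 6⌋₊

/-- The region of complete localization in the open interval `𝓘`: the energies at which the
conclusions of the bootstrap multiscale analysis hold. -/
def regionCL (b ϱ : ℝ) (𝓘 : Set ℝ) (F : FiniteVolume 𝔞 d n Ω) (ℙ : Measure Ω) : Set ℝ :=
  {E | ∃ E₁ E₂ : ℝ, E ∈ Ioo E₁ E₂ ∧ Ioo E₁ E₂ ⊆ 𝓘 ∧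
    ∀ ζ α : ℝ, 0 < ζ → ζ < 1 → 1 < α → α < ζ⁻¹ →
      ∃ L₀ : ℕ, 6 ∣ L₀ ∧ StrictMono (scale α L₀) ∧ ∃ m : ℝ, 0 < m ∧
        ∀ (k : ℕ) (x y : Fin d → ℤ), (scale α L₀ k : ℝ) + ϱ < ‖pt x - pt y‖ →
          ℙ (goodEvent b F m (scale α L₀ k) (Ioo E₁ E₂) x y)ᶜ ≤
            ENNReal.ofReal (Real.exp (-((scale α L₀ k : ℝ) ^ ζ)))}

end Random

end

end RandomLoc

/-!
# Localization in the region of complete localization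

Two ingredients carry the argument. The deterministic one is an expansion in generalized
eigenfunctions. On a bounded interval where the measure `μ = tr (T⁻¹ P T⁻¹)` is finite, the
vector-valued set function `B ↦ T⁻¹ P_B T⁻¹ e` is dominated by `μ` and so has a density `K`
(`exists_density`), and `T K(t)` is a generalized eigenfunction with generalized eigenvalue `t`, or
zero, for `μ`-almost every `t` (`exists_genEigenfunction_density`). Hence, if every generalized
eigenvalue is an eigenvalue, then `P` lives on the countable set of atoms of `μ`, and the spectrum
is pure point (`exists_countable_proj_diff_eq_zero`, `hasPurePointSpectrumIn_of_countable`).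
Finiteness of `μ` on compact intervals comes with a nonrandom bound, by ergodicity
(`exists_traceMeasure_le`).

The probabilistic one is that two distant cubes are rarely both singular for a common energy. At
the distance `r` of the centers, the scale `ℓ r` satisfies `ℓ r ≤ r ≤ C (ℓ r)^α`, and the
probability of the event is at most `exp (-(ℓ r)^ζ)` (`HasScales`). By Borel-Cantelli, for each `x₀`
almost surely the cubes at `x₀` and at `x` are not both singular, for all but finitely many `x`.
Let `x₀` be a site where a generalized eigenfunction `ψ` does not vanish. As `ψ` grows at most
polynomially, the eigenfunction decay inequality forbids that the cubes at `x₀` of large scales are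
regular. So the cubes at distant `x` are regular, and `ψ` decays like `exp (-c |x|^(1/α))`
(`IsGenEigenfunction.eventually_locMass_le`). In particular `ψ` is square integrable, hence an
eigenfunction, because the eigenvalue equation extends from the core to the domain.

For the expectation, let `a_x` be the trace of `1_x P_{E}` over the unit cube at `x`. Then
`tr P_{E} = ∑ a_x` and `μ({E}) ≤ c ∑ ⟨x⟩^(-2κ) a_x`. By covariance all `a_x` are bounded by one
constant, and at regular cubes `a_x` is exponentially small. So `a_x a_y` is summably small in the
distance of `x` and `y`, off an event whose probability is summable in that distance. As `2κ > d`,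
the double sum that bounds `μ({E}) tr P_{E}` for all energies of an interval has finite expectation
(`IsLocInterval.exists_traceMeasure_mul_posTrace_le`). Since `μ({E}) > 0` at an eigenvalue, its
multiplicity is finite.

The essential supremum over `μ` is a supremum over points. For finite measures such a supremum of
products of masses of points is a limit of suprema over balls with rational centers
(`iSup_singleton_mul_eq`), which shows that it is measurable.
-/

set_option linter.unusedSectionVars false

namespace RandomLoc

/-! ### Spectral families and self-adjoint operators -/

section Spectral

variable {𝓗 : Type*} [NormedAddCommGroup 𝓗] [InnerProductSpace ℂ 𝓗] [CompleteSpace 𝓗]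

namespace SpectralFamily

variable (P : SpectralFamily 𝓗) {B C : Set ℝ}

theorem proj_proj (hB : MeasurableSet B) (hC : MeasurableSet C) (φ : 𝓗) :
    P.proj B (P.proj C φ) = P.proj (B ∩ C) φ := by
  rw [P.inter B C hB hC]; rfl

theorem proj_union (hB : MeasurableSet B) (hC : MeasurableSet C) (h : Disjoint B C) (φ : 𝓗) :
    P.proj (B ∪ C) φ = P.proj B φ + P.proj C φ := by
  have h1 := P.hasSum_iUnion (fun i => if i = 0 then B else if i = 1 then C else ∅)
    (by intro i; split_ifs <;> simp [hB, hC])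
    (by
      intro i j hij
      simp only [Function.onFun]
      split_ifs <;> first | omega | simp | simp [h.symm]) φ
  have h2 : (⋃ i : ℕ, (if i = 0 then B else if i = 1 then C else ∅)) = B ∪ C := by
    ext t
    simp only [mem_iUnion, mem_union]
    constructor
    · rintro ⟨i, hi⟩
      split_ifs at hi
      · exact Or.inl hi
      · exact Or.inr hi
      · exact hi.elim
    · rintro (ht | ht)
      · exact ⟨0, by simpa using ht⟩
      · exact ⟨1, by simpa using ht⟩
  rw [h2] at h1
  have h3 : ∀ i ∉ ({0, 1} : Finset ℕ),
      P.proj (if i = 0 then B else if i = 1 then C else ∅) φ = 0 := by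
    intro i hi
    simp only [Finset.mem_insert, Finset.mem_singleton, not_or] at hi
    rw [if_neg hi.1, if_neg hi.2, P.proj_empty]
  rw [← h1.tsum_eq, tsum_eq_sum h3]
  simp

theorem proj_compl (hB : MeasurableSet B) (φ : 𝓗) : P.proj Bᶜ φ = φ - P.proj B φ := by
  have h := P.proj_union hB hB.compl disjoint_compl_right φ
  rw [union_compl_self, P.univ] at h
  rw [eq_sub_iff_add_eq, add_comm]
  exact h.symm

theorem inner_proj_left (hB : MeasurableSet B) (φ ψ : 𝓗) :
    inner ℂ (P.proj B φ) ψ = inner ℂ φ (P.proj B ψ) := by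
  have h2 : ContinuousLinearMap.adjoint (P.proj B) = P.proj B :=
    (P.isStarProjection B hB).isSelfAdjoint
  conv_lhs => rw [← h2]
  exact ContinuousLinearMap.adjoint_inner_left _ _ _

theorem inner_proj_proj (hB : MeasurableSet B) (hC : MeasurableSet C) (φ ψ : 𝓗) :
    inner ℂ (P.proj B φ) (P.proj C ψ) = inner ℂ φ (P.proj (B ∩ C) ψ) := by
  rw [P.inner_proj_left hB, P.proj_proj hB hC]

theorem inner_proj_eq (hB : MeasurableSet B) (φ : 𝓗) :
    inner ℂ φ (P.proj B φ) = ((‖P.proj B φ‖ ^ 2 : ℝ) : ℂ) := by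
  have := P.inner_proj_proj hB hB φ φ
  rw [inter_self] at this
  rw [← this, inner_self_eq_norm_sq_to_K]
  norm_cast

theorem measure_univ (φ : 𝓗) : P.measure φ Set.univ = ENNReal.ofReal (‖φ‖ ^ 2) := by
  rw [P.measure_apply φ MeasurableSet.univ, P.univ]; rfl

instance isFiniteMeasure_measure (φ : 𝓗) : IsFiniteMeasure (P.measure φ) :=
  ⟨by rw [P.measure_univ]; exact ENNReal.ofReal_lt_top⟩

theorem measureReal_univ (φ : 𝓗) : (P.measure φ).real Set.univ = ‖φ‖ ^ 2 := by
  rw [Measure.real, P.measure_univ, ENNReal.toReal_ofReal (by positivity)]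

theorem measure_proj (hB : MeasurableSet B) (φ : 𝓗) :
    P.measure (P.proj B φ) = (P.measure φ).restrict B := by
  ext C hC
  rw [Measure.restrict_apply hC, P.measure_apply _ hC, P.measure_apply _ (hC.inter hB),
    P.proj_proj hC hB]

theorem proj_eq_zero_iff_measure (hB : MeasurableSet B) (φ : 𝓗) :
    P.proj B φ = 0 ↔ P.measure φ B = 0 := by
  rw [P.measure_apply φ hB, ENNReal.ofReal_eq_zero]
  constructor
  · intro h; simp [h]
  · intro h
    have h1 : ‖P.proj B φ‖ ^ 2 = 0 := le_antisymm h (by positivity)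
    simpa using h1

theorem proj_eq_zero_of_subset (hB : MeasurableSet B) (hC : MeasurableSet C) (h : B ⊆ C)
    (hz : P.proj C = 0) : P.proj B = 0 := by
  ext φ
  have := P.proj_proj hB hC φ
  rw [inter_eq_left.2 h, hz] at this
  simpa using this.symm

/-- Spectral measures add up over orthogonal spectral subspaces. -/
theorem measure_add (hB : MeasurableSet B) (φ ψ : 𝓗) :
    P.measure (P.proj B φ + P.proj Bᶜ ψ) =
      P.measure (P.proj B φ) + P.measure (P.proj Bᶜ ψ) := by
  ext C hC
  rw [Measure.add_apply, P.measure_apply _ hC, P.measure_apply _ hC, P.measure_apply _ hC,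
    ← ENNReal.ofReal_add (by positivity) (by positivity), map_add]
  congr 1
  rw [P.proj_proj hC hB, P.proj_proj hC hB.compl, @norm_add_sq ℂ,
    P.inner_proj_proj (hC.inter hB) (hC.inter hB.compl)]
  have : C ∩ B ∩ (C ∩ Bᶜ) = ∅ := by ext t; simp; tauto
  rw [this, P.proj_empty]
  simp

end SpectralFamily

variable {P : SpectralFamily 𝓗} {A : 𝓗 →ₗ.[ℂ] 𝓗}

theorem inner_map_symm (hA : IsSelfAdjoint A) (φ ψ : A.domain) :
    inner ℂ (A φ) (ψ : 𝓗) = inner ℂ (φ : 𝓗) (A ψ) := by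
  have h1 : LinearPMap.adjoint A = A := LinearPMap.isSelfAdjoint_def.1 hA
  have h := LinearPMap.adjoint_isFormalAdjoint (T := A) hA.dense_domain
  rw [h1] at h
  exact h φ ψ

/-- A self-adjoint operator has no proper symmetric extension by a single vector. -/
theorem mem_graph_of_inner (hA : IsSelfAdjoint A) {ψ η : 𝓗}
    (h : ∀ φ : A.domain, inner ℂ (A φ) ψ = inner ℂ (φ : 𝓗) η) : (ψ, η) ∈ A.graph := by
  have h1 : LinearPMap.adjoint A = A := LinearPMap.isSelfAdjoint_def.1 hA
  have h2 : ∀ φ : A.domain, inner ℂ η (φ : 𝓗) = inner ℂ ψ (A φ) := fun φ => by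
    rw [← inner_conj_symm, ← h φ, inner_conj_symm]
  have h3 : ψ ∈ (LinearPMap.adjoint A).domain :=
    LinearPMap.mem_adjoint_domain_of_exists _ ⟨η, h2⟩
  have h4 : LinearPMap.adjoint A ⟨ψ, h3⟩ = η :=
    LinearPMap.adjoint_apply_eq hA.dense_domain ⟨ψ, h3⟩ h2
  have h5 : (ψ, η) ∈ (LinearPMap.adjoint A).graph := by
    rw [LinearPMap.mem_graph_iff]
    exact ⟨⟨ψ, h3⟩, rfl, h4⟩
  rwa [h1] at h5

namespace IsSpectralFamilyOf

variable {B : Set ℝ}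

theorem proj_mem_domain (hP : IsSpectralFamilyOf P A) (hB : MeasurableSet B) {φ : 𝓗}
    (hφ : φ ∈ A.domain) : P.proj B φ ∈ A.domain := by
  rw [hP.mem_domain_iff, P.measure_proj hB]
  exact (lintegral_mono' Measure.restrict_le_self le_rfl).trans_lt ((hP.mem_domain_iff φ).1 hφ)

theorem proj_mem_domain_of_bounded (hP : IsSpectralFamilyOf P A) (hB : MeasurableSet B)
    {a b : ℝ} (hab : B ⊆ Icc a b) (φ : 𝓗) : P.proj B φ ∈ A.domain := by
  rw [hP.mem_domain_iff, P.measure_proj hB]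
  calc ∫⁻ t in B, ENNReal.ofReal (t ^ 2) ∂(P.measure φ)
      ≤ ∫⁻ _ in B, ENNReal.ofReal (a ^ 2 + b ^ 2) ∂(P.measure φ) := by
        refine setLIntegral_mono' hB fun t ht => ENNReal.ofReal_le_ofReal ?_
        obtain ⟨h1, h2⟩ := hab ht
        rcases le_total 0 t with h | h <;> nlinarith [sq_nonneg a, sq_nonneg b]
    _ < ∞ := by
        rw [lintegral_const]
        exact ENNReal.mul_lt_top ENNReal.ofReal_lt_top (measure_lt_top _ _)

theorem integrable_id (hP : IsSpectralFamilyOf P A) {φ : 𝓗} (hφ : φ ∈ A.domain) :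
    Integrable (fun t : ℝ => t) (P.measure φ) := by
  have h := (hP.mem_domain_iff φ).1 hφ
  have h2 : MemLp (fun t : ℝ => t) 2 (P.measure φ) := by
    rw [memLp_two_iff_integrable_sq (by fun_prop)]
    refine ⟨by fun_prop, ?_⟩
    rw [hasFiniteIntegral_iff_ofReal (Eventually.of_forall fun t => sq_nonneg t)]
    exact h
  exact h2.integrable (by norm_num)

theorem inner_map_sub (hP : IsSpectralFamilyOf P A) (φ : A.domain) (c : ℝ) :
    inner ℂ (φ : 𝓗) (A φ - (c : ℂ) • (φ : 𝓗)) =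
      ((∫ t, (t - c) ∂(P.measure (φ : 𝓗)) : ℝ) : ℂ) := by
  rw [inner_sub_right, hP.inner_eq, inner_smul_right, inner_self_eq_norm_sq_to_K,
    integral_sub (hP.integrable_id φ.2) (integrable_const _), integral_const,
    P.measureReal_univ]
  push_cast
  simp [mul_comm]

/-- Vectors in complementary spectral subspaces are orthogonal for the form of `A`. -/
theorem inner_map_compl (hA : IsSelfAdjoint A) (hP : IsSpectralFamilyOf P A)
    (hB : MeasurableSet B) (φ ψ : A.domain) (hφ : P.proj B (φ : 𝓗) = φ)
    (hψ : P.proj Bᶜ (ψ : 𝓗) = ψ) : inner ℂ (φ : 𝓗) (A ψ) = 0 := by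
  have key : ∀ ψ : A.domain, P.proj Bᶜ (ψ : 𝓗) = ψ → (inner ℂ (φ : 𝓗) (A ψ)).re = 0 := by
    intro ψ hψ
    have h1 := hP.inner_eq (φ + ψ)
    have h2 : P.measure ((φ + ψ : A.domain) : 𝓗) = P.measure (φ : 𝓗) + P.measure (ψ : 𝓗) := by
      have := P.measure_add hB (φ : 𝓗) (ψ : 𝓗)
      rwa [hφ, hψ] at this
    rw [h2, integral_add_measure (hP.integrable_id φ.2) (hP.integrable_id ψ.2)] at h1
    have h3 := hP.inner_eq φ
    have h4 := hP.inner_eq ψ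
    rw [LinearPMap.map_add, Submodule.coe_add, inner_add_left, inner_add_right, inner_add_right,
      h3, h4] at h1
    have h5 : inner ℂ (ψ : 𝓗) (A φ) = (starRingEnd ℂ) (inner ℂ (φ : 𝓗) (A ψ)) := by
      rw [← inner_map_symm hA φ ψ, inner_conj_symm]
    rw [h5] at h1
    have h6 := congrArg Complex.re h1
    simp only [Complex.add_re, Complex.ofReal_re, Complex.conj_re] at h6
    linarith
  apply Complex.ext
  · exact key ψ hψ
  · have h := key (Complex.I • ψ) (by rw [Submodule.coe_smul, map_smul, hψ])
    rw [LinearPMap.map_smul, inner_smul_right, Complex.I_mul_re] at h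
    simpa using h

theorem inner_map_proj (hA : IsSelfAdjoint A) (hP : IsSpectralFamilyOf P A)
    (hB : MeasurableSet B) (φ ψ : A.domain) (hψ : P.proj B (ψ : 𝓗) = ψ) :
    inner ℂ (φ : 𝓗) (A ψ) = inner ℂ (P.proj B (φ : 𝓗)) (A ψ) := by
  have h := inner_map_compl hA hP hB.compl ⟨P.proj Bᶜ (φ : 𝓗), hP.proj_mem_domain hB.compl φ.2⟩
    ψ (by simp [P.proj_proj hB.compl hB.compl]) (by simpa using hψ)
  dsimp only at h
  rw [P.proj_compl hB, inner_sub_left, sub_eq_zero] at h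
  exact h

/-- On the spectral subspace of a set `B ⊆ [c - ε, c + ε]` the operator `A - c` has norm at
most `ε`: this is the bound on its quadratic form, by polarization. -/
theorem norm_map_sub_le (hA : IsSelfAdjoint A) (hP : IsSpectralFamilyOf P A)
    (hB : MeasurableSet B) {c ε : ℝ} (hBc : B ⊆ Icc (c - ε) (c + ε)) (φ : A.domain)
    (hφ : P.proj B (φ : 𝓗) = φ) : ‖A φ - (c : ℂ) • (φ : 𝓗)‖ ≤ ε * ‖(φ : 𝓗)‖ := by
  have hq : ∀ u : A.domain, P.proj B (u : 𝓗) = u →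
      |(inner ℂ (u : 𝓗) (A u - (c : ℂ) • (u : 𝓗))).re| ≤ ε * ‖(u : 𝓗)‖ ^ 2 := by
    intro u hu
    rw [hP.inner_map_sub, Complex.ofReal_re]
    have h1 : ∀ᵐ t ∂(P.measure (u : 𝓗)), ‖t - c‖ ≤ ε := by
      rw [← hu, P.measure_proj hB]
      refine (ae_restrict_mem hB).mono fun t ht => ?_
      rw [Real.norm_eq_abs, abs_le]
      constructor <;> linarith [(hBc ht).1, (hBc ht).2]
    have h2 := norm_integral_le_of_norm_le_const h1
    rwa [P.measureReal_univ, Real.norm_eq_abs] at h2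
  -- `A φ - c φ` lies in the closure of the range of `P B`
  have hw : P.proj B (A φ - (c : ℂ) • (φ : 𝓗)) = A φ - (c : ℂ) • (φ : 𝓗) := by
    rw [map_sub, map_smul, hφ]
    congr 1
    refine hA.dense_domain.eq_of_inner_right (𝕜 := ℂ) fun v hv => ?_
    rw [← P.inner_proj_left hB]
    exact (inner_map_proj hA hP hB ⟨v, hv⟩ φ hφ).symm
  set w : 𝓗 := A φ - (c : ℂ) • (φ : 𝓗) with hw_def
  have hwD : w ∈ A.domain := by
    rw [← hw]; exact hP.proj_mem_domain_of_bounded hB hBc w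
  rcases eq_or_ne w 0 with h0 | h0
  · rw [h0, norm_zero]
    have h1 := hq φ hφ
    rcases eq_or_ne (φ : 𝓗) 0 with h2 | h2
    · simp [h2]
    · have h3 : 0 < ‖(φ : 𝓗)‖ := norm_pos_iff.2 h2
      have h4 : 0 ≤ ε * ‖(φ : 𝓗)‖ ^ 2 := (abs_nonneg _).trans h1
      have h5 : 0 ≤ ε := nonneg_of_mul_nonneg_left h4 (by positivity)
      positivity
  have hφ0 : (φ : 𝓗) ≠ 0 := by
    intro h
    have h' : φ = 0 := Subtype.ext h
    exact h0 (by rw [hw_def, h']; simp)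
  have hwp : 0 < ‖w‖ := norm_pos_iff.2 h0
  have hφp : 0 < ‖(φ : 𝓗)‖ := norm_pos_iff.2 hφ0
  -- Let `u` be the multiple of `w` with the norm of `φ`.  The values of the form at `u + φ` and
  -- `u - φ` differ by `4 ⟨u, w⟩ = 4 ‖φ‖ ‖w‖`.
  set s : ℝ := ‖(φ : 𝓗)‖ / ‖w‖ with hs
  set u : A.domain := (s : ℂ) • ⟨w, hwD⟩ with hu
  have hu1 : (u : 𝓗) = (s : ℂ) • w := rfl
  have hup : P.proj B (u : 𝓗) = u := by rw [hu1, map_smul, hw]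
  have hplus := hq (u + φ) (by rw [Submodule.coe_add, map_add, hup, hφ])
  have hminus := hq (u - φ) (by rw [Submodule.coe_sub, map_sub, hup, hφ])
  have hsym : (inner ℂ (φ : 𝓗) (A u - (c : ℂ) • (u : 𝓗))).re =
      (inner ℂ (u : 𝓗) w).re := by
    rw [hw_def, inner_sub_right, inner_sub_right, Complex.sub_re, Complex.sub_re,
      ← inner_map_symm hA φ u, inner_smul_right, inner_smul_right, Complex.re_ofReal_mul,
      Complex.re_ofReal_mul, ← inner_conj_symm (A φ), ← inner_conj_symm (φ : 𝓗) (u : 𝓗),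
      Complex.conj_re, Complex.conj_re]
  have hpar := parallelogram_law_with_norm ℂ (u : 𝓗) (φ : 𝓗)
  have hval : (inner ℂ (u : 𝓗) w).re = ‖(φ : 𝓗)‖ * ‖w‖ := by
    rw [hu1, inner_smul_left, Complex.conj_ofReal, Complex.re_ofReal_mul,
      show (inner ℂ w w).re = ‖w‖ ^ 2 from inner_self_eq_norm_sq (𝕜 := ℂ) w, hs]
    field_simp
  have hun : ‖(u : 𝓗)‖ = ‖(φ : 𝓗)‖ := by
    rw [hu1, norm_smul, Complex.norm_real, Real.norm_eq_abs, abs_of_nonneg (by positivity), hs]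
    field_simp
  have e1 : (inner ℂ ((u + φ : A.domain) : 𝓗)
      (A (u + φ) - (c : ℂ) • ((u + φ : A.domain) : 𝓗))).re =
      (inner ℂ (u : 𝓗) (A u - (c : ℂ) • (u : 𝓗))).re + (inner ℂ (φ : 𝓗) w).re +
        2 * (inner ℂ (u : 𝓗) w).re := by
    have : A (u + φ) - (c : ℂ) • ((u + φ : A.domain) : 𝓗) = (A u - (c : ℂ) • (u : 𝓗)) + w := by
      rw [LinearPMap.map_add, Submodule.coe_add, smul_add, hw_def]; abel
    rw [this, Submodule.coe_add, inner_add_left, inner_add_right, inner_add_right,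
      Complex.add_re, Complex.add_re, Complex.add_re, hsym]
    ring
  have e2 : (inner ℂ ((u - φ : A.domain) : 𝓗)
      (A (u - φ) - (c : ℂ) • ((u - φ : A.domain) : 𝓗))).re =
      (inner ℂ (u : 𝓗) (A u - (c : ℂ) • (u : 𝓗))).re + (inner ℂ (φ : 𝓗) w).re -
        2 * (inner ℂ (u : 𝓗) w).re := by
    have : A (u - φ) - (c : ℂ) • ((u - φ : A.domain) : 𝓗) = (A u - (c : ℂ) • (u : 𝓗)) - w := by
      rw [LinearPMap.map_sub, Submodule.coe_sub, smul_sub, hw_def]; abel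
    rw [this, Submodule.coe_sub]
    clear this e1 hplus hminus
    clear_value w
    generalize A u - (c : ℂ) • (u : 𝓗) = z at hsym ⊢
    rw [inner_sub_left, inner_sub_right, inner_sub_right,
      Complex.sub_re, Complex.sub_re, Complex.sub_re, hsym]
    ring
  rw [e1] at hplus
  rw [e2] at hminus
  rw [hval] at hplus hminus
  rw [Submodule.coe_add] at hplus
  rw [Submodule.coe_sub] at hminus
  rw [hun] at hpar
  have h6 : ‖(φ : 𝓗)‖ * ‖w‖ ≤ ε * (‖(φ : 𝓗)‖ * ‖(φ : 𝓗)‖) := by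
    have a1 := (abs_le.1 hplus).2
    have a2 := (abs_le.1 hminus).1
    have a3 := congrArg (fun r => ε * r) hpar
    linarith
  nlinarith

/-- If no spectrum lies within `ε` of `c`, then `A - c` is bounded below by `ε`: test
`(A - c)φ` against `φ₊ - φ₋`, the difference of the spectral parts above and below `c`. -/
theorem norm_map_sub_ge (hA : IsSelfAdjoint A) (hP : IsSpectralFamilyOf P A) {c ε : ℝ}
    (hz : P.proj (Ioo (c - ε) (c + ε)) = 0) (φ : A.domain) :
    ε * ‖(φ : 𝓗)‖ ≤ ‖A φ - (c : ℂ) • (φ : 𝓗)‖ := by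
  have hB : MeasurableSet (Ici c) := measurableSet_Ici
  set p : A.domain := ⟨P.proj (Ici c) (φ : 𝓗), hP.proj_mem_domain hB φ.2⟩ with hp
  set q : A.domain := ⟨P.proj (Ici c)ᶜ (φ : 𝓗), hP.proj_mem_domain hB.compl φ.2⟩ with hq
  have hp1 : P.proj (Ici c) (p : 𝓗) = p := by simp [hp, P.proj_proj hB hB]
  have hq1 : P.proj (Ici c)ᶜ (q : 𝓗) = q := by
    rw [hq]; dsimp only; rw [P.proj_proj hB.compl hB.compl, inter_self]
  have hsum : φ = p + q := Subtype.ext (by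
    rw [Submodule.coe_add, hp, hq]; dsimp only; rw [P.proj_compl hB, add_sub_cancel])
  have hpq : inner ℂ (p : 𝓗) (q : 𝓗) = 0 := by
    rw [← hp1, ← hq1, P.inner_proj_proj hB hB.compl, inter_compl_self, P.proj_empty,
      inner_zero_right]
  have hqp : inner ℂ (q : 𝓗) (p : 𝓗) = 0 := by rw [← inner_conj_symm, hpq, map_zero]
  have hApq := inner_map_compl hA hP hB p q hp1 hq1
  have hAqp := inner_map_compl hA hP hB.compl q p hq1 (by rw [compl_compl, hp1])
  have hnull : ∀ᵐ t ∂(P.measure (φ : 𝓗)), t ∉ Ioo (c - ε) (c + ε) := by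
    rw [ae_iff]
    simp only [not_not]
    rw [ofPred_mem_eq, P.measure_apply _ measurableSet_Ioo, hz]
    simp
  have hpv : ε * ‖(p : 𝓗)‖ ^ 2 ≤ (inner ℂ (p : 𝓗) (A p - (c : ℂ) • (p : 𝓗))).re := by
    rw [hP.inner_map_sub, Complex.ofReal_re, ← P.measureReal_univ, mul_comm, ← smul_eq_mul,
      ← integral_const]
    refine integral_mono_ae (integrable_const _)
      ((hP.integrable_id p.2).sub (integrable_const _)) ?_
    rw [show (p : 𝓗) = P.proj (Ici c) (φ : 𝓗) from rfl, P.measure_proj hB]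
    filter_upwards [ae_restrict_of_ae hnull, ae_restrict_mem hB] with t h1 h2
    by_contra h3
    exact h1 ⟨by linarith [mem_Ici.1 h2], by linarith⟩
  have hqv : (inner ℂ (q : 𝓗) (A q - (c : ℂ) • (q : 𝓗))).re ≤ -ε * ‖(q : 𝓗)‖ ^ 2 := by
    rw [hP.inner_map_sub, Complex.ofReal_re, ← P.measureReal_univ, mul_comm, ← smul_eq_mul,
      ← integral_const]
    refine integral_mono_ae ((hP.integrable_id q.2).sub (integrable_const _))
      (integrable_const _) ?_
    rw [show (q : 𝓗) = P.proj (Ici c)ᶜ (φ : 𝓗) from rfl, P.measure_proj hB.compl]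
    filter_upwards [ae_restrict_of_ae hnull, ae_restrict_mem hB.compl] with t h1 h2
    have h2' : t < c := by simpa using h2
    by_contra h3
    exact h1 ⟨by linarith, by linarith⟩
  have hval : (inner ℂ ((p : 𝓗) - q) (A φ - (c : ℂ) • (φ : 𝓗))).re =
      (inner ℂ (p : 𝓗) (A p - (c : ℂ) • (p : 𝓗))).re -
        (inner ℂ (q : 𝓗) (A q - (c : ℂ) • (q : 𝓗))).re := by
    have h1 : A φ - (c : ℂ) • (φ : 𝓗) =
        (A p - (c : ℂ) • (p : 𝓗)) + (A q - (c : ℂ) • (q : 𝓗)) := by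
      rw [hsum, LinearPMap.map_add, Submodule.coe_add, smul_add]; abel
    have h2 : inner ℂ (p : 𝓗) (A q - (c : ℂ) • (q : 𝓗)) = 0 := by
      rw [inner_sub_right, hApq, inner_smul_right, hpq]; simp
    have h3 : inner ℂ (q : 𝓗) (A p - (c : ℂ) • (p : 𝓗)) = 0 := by
      rw [inner_sub_right, hAqp, inner_smul_right, hqp]; simp
    rw [h1, inner_add_right, inner_sub_left, inner_sub_left, h2, h3, zero_sub, sub_zero,
      Complex.add_re, Complex.neg_re, ← sub_eq_add_neg]
  have hn1 : ‖(φ : 𝓗)‖ ^ 2 = ‖(p : 𝓗)‖ ^ 2 + ‖(q : 𝓗)‖ ^ 2 := by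
    rw [hsum, Submodule.coe_add, @norm_add_sq ℂ, hpq]; simp
  have hn2 : ‖(p : 𝓗) - q‖ ^ 2 = ‖(p : 𝓗)‖ ^ 2 + ‖(q : 𝓗)‖ ^ 2 := by
    rw [@norm_sub_sq ℂ, hpq]; simp
  have hn3 : ‖(p : 𝓗) - q‖ = ‖(φ : 𝓗)‖ := by
    rw [← abs_of_nonneg (norm_nonneg ((p : 𝓗) - q)), ← abs_of_nonneg (norm_nonneg (φ : 𝓗)),
      ← sq_eq_sq_iff_abs_eq_abs, hn1, hn2]
  have hcs : (inner ℂ ((p : 𝓗) - q) (A φ - (c : ℂ) • (φ : 𝓗))).re ≤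
      ‖(φ : 𝓗)‖ * ‖A φ - (c : ℂ) • (φ : 𝓗)‖ := by
    rw [← hn3]
    exact re_inner_le_norm (𝕜 := ℂ) _ _
  rcases eq_or_ne (φ : 𝓗) 0 with h0 | h0
  · simp [h0]
  · have h4 : 0 < ‖(φ : 𝓗)‖ := norm_pos_iff.2 h0
    have h5 : ‖(φ : 𝓗)‖ * (ε * ‖(φ : 𝓗)‖) ≤ ‖(φ : 𝓗)‖ * ‖A φ - (c : ℂ) • (φ : 𝓗)‖ := by
      refine le_trans (le_of_eq ?_) ((add_le_add hpv (neg_le_neg hqv)).trans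
        ((le_of_eq ?_).trans hcs))
      · linear_combination ε * hn1
      · rw [hval, ← sub_eq_add_neg]
    exact le_of_mul_le_mul_left h5 h4

end IsSpectralFamilyOf

theorem mem_eigenspace_iff_graph {E : ℝ} {φ : 𝓗} :
    φ ∈ eigenspace A E ↔ (φ, (E : ℂ) • φ) ∈ A.graph := Iff.rfl

theorem mem_eigenspace_iff_apply {E : ℝ} {φ : 𝓗} :
    φ ∈ eigenspace A E ↔ ∃ h : φ ∈ A.domain, A ⟨φ, h⟩ = (E : ℂ) • φ := by
  rw [mem_eigenspace_iff_graph, LinearPMap.mem_graph_iff]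
  constructor
  · rintro ⟨y, h1, h2⟩
    dsimp only at h1 h2
    subst h1
    exact ⟨y.2, h2⟩
  · rintro ⟨h, h1⟩
    exact ⟨⟨φ, h⟩, rfl, h1⟩

/-- The eigenspace at `E` is the range of the spectral projection of `{E}`. -/
theorem IsSpectralFamilyOf.mem_eigenspace_iff (hA : IsSelfAdjoint A)
    (hP : IsSpectralFamilyOf P A) {E : ℝ} {φ : 𝓗} :
    φ ∈ eigenspace A E ↔ P.proj {E} φ = φ := by
  rw [mem_eigenspace_iff_apply]
  constructor
  · rintro ⟨h, hE⟩
    -- The form of `A - E` vanishes on all spectral parts of `φ`; on those above and below `E` the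
    -- integrand `t - E` has a sign, so they vanish.
    have key : ∀ B : Set ℝ, MeasurableSet B →
        ∫ t in B, (t - E) ∂(P.measure φ) = 0 := by
      intro B hB
      set p : A.domain := ⟨P.proj B φ, hP.proj_mem_domain hB h⟩ with hp
      have hpp : P.proj B (p : 𝓗) = p := by
        rw [hp]; dsimp only; rw [P.proj_proj hB hB, inter_self]
      have h1 := hP.inner_map_sub p E
      have h2 := hP.inner_map_proj hA hB ⟨φ, h⟩ p hpp
      have h3 : inner ℂ (p : 𝓗) (p : 𝓗) = inner ℂ φ (p : 𝓗) := by
        rw [hp]; dsimp only; rw [P.inner_proj_left hB, P.proj_proj hB hB, inter_self]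
      rw [← inner_map_symm hA, hE, inner_smul_left, Complex.conj_ofReal] at h2
      rw [inner_sub_right, inner_smul_right, ← h2, h3, sub_self,
        show P.measure (p : 𝓗) = (P.measure φ).restrict B from P.measure_proj hB φ] at h1
      exact_mod_cast h1.symm
    have hint : Integrable (fun t => t - E) (P.measure φ) :=
      (hP.integrable_id h).sub (integrable_const _)
    have hgt : P.proj (Ioi E) φ = 0 := by
      rw [P.proj_eq_zero_iff_measure measurableSet_Ioi]
      have h1 := (setIntegral_eq_zero_iff_of_nonneg_ae
        ((ae_restrict_mem measurableSet_Ioi).mono fun t ht => (sub_pos.2 (mem_Ioi.1 ht)).le)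
        hint.integrableOn).1 (key _ measurableSet_Ioi)
      have h2 := h1.and (ae_restrict_mem measurableSet_Ioi)
      rw [ae_iff] at h2
      rw [← Measure.restrict_apply_self]
      refine measure_mono_null (fun t ht => ?_) h2
      rintro ⟨h3, -⟩
      exact (sub_pos.2 (mem_Ioi.1 ht)).ne' h3
    have hlt : P.proj (Iio E) φ = 0 := by
      rw [P.proj_eq_zero_iff_measure measurableSet_Iio]
      have h0 : ∫ t in Iio E, (E - t) ∂(P.measure φ) = 0 := by
        rw [← neg_eq_zero, ← integral_neg]
        simpa using key _ measurableSet_Iio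
      have h1 := (setIntegral_eq_zero_iff_of_nonneg_ae
        ((ae_restrict_mem measurableSet_Iio).mono fun t ht => (sub_pos.2 (mem_Iio.1 ht)).le)
        ((integrable_const E).sub (hP.integrable_id h)).integrableOn).1 h0
      have h2 := h1.and (ae_restrict_mem measurableSet_Iio)
      rw [ae_iff] at h2
      rw [← Measure.restrict_apply_self]
      refine measure_mono_null (fun t ht => ?_) h2
      rintro ⟨h3, -⟩
      exact (sub_pos.2 (mem_Iio.1 ht)).ne' h3
    have h1 := P.proj_union (measurableSet_Iio (a := E)) measurableSet_Ioi
      (Set.disjoint_left.2 fun t h1 h2 => lt_asymm (mem_Iio.1 h1) (mem_Ioi.1 h2)) φ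
    rw [hgt, hlt, add_zero, Iio_union_Ioi, P.proj_compl (measurableSet_singleton E)] at h1
    exact (sub_eq_zero.1 h1).symm
  · intro h
    have hD : φ ∈ A.domain := by
      rw [← h]
      exact hP.proj_mem_domain_of_bounded (a := E) (b := E) (measurableSet_singleton E)
        (by simp) φ
    refine ⟨hD, ?_⟩
    have h1 := hP.norm_map_sub_le hA (measurableSet_singleton E) (c := E) (ε := 0) (by simp)
      ⟨φ, hD⟩ h
    rw [zero_mul] at h1
    exact sub_eq_zero.1 (norm_le_zero_iff.1 h1)

/-- A self-adjoint operator for which `A - c` is bounded below has a resolvent at `c`: the range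
of `A - c` is closed, and its orthogonal complement consists of eigenvectors. -/
theorem exists_isResolventAt (hA : IsSelfAdjoint A) {c ε : ℝ} (hε : 0 < ε)
    (h : ∀ φ : A.domain, ε * ‖(φ : 𝓗)‖ ≤ ‖A φ - (c : ℂ) • (φ : 𝓗)‖) :
    ∃ R : 𝓗 →L[ℂ] 𝓗, IsResolventAt A c R := by
  set L : A.domain →ₗ[ℂ] 𝓗 := A.toFun - (c : ℂ) • A.domain.subtype with hL
  have hLa : ∀ φ : A.domain, L φ = A φ - (c : ℂ) • (φ : 𝓗) := fun _ => rfl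
  have hinj : Function.Injective L := by
    rw [← LinearMap.ker_eq_bot, LinearMap.ker_eq_bot']
    intro φ hφ
    have h1 := h φ
    rw [← hLa, hφ, norm_zero] at h1
    have h2 : ‖(φ : 𝓗)‖ ≤ 0 := by
      by_contra h3
      push Not at h3
      nlinarith
    exact Subtype.ext (norm_le_zero_iff.1 h2)
  have hclosed : IsClosed (LinearMap.range L : Set 𝓗) := by
    rw [← isSeqClosed_iff_isClosed]
    intro y y0 hy hy0
    choose φ hφ using hy
    have hcau : CauchySeq (fun k => (φ k : 𝓗)) := by
      rw [Metric.cauchySeq_iff]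
      intro δ hδ
      obtain ⟨N, hN⟩ := Metric.cauchySeq_iff.1 hy0.cauchySeq (ε * δ) (by positivity)
      refine ⟨N, fun j hj k hk => ?_⟩
      have h1 := hN j hj k hk
      have h2 := h (φ j - φ k)
      rw [← hLa, map_sub, hφ, hφ, ← dist_eq_norm, Submodule.coe_sub, ← dist_eq_norm] at h2
      exact lt_of_mul_lt_mul_left (h2.trans_lt h1) hε.le
    obtain ⟨φ0, hφ0⟩ := cauchySeq_tendsto_of_complete hcau
    have hAφ : Tendsto (fun k => A (φ k)) atTop (𝓝 (y0 + (c : ℂ) • φ0)) := by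
      have h1 := hy0.add (hφ0.const_smul (c : ℂ))
      refine h1.congr fun k => ?_
      rw [← hφ k, hLa]; simp
    have hg : (φ0, y0 + (c : ℂ) • φ0) ∈ A.graph := by
      have hc : IsClosed (A.graph : Set (𝓗 × 𝓗)) := hA.isClosed
      refine hc.mem_of_tendsto (hφ0.prodMk_nhds hAφ) (Eventually.of_forall fun k => ?_)
      exact A.mem_graph (φ k)
    rw [LinearPMap.mem_graph_iff] at hg
    obtain ⟨z, hz1, hz2⟩ := hg
    refine ⟨z, ?_⟩
    rw [hLa, hz2, hz1]; simp
  have hsurj : LinearMap.range L = ⊤ := by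
    have : (LinearMap.range L)ᗮ = ⊥ := by
      rw [Submodule.eq_bot_iff]
      intro u hu
      rw [Submodule.mem_orthogonal] at hu
      have hg : (u, (c : ℂ) • u) ∈ A.graph := by
        refine mem_graph_of_inner hA fun φ => ?_
        have h1 := hu (L φ) ⟨φ, rfl⟩
        rw [hLa, inner_sub_left, inner_smul_left, Complex.conj_ofReal, sub_eq_zero] at h1
        rw [h1, inner_smul_right]
      obtain ⟨hu1, hu2⟩ := mem_eigenspace_iff_apply.1 hg
      have h1 := h ⟨u, hu1⟩
      rw [hu2, sub_self, norm_zero] at h1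
      have h2 : ‖u‖ ≤ 0 := by
        by_contra h3
        push Not at h3
        dsimp only at h1
        nlinarith
      exact norm_le_zero_iff.1 h2
    have : CompleteSpace (LinearMap.range L) := hclosed.completeSpace_coe
    rwa [← Submodule.orthogonal_eq_bot_iff]
  let e : A.domain ≃ₗ[ℂ] 𝓗 := LinearEquiv.ofBijective L ⟨hinj, LinearMap.range_eq_top.1 hsurj⟩
  have he : ∀ φ, e φ = A φ - (c : ℂ) • (φ : 𝓗) := fun _ => rfl
  refine ⟨LinearMap.mkContinuous (A.domain.subtype ∘ₗ e.symm.toLinearMap) ε⁻¹ fun y => ?_,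
    fun y => ⟨(e.symm y).2, ?_⟩, fun φ => ?_⟩
  · have h1 := h (e.symm y)
    rw [← he, e.apply_symm_apply] at h1
    rw [inv_mul_eq_div, le_div_iff₀ hε, mul_comm]
    exact h1
  · have h1 := he (e.symm y)
    rw [e.apply_symm_apply] at h1
    exact h1.symm
  · have h1 : e.symm (A φ - (c : ℂ) • (φ : 𝓗)) = φ := by rw [← he, e.symm_apply_apply]
    exact congrArg Subtype.val h1

/-- The constant is chosen below `‖R‖⁻¹`, to make the inequality strict. -/
theorem IsResolventAt.exists_norm_ge {E : ℝ} {R : 𝓗 →L[ℂ] 𝓗} (hR : IsResolventAt A E R) :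
    ∃ ε : ℝ, 0 < ε ∧ ∀ φ : A.domain, ‖(φ : 𝓗)‖ ≠ 0 →
      ε * ‖(φ : 𝓗)‖ < ‖A φ - (E : ℂ) • (φ : 𝓗)‖ := by
  refine ⟨(‖R‖ + 1)⁻¹, by positivity, fun φ hφ => ?_⟩
  have h1 : ‖(φ : 𝓗)‖ ≤ ‖R‖ * ‖A φ - (E : ℂ) • (φ : 𝓗)‖ := by
    conv_lhs => rw [← hR.2 φ]
    exact R.le_opNorm _
  have h2 : 0 < ‖(φ : 𝓗)‖ := lt_of_le_of_ne (norm_nonneg _) hφ.symm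
  have h3 : 0 < ‖A φ - (E : ℂ) • (φ : 𝓗)‖ := by
    by_contra h4
    have h5 : ‖A φ - (E : ℂ) • (φ : 𝓗)‖ = 0 := le_antisymm (not_lt.1 h4) (norm_nonneg _)
    rw [h5, mul_zero] at h1
    linarith
  rw [inv_mul_lt_iff₀ (by positivity)]
  linarith

namespace IsSpectralFamilyOf

theorem exists_proj_eq_zero_of_notMem (hA : IsSelfAdjoint A) (hP : IsSpectralFamilyOf P A)
    {E : ℝ} (hE : E ∉ realSpectrum A) : ∃ ε : ℝ, 0 < ε ∧ P.proj (Ioo (E - ε) (E + ε)) = 0 := by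
  obtain ⟨R, hR⟩ : ∃ R, IsResolventAt A E R := by
    by_contra h
    exact hE h
  obtain ⟨ε, hε, h⟩ := hR.exists_norm_ge
  refine ⟨ε, hε, ?_⟩
  ext φ
  have hm : MeasurableSet (Ioo (E - ε) (E + ε)) := measurableSet_Ioo
  have hD := hP.proj_mem_domain_of_bounded hm Ioo_subset_Icc_self φ
  have h1 := hP.norm_map_sub_le hA hm Ioo_subset_Icc_self ⟨_, hD⟩
    (by dsimp only; rw [P.proj_proj hm hm, inter_self])
  by_contra h2
  exact absurd h1 (not_le.2 (h ⟨_, hD⟩ (norm_ne_zero_iff.2 h2)))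

theorem notMem_realSpectrum (hA : IsSelfAdjoint A) (hP : IsSpectralFamilyOf P A)
    {E ε : ℝ} (hε : 0 < ε) (h : P.proj (Ioo (E - ε) (E + ε)) = 0) : E ∉ realSpectrum A := by
  intro hE
  exact hE (exists_isResolventAt hA hε (hP.norm_map_sub_ge hA h))

/-- The spectral projection of an open set vanishes iff the set contains no spectrum. -/
theorem proj_eq_zero_iff_disjoint (hA : IsSelfAdjoint A) (hP : IsSpectralFamilyOf P A)
    {V : Set ℝ} (hV : IsOpen V) : P.proj V = 0 ↔ Disjoint V (realSpectrum A) := by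
  constructor
  · intro h
    rw [Set.disjoint_left]
    intro E hE
    obtain ⟨ε, hε, hb⟩ := Metric.isOpen_iff.1 hV E hE
    rw [Real.ball_eq_Ioo] at hb
    exact hP.notMem_realSpectrum hA hε
      (P.proj_eq_zero_of_subset measurableSet_Ioo hV.measurableSet hb h)
  · intro h
    ext φ
    change P.proj V φ = 0
    rw [P.proj_eq_zero_iff_measure hV.measurableSet]
    refine measure_null_of_locally_null V fun E hE => ?_
    obtain ⟨ε, hε, hz⟩ := hP.exists_proj_eq_zero_of_notMem hA (Set.disjoint_left.1 h hE)
    refine ⟨Ioo (E - ε) (E + ε), mem_nhdsWithin_of_mem_nhds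
      (Ioo_mem_nhds (by linarith) (by linarith)), ?_⟩
    rw [← P.proj_eq_zero_iff_measure measurableSet_Ioo, hz]; rfl

theorem isClosed_realSpectrum (hA : IsSelfAdjoint A) (hP : IsSpectralFamilyOf P A) :
    IsClosed (realSpectrum A) := by
  rw [← isOpen_compl_iff, isOpen_iff_mem_nhds]
  intro E hE
  obtain ⟨ε, hε, hz⟩ := hP.exists_proj_eq_zero_of_notMem hA hE
  refine mem_of_superset (Ioo_mem_nhds (a := E - ε) (b := E + ε) (by linarith) (by linarith)) ?_
  exact Set.disjoint_left.1 ((hP.proj_eq_zero_iff_disjoint hA isOpen_Ioo).1 hz)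

end IsSpectralFamilyOf

end Spectral

/-! ### Unit cubes, weights and the two reference measures -/

section Geometry

variable {d : ℕ}

instance sFinite_ambient_measure (𝔞 : Ambient) (d : ℕ) : SFinite (𝔞.measure d) := by
  cases 𝔞 <;> (unfold Ambient.measure; infer_instance)

theorem pt_sub (x y : Fin d → ℤ) : pt (x - y) = pt x - pt y := by
  ext i; simp [pt]

theorem measurableSet_box (x : Fin d → ℤ) (L : ℝ) : MeasurableSet (box x L) :=
  Metric.isOpen_ball.measurableSet

theorem measurableSet_belt (b : ℝ) (x : Fin d → ℤ) (L : ℝ) : MeasurableSet (belt b x L) :=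
  Metric.isClosed_closedBall.measurableSet.diff (measurableSet_box _ _)

theorem mem_box {x : Fin d → ℤ} {L : ℝ} {z : Fin d → ℝ} :
    z ∈ box x L ↔ ‖z - pt x‖ < L / 2 := mem_ball_iff_norm

theorem belt_subset_box (b : ℝ) (x : Fin d → ℤ) (L : ℝ) : belt b x L ⊆ box x L := by
  rintro z ⟨hz, -⟩
  have h : ‖z - pt x‖ ≤ (L - 1) / 2 := mem_closedBall_iff_norm.1 hz
  exact mem_box.2 (by linarith)

theorem box_subset_box (x : Fin d → ℤ) {L L' : ℝ} (h : L ≤ L') : box x L ⊆ box x L' :=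
  Metric.ball_subset_ball (by linarith)

theorem eq_of_mem_box {x y : Fin d → ℤ} {z : Fin d → ℝ} (hx : z ∈ box x 1) (hy : z ∈ box y 1) :
    x = y := by
  rw [mem_box] at hx hy
  ext i
  have h1 : |z i - x i| < 1 / 2 := (norm_le_pi_norm (z - pt x) i).trans_lt hx
  have h2 : |z i - y i| < 1 / 2 := (norm_le_pi_norm (z - pt y) i).trans_lt hy
  rw [abs_lt] at h1 h2
  have h3 : ((x i - y i : ℤ) : ℝ) < 1 := by push_cast; linarith
  have h4 : (-1 : ℝ) < ((x i - y i : ℤ) : ℝ) := by push_cast; linarith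
  have h5 : x i - y i < 1 := by exact_mod_cast h3
  have h6 : -1 < x i - y i := by exact_mod_cast h4
  omega

theorem pairwise_disjoint_box : Pairwise (Function.onFun Disjoint fun x : Fin d → ℤ => box x 1) :=
  fun _ _ hxy => Set.disjoint_left.2 fun _ h1 h2 => hxy (eq_of_mem_box h1 h2)

/-- The open unit cubes centered at the lattice points cover space up to a null set. -/
theorem ae_exists_mem_box (𝔞 : Ambient) (d : ℕ) :
    ∀ᵐ z ∂(𝔞.measure d), ∃ x : Fin d → ℤ, z ∈ box x 1 := by
  cases 𝔞 with
  | continuum =>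
    have h : ∀ i : Fin d, ∀ k : ℤ, ∀ᵐ z : Fin d → ℝ, z i ≠ k + 1 / 2 := fun i k => by
      rw [ae_iff]
      simp only [not_not]
      exact Measure.pi_hyperplane (fun _ => volume) i _
    have h' : ∀ᵐ z : Fin d → ℝ, ∀ i, ∀ k : ℤ, z i ≠ k + 1 / 2 :=
      ae_all_iff.2 fun i => ae_all_iff.2 fun k => h i k
    refine h'.mono fun z hz => ⟨fun i => round (z i), ?_⟩
    rw [mem_box, pi_norm_lt_iff (by norm_num)]
    intro i
    change |z i - (round (z i) : ℝ)| < 1 / 2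
    refine lt_of_le_of_ne (abs_sub_round (z i)) fun h1 => ?_
    rcases abs_eq (by norm_num : (0 : ℝ) ≤ 1 / 2) |>.1 h1 with h2 | h2
    · exact hz i (round (z i)) (by linarith)
    · exact hz i (round (z i) - 1) (by push_cast; linarith)
  | lattice =>
    unfold Ambient.measure
    rw [Measure.ae_sum_iff]
    intro k
    rw [ae_dirac_eq]
    exact ⟨k, mem_box.2 (by simp)⟩

theorem lintegral_eq_tsum_box (𝔞 : Ambient) (f : (Fin d → ℝ) → ℝ≥0∞) :
    ∫⁻ z, f z ∂(𝔞.measure d) = ∑' x : Fin d → ℤ, ∫⁻ z in box x 1, f z ∂(𝔞.measure d) := by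
  rw [← lintegral_iUnion (fun x => measurableSet_box x 1) pairwise_disjoint_box]
  have : (𝔞.measure d).restrict (⋃ x : Fin d → ℤ, box x 1) = 𝔞.measure d := by
    refine Measure.restrict_eq_self_of_ae_mem ?_
    filter_upwards [ae_exists_mem_box 𝔞 d] with z hz
    exact mem_iUnion.2 hz
  rw [this]

theorem measurePreserving_sub_pt (𝔞 : Ambient) (y : Fin d → ℤ) :
    MeasurePreserving (fun z => z - pt y) (𝔞.measure d) (𝔞.measure d) := by
  cases 𝔞 with
  | continuum => exact measurePreserving_sub_right volume (pt y)
  | lattice =>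
    have hm : Measurable fun z : Fin d → ℝ => z - pt y := by fun_prop
    refine ⟨hm, ?_⟩
    unfold Ambient.measure
    ext S hS
    rw [Measure.map_apply hm hS, Measure.sum_apply _ hS, Measure.sum_apply _ (hm hS),
      ← (Equiv.subRight y).tsum_eq fun k => Measure.dirac (pt k) S]
    refine tsum_congr fun k => ?_
    rw [Measure.dirac_apply' _ (hm hS), Measure.dirac_apply' _ hS, Equiv.subRight_apply, pt_sub]
    rfl

theorem preimage_sub_pt_box (x y : Fin d → ℤ) (L : ℝ) :
    (fun z => z - pt y) ⁻¹' box (x - y) L = box x L := by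
  ext z
  rw [mem_preimage, mem_box, mem_box, pt_sub, sub_sub_sub_cancel_right]

theorem eucl_nonneg (z : Fin d → ℝ) : 0 ≤ eucl z := Real.sqrt_nonneg _

theorem norm_le_eucl (z : Fin d → ℝ) : ‖z‖ ≤ eucl z := by
  rw [pi_norm_le_iff_of_nonneg (eucl_nonneg z)]
  intro i
  rw [Real.norm_eq_abs]
  exact Real.abs_le_sqrt (Finset.single_le_sum (f := fun i => z i ^ 2)
    (fun j _ => sq_nonneg _) (Finset.mem_univ i))

theorem eucl_le (z : Fin d → ℝ) : eucl z ≤ d * ‖z‖ := by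
  refine Real.sqrt_le_iff.2 ⟨by positivity, ?_⟩
  have h1 : ∀ i ∈ (Finset.univ : Finset (Fin d)), z i ^ 2 ≤ ‖z‖ ^ 2 := fun i _ =>
    sq_le_sq' (by linarith [neg_abs_le (z i), norm_le_pi_norm z i, Real.norm_eq_abs (z i)])
      ((le_abs_self _).trans (norm_le_pi_norm z i))
  have h2 := Finset.sum_le_card_nsmul _ _ _ h1
  simp only [Finset.card_univ, Fintype.card_fin, nsmul_eq_mul] at h2
  refine h2.trans ?_
  rw [mul_pow]
  refine mul_le_mul_of_nonneg_right ?_ (by positivity)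
  rcases Nat.eq_zero_or_pos d with h | h
  · simp [h]
  · have : (1 : ℝ) ≤ d := by exact_mod_cast h
    nlinarith

theorem one_le_jap (z : Fin d → ℝ) : 1 ≤ jap z := by
  rw [jap, Real.one_le_sqrt]; nlinarith [sq_nonneg (eucl z)]

theorem jap_pos (z : Fin d → ℝ) : 0 < jap z := one_pos.trans_le (one_le_jap z)

theorem measurable_jap : Measurable (jap : (Fin d → ℝ) → ℝ) := by
  unfold jap eucl; fun_prop

theorem jap_le (z : Fin d → ℝ) : jap z ≤ (d + 1) * (1 + ‖z‖) := by
  have h : jap z ≤ 1 + eucl z := by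
    refine Real.sqrt_le_iff.2 ⟨by linarith [eucl_nonneg z], ?_⟩
    nlinarith [eucl_nonneg z]
  have := eucl_le z
  nlinarith [norm_nonneg z, Nat.cast_nonneg (α := ℝ) d]

theorem one_add_norm_le_jap (z : Fin d → ℝ) : 1 + ‖z‖ ≤ 2 * jap z := by
  have h : ‖z‖ ≤ jap z := by
    refine (norm_le_eucl z).trans (Real.le_sqrt_of_sq_le ?_)
    linarith
  linarith [one_le_jap z]

theorem norm_le_of_mem_box {x : Fin d → ℤ} {L : ℝ} {z : Fin d → ℝ} (hz : z ∈ box x L) :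
    ‖z‖ ≤ ‖pt x‖ + L / 2 := by
  have h1 := mem_box.1 hz
  have h2 := norm_le_norm_add_norm_sub' z (pt x)
  linarith

theorem norm_pt_le_of_mem_box {x : Fin d → ℤ} {L : ℝ} {z : Fin d → ℝ} (hz : z ∈ box x L) :
    ‖pt x‖ ≤ ‖z‖ + L / 2 := by
  have h1 := mem_box.1 hz
  have h2 := norm_le_norm_add_norm_sub z (pt x)
  linarith

theorem jap_le_of_mem_box {x : Fin d → ℤ} {L : ℝ} (hL : 0 ≤ L) {z : Fin d → ℝ}
    (hz : z ∈ box x L) : jap z ≤ (d + 1) * (1 + ‖pt x‖ + L) := by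
  refine (jap_le z).trans ?_
  have := norm_le_of_mem_box hz
  have h : 1 + ‖z‖ ≤ 1 + ‖pt x‖ + L := by linarith
  gcongr

theorem jap_ge_of_mem_box {x : Fin d → ℤ} {z : Fin d → ℝ}
    (hz : z ∈ box x 1) : 1 + ‖pt x‖ ≤ 4 * jap z := by
  have h1 := norm_pt_le_of_mem_box hz
  have h2 := one_add_norm_le_jap z
  linarith [one_le_jap z]

/-- The polynomial weight `(1 + |x|_∞)^(-p)` on the lattice. -/
noncomputable def wt (p : ℝ) (x : Fin d → ℤ) : ℝ≥0∞ := ENNReal.ofReal ((1 + ‖pt x‖) ^ (-p))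

theorem tsum_wt_lt_top {p : ℝ} (hp : (d : ℝ) < p) : ∑' x : Fin d → ℤ, wt p x < ∞ := by
  have hp0 : 0 < p := (Nat.cast_nonneg d).trans_lt hp
  have h1 : ∀ x : Fin d → ℤ, wt p x ≤ ENNReal.ofReal (2 ^ p) *
      ∫⁻ z in box x 1, ENNReal.ofReal ((1 + ‖z‖) ^ (-p)) := by
    intro x
    have h2 : ∫⁻ z in box x 1, ENNReal.ofReal (2 ^ (-p) * (1 + ‖pt x‖) ^ (-p)) ≤
        ∫⁻ z in box x 1, ENNReal.ofReal ((1 + ‖z‖) ^ (-p)) := by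
      refine setLIntegral_mono' (measurableSet_box x 1) fun z hz => ENNReal.ofReal_le_ofReal ?_
      rw [← Real.mul_rpow (by norm_num) (by positivity)]
      have := norm_le_of_mem_box hz
      exact Real.rpow_le_rpow_of_nonpos (by positivity) (by linarith [norm_nonneg (pt x)])
        (by linarith)
    have hvol : volume (box x 1) = 1 := by
      rw [box, Real.volume_pi_ball _ (by norm_num)]; simp
    rw [setLIntegral_const, hvol, mul_one] at h2
    refine le_trans (le_of_eq ?_) (mul_le_mul_right h2 _)
    rw [← ENNReal.ofReal_mul (by positivity), ← mul_assoc, ← Real.rpow_add (by norm_num)]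
    simp [wt]
  refine (ENNReal.tsum_le_tsum h1).trans_lt ?_
  rw [ENNReal.tsum_mul_left]
  refine ENNReal.mul_lt_top ENNReal.ofReal_lt_top ?_
  have h3 := lintegral_eq_tsum_box .continuum
    (fun z : Fin d → ℝ => ENNReal.ofReal ((1 + ‖z‖) ^ (-p)))
  have h4 := finite_integral_one_add_norm (E := Fin d → ℝ) (μ := volume) (r := p) (by simpa)
  unfold Ambient.measure at h3
  dsimp only at h3
  rwa [← h3]

theorem tsum_wt_sub {p : ℝ} (y : Fin d → ℤ) :
    ∑' x : Fin d → ℤ, wt p (x - y) = ∑' x : Fin d → ℤ, wt p x :=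
  (Equiv.subRight y).tsum_eq (wt p)

/-- The lattice points of sup distance at most `N` from `x`. -/
noncomputable def nearSites (x : Fin d → ℤ) (N : ℕ) : Finset (Fin d → ℤ) :=
  Fintype.piFinset fun i => Finset.Icc (x i - N) (x i + N)

theorem mem_nearSites {x z : Fin d → ℤ} {N : ℕ} (h : ‖pt x - pt z‖ ≤ N) :
    z ∈ nearSites x N := by
  rw [nearSites, Fintype.mem_piFinset]
  intro i
  have h1 : |(x i : ℝ) - z i| ≤ N := (norm_le_pi_norm (pt x - pt z) i).trans h
  have h2 : |x i - z i| ≤ N := by exact_mod_cast h1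
  rw [abs_le] at h2
  rw [Finset.mem_Icc]
  constructor <;> linarith [h2.1, h2.2]

theorem card_nearSites (x : Fin d → ℤ) (N : ℕ) : (nearSites x N).card = (2 * N + 1) ^ d := by
  rw [nearSites, Fintype.card_piFinset]
  have : ∀ i : Fin d, (Finset.Icc (x i - N) (x i + N)).card = 2 * N + 1 := fun i => by
    rw [Int.card_Icc]; omega
  simp [this]

end Geometry

/-! ### Local masses -/

section Mass

variable {d n : ℕ} {ν : Measure (Fin d → ℝ)}

/-- The mass `‖1_S ψ‖²` of `ψ` in `S`, as an extended nonnegative number. -/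
noncomputable def locMass (ν : Measure (Fin d → ℝ)) (S : Set (Fin d → ℝ))
    (ψ : (Fin d → ℝ) → EuclideanSpace ℂ (Fin n)) : ℝ≥0∞ := ∫⁻ z in S, ‖ψ z‖ₑ ^ 2 ∂ν

theorem locMass_mono {S S' : Set (Fin d → ℝ)} (h : S ⊆ S')
    (ψ : (Fin d → ℝ) → EuclideanSpace ℂ (Fin n)) : locMass ν S ψ ≤ locMass ν S' ψ :=
  lintegral_mono_set h

theorem locMass_congr {S : Set (Fin d → ℝ)} {ψ ψ' : (Fin d → ℝ) → EuclideanSpace ℂ (Fin n)}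
    (h : ψ =ᵐ[ν] ψ') : locMass ν S ψ = locMass ν S ψ' :=
  lintegral_congr_ae (ae_restrict_of_ae (h.mono fun z hz => by dsimp only; rw [hz]))

theorem eLpNorm_two_sq (ψ : (Fin d → ℝ) → EuclideanSpace ℂ (Fin n)) :
    eLpNorm ψ 2 ν ^ 2 = ∫⁻ z, ‖ψ z‖ₑ ^ 2 ∂ν := by
  rw [eLpNorm_eq_lintegral_rpow_enorm_toReal (by norm_num) (by norm_num), ← ENNReal.rpow_natCast,
    ← ENNReal.rpow_mul]
  simp

theorem enorm_sq_eq_locMass (φ : HSpace ν n) : ‖φ‖ₑ ^ 2 = locMass ν univ φ := by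
  rw [locMass, Measure.restrict_univ, ← eLpNorm_two_sq, Lp.enorm_def]

theorem localNorm_eq {S : Set (Fin d → ℝ)} (hS : MeasurableSet S)
    (ψ : (Fin d → ℝ) → EuclideanSpace ℂ (Fin n)) :
    localNorm ν S ψ ^ 2 = (locMass ν S ψ).toReal := by
  rw [localNorm, ← ENNReal.toReal_pow, eLpNorm_indicator_eq_eLpNorm_restrict hS, eLpNorm_two_sq,
    locMass]

theorem locMass_univ_eq_tsum (𝔞 : Ambient) (ψ : (Fin d → ℝ) → EuclideanSpace ℂ (Fin n)) :
    locMass (𝔞.measure d) univ ψ = ∑' x : Fin d → ℤ, locMass (𝔞.measure d) (box x 1) ψ := by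
  rw [locMass, Measure.restrict_univ, lintegral_eq_tsum_box]
  rfl

theorem memLp_indicator_one {S : Set (Fin d → ℝ)} (hS : MeasurableSet S) :
    MemLp (S.indicator (1 : (Fin d → ℝ) → ℂ)) ∞ ν := by
  refine memLp_top_of_bound (C := 1)
    ((measurable_const.indicator hS).aestronglyMeasurable) (Eventually.of_forall fun z => ?_)
  by_cases h : z ∈ S <;> simp [h]

theorem cutoff_apply {S : Set (Fin d → ℝ)} (hS : MeasurableSet S) (φ : HSpace ν n) :
    cutoff ν n S φ =ᵐ[ν] S.indicator φ := by
  filter_upwards [mulOp_apply ν n (memLp_indicator_one hS) φ] with z hz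
  rw [cutoff, hz]
  by_cases h : z ∈ S <;> simp [h]

theorem enorm_cutoff_sq {S : Set (Fin d → ℝ)} (hS : MeasurableSet S) (φ : HSpace ν n) :
    ‖cutoff ν n S φ‖ₑ ^ 2 = locMass ν S φ := by
  rw [enorm_sq_eq_locMass, locMass_congr (cutoff_apply hS φ), locMass, locMass,
    Measure.restrict_univ, ← lintegral_indicator hS]
  congr 1
  ext z
  by_cases h : z ∈ S <;> simp [h]

theorem norm_cutoff_le {S : Set (Fin d → ℝ)} (hS : MeasurableSet S) :
    ‖cutoff ν n S‖ ≤ 1 := by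
  refine ContinuousLinearMap.opNorm_le_bound _ zero_le_one fun φ => ?_
  rw [one_mul]
  have h : ‖cutoff ν n S φ‖ₑ ^ 2 ≤ ‖φ‖ₑ ^ 2 := by
    rw [enorm_cutoff_sq hS, enorm_sq_eq_locMass]
    exact locMass_mono (subset_univ _) _
  have h2 : ‖cutoff ν n S φ‖ₑ ≤ ‖φ‖ₑ := by
    rwa [ENNReal.pow_le_pow_left_iff (by norm_num)] at h
  exact enorm_le_iff_norm_le.1 h2

theorem cutoff_mul_cutoff {S S' : Set (Fin d → ℝ)} (hS : MeasurableSet S)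
    (hS' : MeasurableSet S') (h : S' ⊆ S) : cutoff ν n S * cutoff ν n S' = cutoff ν n S' := by
  ext1 φ
  refine Lp.ext ?_
  filter_upwards [cutoff_apply hS (cutoff ν n S' φ), cutoff_apply hS' φ] with z h1 h2
  change cutoff ν n S (cutoff ν n S' φ) z = _
  rw [h1]
  by_cases hz : z ∈ S
  · simp [hz]
  · have hz' : z ∉ S' := fun hh => hz (h hh)
    rw [h2]; simp [hz, hz']

theorem jap_rpow_neg_le_one {κ : ℝ} (hκ : 0 ≤ κ) (z : Fin d → ℝ) : jap z ^ (-κ) ≤ 1 :=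
  Real.rpow_le_one_of_one_le_of_nonpos (one_le_jap z) (by linarith)

theorem memLp_jap_rpow {κ : ℝ} (hκ : 0 ≤ κ) :
    MemLp (fun z : Fin d → ℝ => ((jap z ^ (-κ) : ℝ) : ℂ)) ∞ ν := by
  have hm : Measurable fun z : Fin d → ℝ => ((jap z ^ (-κ) : ℝ) : ℂ) := by
    have := measurable_jap (d := d)
    fun_prop
  refine memLp_top_of_bound (C := 1) hm.aestronglyMeasurable (Eventually.of_forall fun z => ?_)
  rw [Complex.norm_real, Real.norm_eq_abs, abs_of_nonneg (by have := jap_pos z; positivity)]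
  exact jap_rpow_neg_le_one hκ z

theorem Tinv_apply {κ : ℝ} (hκ : 0 ≤ κ) (φ : HSpace ν n) :
    Tinv κ ν n φ =ᵐ[ν] fun z => (jap z ^ (-κ)) • φ z := by
  filter_upwards [mulOp_apply ν n (memLp_jap_rpow hκ) φ] with z hz
  rw [Tinv, hz]
  exact Complex.coe_smul _ _

theorem enorm_jap_smul (κ : ℝ) (z : Fin d → ℝ) (v : EuclideanSpace ℂ (Fin n)) :
    ‖(jap z ^ κ) • v‖ₑ ^ 2 = ENNReal.ofReal (jap z ^ (2 * κ)) * ‖v‖ₑ ^ 2 := by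
  have h := jap_pos z
  rw [enorm_smul, mul_pow, Real.enorm_eq_ofReal (by positivity),
    ← ENNReal.ofReal_pow (by positivity), ← Real.rpow_natCast, ← Real.rpow_mul h.le]
  congr 3
  push_cast; ring

theorem Tinv_injective {κ : ℝ} (hκ : 0 ≤ κ) : Function.Injective (Tinv κ ν n) := by
  rw [injective_iff_map_eq_zero]
  intro φ hφ
  rw [Lp.eq_zero_iff_ae_eq_zero]
  have h1 := Tinv_apply hκ φ
  rw [hφ] at h1
  filter_upwards [h1, Lp.coeFn_zero (EuclideanSpace ℂ (Fin n)) 2 ν] with z h2 h3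
  rw [h3] at h2
  have := jap_pos z
  exact (smul_eq_zero.1 h2.symm).resolve_left (by positivity)

/-- For `z` in the cube of side `L ≥ 0` at `x`, the mass of `ψ` is controlled by that of
`⟨z⟩^(-κ) ψ`. -/
theorem locMass_box_le {κ : ℝ} (hκ : 0 ≤ κ) (x : Fin d → ℤ) {L : ℝ} (hL : 0 ≤ L)
    {S : Set (Fin d → ℝ)} (hm : MeasurableSet S) (hS : S ⊆ box x L)
    (ψ : (Fin d → ℝ) → EuclideanSpace ℂ (Fin n)) :
    locMass ν S ψ ≤ ENNReal.ofReal (((d + 1) * (1 + ‖pt x‖ + L)) ^ (2 * κ)) *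
      locMass ν S (fun z => jap z ^ (-κ) • ψ z) := by
  rw [locMass, locMass, ← lintegral_const_mul' _ _ ENNReal.ofReal_ne_top]
  refine setLIntegral_mono' hm fun z hz => ?_
  have h := jap_pos z
  rw [enorm_jap_smul, ← mul_assoc, ← ENNReal.ofReal_mul (by positivity)]
  refine le_mul_of_one_le_left zero_le ?_
  rw [← ENNReal.ofReal_one]
  refine ENNReal.ofReal_le_ofReal ?_
  calc (1 : ℝ) = jap z ^ (2 * κ) * jap z ^ (2 * -κ) := by
        rw [← Real.rpow_add h]; simp
    _ ≤ _ := by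
        refine mul_le_mul_of_nonneg_right ?_ (by positivity)
        exact Real.rpow_le_rpow h.le (jap_le_of_mem_box hL (hS hz)) (by positivity)

theorem locMass_jap_smul_le {κ : ℝ} (hκ : 0 ≤ κ) (x : Fin d → ℤ)
    (ψ : (Fin d → ℝ) → EuclideanSpace ℂ (Fin n)) :
    locMass ν (box x 1) (fun z => jap z ^ (-κ) • ψ z) ≤
      ENNReal.ofReal (4 ^ (2 * κ)) * wt (2 * κ) x * locMass ν (box x 1) ψ := by
  rw [locMass, locMass, wt, ← ENNReal.ofReal_mul (by positivity),
    ← lintegral_const_mul' _ _ ENNReal.ofReal_ne_top]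
  refine setLIntegral_mono' (measurableSet_box x 1) fun z hz => ?_
  rw [enorm_jap_smul]
  refine mul_le_mul_left (ENNReal.ofReal_le_ofReal ?_) _
  have h := jap_ge_of_mem_box hz
  have h1 := jap_pos z
  calc jap z ^ (2 * -κ) = 4 ^ (2 * κ) * (4 * jap z) ^ (-(2 * κ)) := by
        rw [Real.mul_rpow (by norm_num) h1.le, ← mul_assoc, ← Real.rpow_add (by norm_num)]
        simp
    _ ≤ _ := by
        refine mul_le_mul_of_nonneg_left ?_ (by positivity)
        exact Real.rpow_le_rpow_of_nonpos (by positivity) h (by linarith)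

end Mass

/-! ### Hilbert-Schmidt norms and traces -/

section HilbertSchmidt

variable {𝓗 : Type*} [NormedAddCommGroup 𝓗] [InnerProductSpace ℂ 𝓗] [CompleteSpace 𝓗]

/-- The square of the Hilbert-Schmidt norm, in `[0, ∞]`. -/
noncomputable def hsSq (B : 𝓗 →L[ℂ] 𝓗) : ℝ≥0∞ := ∑' i, ‖B (stdBasis 𝓗 i)‖ₑ ^ 2

theorem enorm_sq_eq_ofReal {E : Type*} [SeminormedAddCommGroup E] (v : E) :
    ‖v‖ₑ ^ 2 = ENNReal.ofReal (‖v‖ ^ 2) := by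
  rw [← ofReal_norm, ENNReal.ofReal_pow (norm_nonneg _)]

theorem HilbertBasis.tsum_enorm_inner_sq {ι E : Type*} [NormedAddCommGroup E]
    [InnerProductSpace ℂ E] (b : HilbertBasis ι ℂ E) (v : E) :
    ∑' i, ‖inner ℂ (b i) v‖ₑ ^ 2 = ‖v‖ₑ ^ 2 := by
  have h1 := (b.hasSum_inner_mul_inner v v).mapL Complex.reCLM
  have h2 : ∀ i, Complex.reCLM (inner ℂ v (b i) * inner ℂ (b i) v) = ‖inner ℂ (b i) v‖ ^ 2 := by
    intro i
    rw [← inner_conj_symm, mul_comm, Complex.mul_conj, Complex.normSq_eq_norm_sq]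
    exact Complex.ofReal_re _
  have h3 : Complex.reCLM (inner ℂ v v) = ‖v‖ ^ 2 := inner_self_eq_norm_sq (𝕜 := ℂ) v
  rw [h3] at h1
  simp only [h2] at h1
  simp_rw [enorm_sq_eq_ofReal]
  rw [← h1.tsum_eq, ENNReal.ofReal_tsum_of_nonneg (fun i => by positivity) h1.summable]

theorem hsSq_adjoint (B : 𝓗 →L[ℂ] 𝓗) : hsSq (ContinuousLinearMap.adjoint B) = hsSq B := by
  unfold hsSq
  calc ∑' i, ‖ContinuousLinearMap.adjoint B (stdBasis 𝓗 i)‖ₑ ^ 2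
      = ∑' i, ∑' j, ‖inner ℂ (stdBasis 𝓗 j)
          (ContinuousLinearMap.adjoint B (stdBasis 𝓗 i))‖ₑ ^ 2 := by
        simp_rw [HilbertBasis.tsum_enorm_inner_sq]
    _ = ∑' j, ∑' i, ‖inner ℂ (stdBasis 𝓗 i) (B (stdBasis 𝓗 j))‖ₑ ^ 2 := by
        rw [ENNReal.tsum_comm]
        refine tsum_congr fun j => tsum_congr fun i => ?_
        rw [ContinuousLinearMap.adjoint_inner_right, ← ofReal_norm,
          ← ofReal_norm, norm_inner_symm]
    _ = _ := by simp_rw [HilbertBasis.tsum_enorm_inner_sq]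

theorem enorm_inner_le_enorm (x y : 𝓗) : ‖inner ℂ x y‖ₑ ≤ ‖x‖ₑ * ‖y‖ₑ := by
  rw [← ofReal_norm, ← ofReal_norm, ← ofReal_norm,
    ← ENNReal.ofReal_mul (norm_nonneg _)]
  exact ENNReal.ofReal_le_ofReal (norm_inner_le_norm x y)

theorem enorm_apply_sq_le_hsSq (B : 𝓗 →L[ℂ] 𝓗) (v : 𝓗) :
    ‖B v‖ₑ ^ 2 ≤ hsSq B * ‖v‖ₑ ^ 2 := by
  rw [← HilbertBasis.tsum_enorm_inner_sq (stdBasis 𝓗) (B v), ← hsSq_adjoint, hsSq,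
    ← ENNReal.tsum_mul_right]
  refine ENNReal.tsum_le_tsum fun i => ?_
  rw [← ContinuousLinearMap.adjoint_inner_left, ← mul_pow]
  exact pow_le_pow_left' (enorm_inner_le_enorm _ _) 2

theorem hsSq_comp_isometry (B : 𝓗 →L[ℂ] 𝓗) (U : 𝓗 ≃ₗᵢ[ℂ] 𝓗) :
    hsSq (B * (U.toContinuousLinearEquiv : 𝓗 →L[ℂ] 𝓗)) = hsSq B := by
  rw [← hsSq_adjoint, ← hsSq_adjoint B]
  refine tsum_congr fun i => ?_
  have h : ContinuousLinearMap.adjoint (B * (U.toContinuousLinearEquiv : 𝓗 →L[ℂ] 𝓗))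
      (stdBasis 𝓗 i) = U.symm (ContinuousLinearMap.adjoint B (stdBasis 𝓗 i)) := by
    refine ext_inner_left ℂ fun v => ?_
    rw [ContinuousLinearMap.adjoint_inner_right]
    change inner ℂ (B (U v)) _ = _
    rw [← ContinuousLinearMap.adjoint_inner_right, ← U.inner_map_map v, U.apply_symm_apply]
  rw [h, ← ofReal_norm, U.symm.norm_map, ofReal_norm]

theorem posTrace_proj (P : SpectralFamily 𝓗) {B : Set ℝ} (hB : MeasurableSet B) :
    posTrace (P.proj B) = hsSq (P.proj B) := by
  refine tsum_congr fun i => ?_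
  rw [P.inner_proj_self hB, enorm_sq_eq_ofReal]

/-- A spectral subspace with finite trace is finite dimensional: by Bessel's inequality the trace
bounds the number of elements of an orthonormal family in it. -/
theorem finiteDimensional_of_hsSq_lt_top {A : 𝓗 →ₗ.[ℂ] 𝓗} (hA : IsSelfAdjoint A)
    {P : SpectralFamily 𝓗} (hP : IsSpectralFamilyOf P A) {E : ℝ} (h : hsSq (P.proj {E}) < ∞) :
    FiniteDimensional ℂ (eigenspace A E) := by
  have hm : MeasurableSet ({E} : Set ℝ) := measurableSet_singleton E
  have hcl : IsClosed (eigenspace A E : Set 𝓗) := by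
    have : (eigenspace A E : Set 𝓗) = {φ | P.proj {E} φ = φ} := by
      ext φ; exact hP.mem_eigenspace_iff hA
    rw [this]
    exact isClosed_eq (P.proj {E}).continuous continuous_id
  have : CompleteSpace (eigenspace A E) := hcl.completeSpace_coe
  obtain ⟨w, b, -⟩ := exists_hilbertBasis ℂ (eigenspace A E)
  have horth : Orthonormal ℂ fun i => ((b i : eigenspace A E) : 𝓗) :=
    b.orthonormal.comp_linearIsometry (eigenspace A E).subtypeₗᵢ
  have hcard : ∀ s : Finset w, (s.card : ℝ≥0∞) ≤ hsSq (P.proj {E}) := by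
    intro s
    have h1 : (s.card : ℝ≥0∞) =
        ∑ k ∈ s, ∑' i, ‖inner ℂ ((b k : eigenspace A E) : 𝓗) (stdBasis 𝓗 i)‖ₑ ^ 2 := by
      rw [Finset.sum_congr rfl fun k _ => ?_, Finset.sum_const, nsmul_eq_mul, mul_one]
      have h2 := HilbertBasis.tsum_enorm_inner_sq (stdBasis 𝓗) ((b k : eigenspace A E) : 𝓗)
      rw [enorm_sq_eq_ofReal ((b k : eigenspace A E) : 𝓗), horth.1 k] at h2
      rw [one_pow, ENNReal.ofReal_one] at h2
      rw [← h2]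
      refine tsum_congr fun i => ?_
      rw [← ofReal_norm, ← ofReal_norm, norm_inner_symm]
    rw [h1, ← Summable.tsum_finsetSum fun _ _ => ENNReal.summable]
    refine ENNReal.tsum_le_tsum fun i => ?_
    have h3 := horth.sum_inner_products_le (s := s) (P.proj {E} (stdBasis 𝓗 i))
    rw [enorm_sq_eq_ofReal]
    refine le_trans (le_of_eq ?_) (ENNReal.ofReal_le_ofReal h3)
    rw [ENNReal.ofReal_sum_of_nonneg fun _ _ => by positivity]
    refine Finset.sum_congr rfl fun k _ => ?_
    have h4 : P.proj {E} ((b k : eigenspace A E) : 𝓗) = ((b k : eigenspace A E) : 𝓗) :=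
      (hP.mem_eigenspace_iff hA).1 (b k).2
    rw [← P.inner_proj_left hm, h4, enorm_sq_eq_ofReal]
  have hfin : Finite w := by
    by_contra hinf
    rw [not_finite_iff_infinite] at hinf
    obtain ⟨N, hN⟩ := ENNReal.exists_nat_gt h.ne
    obtain ⟨s, hs⟩ := Infinite.exists_subset_card_eq w N
    have := hcard s
    rw [hs] at this
    exact absurd hN (not_lt.2 this)
  have : Fintype w := Fintype.ofFinite w
  exact (b.toOrthonormalBasis).toBasis.finiteDimensional_of_finite

end HilbertSchmidt

section Blocks

variable {d n : ℕ} {ν : Measure (Fin d → ℝ)}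

/-- The square of the Hilbert-Schmidt norm of `1_S Q`. -/
noncomputable def blockMass (S : Set (Fin d → ℝ)) (Q : HSpace ν n →L[ℂ] HSpace ν n) : ℝ≥0∞ :=
  ∑' i, locMass ν S (Q (stdBasis (HSpace ν n) i))

theorem blockMass_eq_hsSq {S : Set (Fin d → ℝ)} (hS : MeasurableSet S)
    (Q : HSpace ν n →L[ℂ] HSpace ν n) : blockMass S Q = hsSq (cutoff ν n S * Q) :=
  tsum_congr fun _ => (enorm_cutoff_sq hS _).symm

theorem hsSq_eq_tsum_blockMass (𝔞 : Ambient)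
    (Q : HSpace (𝔞.measure d) n →L[ℂ] HSpace (𝔞.measure d) n) :
    hsSq Q = ∑' x : Fin d → ℤ, blockMass (box x 1) Q := by
  unfold blockMass hsSq
  rw [ENNReal.tsum_comm]
  refine tsum_congr fun i => ?_
  rw [enorm_sq_eq_locMass, locMass_univ_eq_tsum]

theorem adjoint_Tinv (κ : ℝ) :
    ContinuousLinearMap.adjoint (Tinv κ ν n) = Tinv κ ν n := by
  symm
  rw [ContinuousLinearMap.eq_adjoint_iff]
  exact fun x y => inner_Tinv_left κ x y

/-- The trace measure is the squared Hilbert-Schmidt norm of `T⁻¹ P_B`. -/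
theorem traceMeasure_eq_hsSq (κ : ℝ) (P : SpectralFamily (HSpace ν n)) {B : Set ℝ}
    (hB : MeasurableSet B) : traceMeasure κ P B = hsSq (Tinv κ ν n * P.proj B) := by
  rw [← hsSq_adjoint]
  have h : ContinuousLinearMap.adjoint (Tinv κ ν n * P.proj B) = P.proj B * Tinv κ ν n := by
    have h2 : ContinuousLinearMap.adjoint (P.proj B) = P.proj B :=
      (P.isStarProjection B hB).isSelfAdjoint
    have h3 := ContinuousLinearMap.adjoint_comp (Tinv κ ν n) (P.proj B)
    rw [adjoint_Tinv, h2] at h3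
    exact h3
  rw [h, traceMeasure, Measure.sum_apply _ hB]
  refine tsum_congr fun i => ?_
  rw [P.measure_apply _ hB, enorm_sq_eq_ofReal]
  rfl

theorem traceMeasure_singleton_le (𝔞 : Ambient) {κ : ℝ} (hκ : 0 ≤ κ)
    (P : SpectralFamily (HSpace (𝔞.measure d) n)) (E : ℝ) :
    traceMeasure κ P {E} ≤ ENNReal.ofReal (4 ^ (2 * κ)) *
      ∑' x : Fin d → ℤ, wt (2 * κ) x * blockMass (box x 1) (P.proj {E}) := by
  rw [traceMeasure_eq_hsSq κ P (measurableSet_singleton E), hsSq_eq_tsum_blockMass,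
    ← ENNReal.tsum_mul_left]
  refine ENNReal.tsum_le_tsum fun x => ?_
  unfold blockMass
  rw [← ENNReal.tsum_mul_left, ← ENNReal.tsum_mul_left]
  refine ENNReal.tsum_le_tsum fun i => ?_
  change locMass _ _ (Tinv κ _ n (P.proj {E} _)) ≤ _
  rw [locMass_congr (Tinv_apply hκ _), ← mul_assoc]
  exact locMass_jap_smul_le hκ x _

theorem blockMass_zero_le {κ : ℝ} (hκ : 0 ≤ κ) (P : SpectralFamily (HSpace ν n)) (E : ℝ) :
    blockMass (box 0 1) (P.proj {E}) ≤
      ENNReal.ofReal (((d + 1) * 2) ^ (2 * κ)) * traceMeasure κ P {E} := by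
  rw [traceMeasure_eq_hsSq κ P (measurableSet_singleton E)]
  unfold blockMass hsSq
  rw [← ENNReal.tsum_mul_left]
  refine ENNReal.tsum_le_tsum fun i => ?_
  refine (locMass_box_le hκ 0 zero_le_one (measurableSet_box 0 1) subset_rfl _).trans ?_
  have h0 : pt (0 : Fin d → ℤ) = 0 := by ext; simp [pt]
  rw [h0, norm_zero, show (1 + 0 + 1 : ℝ) = 2 by norm_num]
  refine mul_le_mul_right ?_ _
  change _ ≤ ‖Tinv κ ν n (P.proj {E} _)‖ₑ ^ 2
  rw [enorm_sq_eq_locMass, locMass_congr (Tinv_apply hκ _)]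
  exact locMass_mono (subset_univ _) _

end Blocks

section Covariance

variable {Ω : Type*} [MeasurableSpace Ω] {𝔞 : Ambient} {d n : ℕ} [AddAction (Fin d → ℤ) Ω]

/-- Covariance of eigenprojections. -/
theorem RandomOperator.proj_singleton_transl (H : RandomOperator 𝔞 d n Ω) (y : Fin d → ℤ) (ω : Ω)
    (E : ℝ) (φ : HSpace (𝔞.measure d) n) :
    (H.spec (y +ᵥ ω)).proj {E} (H.transl y φ) = H.transl y ((H.spec ω).proj {E} φ) := by
  have hm : MeasurableSet ({E} : Set ℝ) := measurableSet_singleton E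
  have heig : ∀ φ, φ ∈ eigenspace (H.op ω) E ↔ H.transl y φ ∈ eigenspace (H.op (y +ᵥ ω)) E := by
    intro φ
    rw [mem_eigenspace_iff_graph, H.covariance y ω, mem_eigenspace_iff_graph, map_smul]
  have hfix := fun φ => (H.isSpectralFamilyOf ω).mem_eigenspace_iff (H.isSelfAdjoint ω)
    (E := E) (φ := φ)
  have hfix' := fun φ => (H.isSpectralFamilyOf (y +ᵥ ω)).mem_eigenspace_iff
    (H.isSelfAdjoint (y +ᵥ ω)) (E := E) (φ := φ)
  set P := (H.spec ω).proj {E} with hPdef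
  set Q := (H.spec (y +ᵥ ω)).proj {E} with hQdef
  have hPP : ∀ v, P (P v) = P v := fun v => by
    rw [hPdef, (H.spec ω).proj_proj hm hm, inter_self]
  have hQQ : ∀ v, Q (Q v) = Q v := fun v => by
    rw [hQdef, (H.spec (y +ᵥ ω)).proj_proj hm hm, inter_self]
  have h1 : Q (H.transl y (P φ)) = H.transl y (P φ) :=
    (hfix' _).1 ((heig _).1 ((hfix _).2 (hPP φ)))
  have h2 : Q (H.transl y (φ - P φ)) = 0 := by
    -- `Q U (φ - P φ)` is orthogonal to itself
    obtain ⟨u, hu⟩ := (H.transl y).surjective (Q (H.transl y (φ - P φ)))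
    have hu1 : P u = u := (hfix _).1 ((heig _).2 (by rw [hu]; exact (hfix' _).2 (hQQ _)))
    rw [← inner_self_eq_zero (𝕜 := ℂ)]
    have h3 : inner ℂ (Q (H.transl y (φ - P φ))) (Q (H.transl y (φ - P φ))) =
        inner ℂ (H.transl y (φ - P φ)) (Q (H.transl y (φ - P φ))) := by
      have := (H.spec (y +ᵥ ω)).inner_proj_proj hm hm (H.transl y (φ - P φ))
        (H.transl y (φ - P φ))
      rwa [inter_self] at this
    rw [h3, ← hu, (H.transl y).inner_map_map, inner_sub_left]
    have h4 := (H.spec ω).inner_proj_left hm φ u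
    rw [← hPdef, hu1] at h4
    rw [h4, sub_self]
  rw [map_sub, map_sub, h1, sub_eq_zero] at h2
  exact h2

theorem RandomOperator.locMass_transl (H : RandomOperator 𝔞 d n Ω) (x y : Fin d → ℤ)
    (φ : HSpace (𝔞.measure d) n) :
    locMass (𝔞.measure d) (box x 1) (H.transl y φ) =
      locMass (𝔞.measure d) (box (x - y) 1) φ := by
  rw [locMass_congr (H.transl_apply y φ), locMass, locMass]
  have h := (measurePreserving_sub_pt 𝔞 y).setLIntegral_comp_preimage_emb
    (MeasurableEquiv.subRight (pt y)).measurableEmbedding (fun z => ‖φ z‖ₑ ^ 2) (box (x - y) 1)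
  rw [preimage_sub_pt_box] at h
  rw [← h]
  refine lintegral_congr fun z => ?_
  rw [enorm_smul, ← ofReal_norm (H.phase y z), H.norm_phase]
  simp

/-- Local traces of eigenprojections are covariant. -/
theorem RandomOperator.blockMass_vadd (H : RandomOperator 𝔞 d n Ω) (x y : Fin d → ℤ) (ω : Ω)
    (E : ℝ) : blockMass (box x 1) ((H.spec (y +ᵥ ω)).proj {E}) =
      blockMass (box (x - y) 1) ((H.spec ω).proj {E}) := by
  rw [blockMass_eq_hsSq (measurableSet_box x 1), ← hsSq_comp_isometry _ (H.transl y), mul_assoc]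
  refine tsum_congr fun i => ?_
  change ‖cutoff _ n _ ((H.spec (y +ᵥ ω)).proj {E} (H.transl y _))‖ₑ ^ 2 = _
  rw [enorm_cutoff_sq (measurableSet_box x 1), H.proj_singleton_transl, H.locMass_transl]

end Covariance

/-! ### Length scales -/

theorem eventually_rpow_mul_exp_le_one (A p a c : ℝ) {ζ β : ℝ} (hζ : ζ < β) (hβ : 0 < β)
    (hc : 0 < c) : ∀ᶠ r : ℝ in atTop, A * r ^ p * Real.exp (a * r ^ ζ - c * r ^ β) ≤ 1 := by
  have h1 : Tendsto (fun r : ℝ => r ^ (β - ζ)) atTop atTop := tendsto_rpow_atTop (by linarith)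
  have h2 : Tendsto (fun r : ℝ => A * ((r ^ β) ^ (p / β) * Real.exp (-(c / 2) * r ^ β)))
      atTop (𝓝 (A * 0)) :=
    ((tendsto_rpow_mul_exp_neg_mul_atTop_nhds_zero (p / β) (c / 2) (by positivity)).comp
      (tendsto_rpow_atTop hβ)).const_mul A
  rw [mul_zero] at h2
  filter_upwards [h1.eventually_ge_atTop (2 * |a| / c), h2.eventually_le_const one_pos,
    eventually_gt_atTop 0] with r h3 h4 h5
  have h6 : a * r ^ ζ ≤ c / 2 * r ^ β := by
    have h7 : r ^ β = r ^ (β - ζ) * r ^ ζ := by rw [← Real.rpow_add h5]; simp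
    rw [h7]
    have h8 : 0 < r ^ ζ := by positivity
    have h9 : |a| ≤ c / 2 * r ^ (β - ζ) := by
      rw [div_le_iff₀ hc] at h3; linarith
    calc a * r ^ ζ ≤ (c / 2 * r ^ (β - ζ)) * r ^ ζ :=
          mul_le_mul_of_nonneg_right ((le_abs_self a).trans h9) h8.le
      _ = _ := by ring
  rcases le_total A 0 with hA | hA
  · have : A * r ^ p ≤ 0 := mul_nonpos_of_nonpos_of_nonneg hA (by positivity)
    have h10 := mul_nonpos_of_nonpos_of_nonneg this
      (Real.exp_pos (a * r ^ ζ - c * r ^ β)).le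
    linarith
  · refine le_trans ?_ h4
    rw [← Real.rpow_mul h5.le, mul_div_cancel₀ _ hβ.ne', ← mul_assoc]
    refine mul_le_mul_of_nonneg_left (Real.exp_le_exp.2 ?_) (by positivity)
    linarith

section Scales

variable {Ω : Type*} [MeasurableSpace Ω] {𝔞 : Ambient} {d n : ℕ}

/-- The interval `(E₁, E₂)` satisfies the probability estimates that define the region of
complete localization. -/
def IsLocInterval (b ϱ : ℝ) (F : FiniteVolume 𝔞 d n Ω) (ℙ : Measure Ω) (E₁ E₂ : ℝ) : Prop :=
  ∀ ζ α : ℝ, 0 < ζ → ζ < 1 → 1 < α → α < ζ⁻¹ →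
    ∃ L₀ : ℕ, 6 ∣ L₀ ∧ StrictMono (scale α L₀) ∧ ∃ m : ℝ, 0 < m ∧
      ∀ (k : ℕ) (x y : Fin d → ℤ), (scale α L₀ k : ℝ) + ϱ < ‖pt x - pt y‖ →
        ℙ (goodEvent b F m (scale α L₀ k) (Ioo E₁ E₂) x y)ᶜ ≤
          ENNReal.ofReal (Real.exp (-((scale α L₀ k : ℝ) ^ ζ)))

theorem goodEvent_anti (b : ℝ) (F : FiniteVolume 𝔞 d n Ω) (m : ℝ) (L : ℕ) {I J : Set ℝ}
    (h : J ⊆ I) (x y : Fin d → ℤ) : goodEvent b F m L I x y ⊆ goodEvent b F m L J x y :=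
  fun _ hω E hE => hω E (h hE)

theorem IsLocInterval.mono {b ϱ : ℝ} {F : FiniteVolume 𝔞 d n Ω} {ℙ : Measure Ω} {E₁ E₂ q₁ q₂ : ℝ}
    (h : IsLocInterval b ϱ F ℙ E₁ E₂) (hq : Ioo q₁ q₂ ⊆ Ioo E₁ E₂) :
    IsLocInterval b ϱ F ℙ q₁ q₂ := by
  intro ζ α h1 h2 h3 h4
  obtain ⟨L₀, h5, h6, m, hm, h7⟩ := h ζ α h1 h2 h3 h4
  refine ⟨L₀, h5, h6, m, hm, fun k x y hxy => (measure_mono ?_).trans (h7 k x y hxy)⟩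
  exact compl_subset_compl.2 (goodEvent_anti b F m _ hq x y)

/-- Estimates on a continuous family of scales: to each distance `r > r₀` belongs a scale `ℓ r`
with `ℓ r ≤ r ≤ C (ℓ r)^α`, at which two cubes with centers at distance `r` are both singular
for a common energy with probability at most `exp (-(ℓ r)^ζ)`. -/
structure HasScales (b : ℝ) (F : FiniteVolume 𝔞 d n Ω) (ℙ : Measure Ω) (E₁ E₂ ζ α m : ℝ)
    (ℓ : ℝ → ℕ) (r₀ C : ℝ) : Prop where
  C_pos : 0 < C
  m_pos : 0 < m
  six_le : ∀ r, r₀ < r → 6 ≤ ℓ r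
  even : ∀ r, r₀ < r → Even (ℓ r)
  le : ∀ r, r₀ < r → (ℓ r : ℝ) ≤ r
  ge : ∀ r, r₀ < r → r ≤ C * (ℓ r : ℝ) ^ α
  prob : ∀ x y : Fin d → ℤ, r₀ < ‖pt x - pt y‖ →
    ℙ (goodEvent b F m (ℓ ‖pt x - pt y‖) (Ioo E₁ E₂) x y)ᶜ ≤
      ENNReal.ofReal (Real.exp (-((ℓ ‖pt x - pt y‖ : ℝ) ^ ζ)))

/-- The scale of the distance `r` is the largest `L_k` with `L_k + ϱ < r`, so that
`r ≤ L_{k+1} + ϱ ≤ L_k ^ α + ϱ`. -/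
theorem IsLocInterval.exists_hasScales {b ϱ : ℝ} (hϱ : 0 < ϱ) {F : FiniteVolume 𝔞 d n Ω}
    {ℙ : Measure Ω} {E₁ E₂ : ℝ} (h : IsLocInterval b ϱ F ℙ E₁ E₂) {ζ α : ℝ} (h1 : 0 < ζ)
    (h2 : ζ < 1) (h3 : 1 < α) (h4 : α < ζ⁻¹) :
    ∃ m ℓ r₀ C, HasScales b F ℙ E₁ E₂ ζ α m ℓ r₀ C := by
  obtain ⟨L₀, h5, h6, m, hm, h7⟩ := h ζ α h1 h2 h3 h4
  set s := scale α L₀ with hs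
  have hdvd : ∀ k, 6 ∣ s k := by
    intro k
    cases k with
    | zero => exact h5
    | succ k => exact ⟨_, rfl⟩
  -- All scales vanish if `L₀ = 0`, which strict monotonicity rules out.
  have hL₀ : 0 < s 0 := by
    by_contra h8
    have h9 : s 0 = 0 := by omega
    have h10 : s 1 = 0 := by
      have : s 1 = 6 * ⌊((s 0 : ℕ) : ℝ) ^ α / 6⌋₊ := rfl
      rw [this, h9, Nat.cast_zero, Real.zero_rpow (by linarith)]
      simp
    have := h6 (show 0 < 1 by norm_num)
    omega
  have hpos : ∀ k, 6 ≤ s k := fun k =>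
    Nat.le_of_dvd (hL₀.trans_le (h6.monotone (Nat.zero_le k))) (hdvd k)
  have hstep : ∀ k, (s (k + 1) : ℝ) ≤ (s k : ℝ) ^ α := by
    intro k
    have h8 : s (k + 1) = 6 * ⌊((s k : ℕ) : ℝ) ^ α / 6⌋₊ := rfl
    have h9 := Nat.floor_le (show (0 : ℝ) ≤ ((s k : ℕ) : ℝ) ^ α / 6 by positivity)
    rw [h8]; push_cast; linarith
  have hex : ∀ r : ℝ, ∃ k, r ≤ s k + ϱ := by
    intro r
    obtain ⟨k, hk⟩ := exists_nat_ge r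
    have : (k : ℝ) ≤ s k := by exact_mod_cast h6.le_apply
    exact ⟨k, by linarith⟩
  classical
  have hmain : ∀ r : ℝ, (s 0 : ℝ) + ϱ < r →
      (s (Nat.find (hex r) - 1) : ℝ) + ϱ < r ∧
        r ≤ (1 + ϱ) * (s (Nat.find (hex r) - 1) : ℝ) ^ α := by
    intro r hr
    have h8 := Nat.find_spec (hex r)
    have h9 : Nat.find (hex r) ≠ 0 := by
      intro h10
      rw [h10] at h8
      linarith
    obtain ⟨k, hk⟩ := Nat.exists_eq_succ_of_ne_zero h9
    have h10 := Nat.find_min (hex r) (m := k) (by omega)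
    rw [hk] at h8 ⊢
    simp only [Nat.succ_eq_add_one, Nat.add_sub_cancel] at h8 ⊢
    refine ⟨not_le.1 h10, ?_⟩
    have h11 : (1 : ℝ) ≤ (s k : ℝ) ^ α :=
      Real.one_le_rpow (by exact_mod_cast (by linarith [hpos k] : 1 ≤ s k)) (by linarith)
    nlinarith [hstep k]
  refine ⟨m, fun r => s (Nat.find (hex r) - 1), s 0 + ϱ, 1 + ϱ, by positivity, hm,
    fun r _ => hpos _, fun r _ => ?_, fun r hr => ?_, fun r hr => (hmain r hr).2,
    fun x y hxy => h7 _ x y (hmain _ hxy).1⟩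
  · obtain ⟨c, hc⟩ := hdvd (Nat.find (hex r) - 1)
    rw [hc]
    exact ⟨3 * c, by ring⟩
  · linarith [(hmain r hr).1]

variable {b : ℝ} {F : FiniteVolume 𝔞 d n Ω} {ℙ : Measure Ω} {E₁ E₂ ζ α m : ℝ} {ℓ : ℝ → ℕ}
  {r₀ C : ℝ}

theorem HasScales.rpow_le (h : HasScales b F ℙ E₁ E₂ ζ α m ℓ r₀ C) (hα : 0 < α) {r : ℝ}
    (hr : r₀ < r) : C⁻¹ ^ α⁻¹ * r ^ α⁻¹ ≤ ℓ r := by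
  have h1 := h.ge r hr
  have hC := h.C_pos
  have h6 : (6 : ℝ) ≤ ℓ r := by exact_mod_cast h.six_le r hr
  have hr0 : 0 ≤ r := by linarith [h.le r hr]
  have h2 : C⁻¹ * r ≤ (ℓ r : ℝ) ^ α := by rwa [inv_mul_le_iff₀ hC]
  have h3 := Real.rpow_le_rpow (by positivity) h2 (inv_nonneg.2 hα.le)
  rwa [Real.mul_rpow (by positivity) hr0, Real.rpow_rpow_inv (by positivity) hα.ne'] at h3

/-- Polynomial bounds at the scales, in terms of the distance. -/
theorem HasScales.exp_le (h : HasScales b F ℙ E₁ E₂ ζ α m ℓ r₀ C) (hα : 0 < α) (A p a c : ℝ)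
    {s η : ℝ} (hη : 0 < η) (hc : 0 < c) (hs : s < η / α) :
    ∃ r₁, r₀ ≤ r₁ ∧ ∀ r, r₁ < r → A * r ^ p * Real.exp (a * r ^ s - c * (ℓ r : ℝ) ^ η) ≤ 1 := by
  have hC := h.C_pos
  obtain ⟨r₂, hr₂⟩ := eventually_atTop.1 (eventually_rpow_mul_exp_le_one A p a
    (c * (C⁻¹ ^ α⁻¹) ^ η) hs (by positivity) (by positivity))
  refine ⟨max r₀ r₂, le_max_left _ _, fun r hr => ?_⟩
  have hr0 : r₀ < r := (le_max_left _ _).trans_lt hr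
  have h6 : (6 : ℝ) ≤ ℓ r := by exact_mod_cast h.six_le r hr0
  have hrp : 0 < r := by linarith [h.le r hr0]
  rcases le_total A 0 with hA | hA
  · have : A * r ^ p ≤ 0 := mul_nonpos_of_nonpos_of_nonneg hA (by positivity)
    have h10 := mul_nonpos_of_nonpos_of_nonneg this
      (Real.exp_pos (a * r ^ s - c * (ℓ r : ℝ) ^ η)).le
    linarith
  refine le_trans ?_ (hr₂ r ((le_max_right _ _).trans hr.le))
  refine mul_le_mul_of_nonneg_left (Real.exp_le_exp.2 ?_) (by positivity)
  have h1 := Real.rpow_le_rpow (by positivity) (h.rpow_le hα hr0) hη.le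
  rw [Real.mul_rpow (by positivity) (by positivity), ← Real.rpow_mul hrp.le,
    inv_mul_eq_div] at h1
  have := mul_le_mul_of_nonneg_left h1 hc.le
  linarith

/-- The probability of a pair of singular cubes is summable in the distance of the cubes. -/
theorem HasScales.exists_prob_le (h : HasScales b F ℙ E₁ E₂ ζ α m ℓ r₀ C) (hα : 0 < α)
    (hζ : 0 < ζ) {p : ℝ} (hp : 0 ≤ p) :
    ∃ r₁, r₀ ≤ r₁ ∧ ∀ r, r₁ < r → Real.exp (-((ℓ r : ℝ) ^ ζ)) ≤ (1 + r) ^ (-p) := by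
  obtain ⟨r₁, h1, h2⟩ := h.exp_le hα (2 ^ p) p 0 1 (s := 0) hζ one_pos (by positivity)
  refine ⟨r₁, h1, fun r hr => ?_⟩
  have h3 := h2 r hr
  have h6 : (6 : ℝ) ≤ ℓ r := by exact_mod_cast h.six_le r (h1.trans_lt hr)
  have hr1 : 6 ≤ r := by linarith [h.le r (h1.trans_lt hr)]
  have h4 : (1 + r) ^ p ≤ 2 ^ p * r ^ p := by
    rw [← Real.mul_rpow (by norm_num) (by linarith)]
    exact Real.rpow_le_rpow (by linarith) (by linarith) hp
  rw [Real.rpow_neg (by linarith), ← one_div, le_div_iff₀ (by positivity), mul_comm]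
  refine le_trans (mul_le_mul_of_nonneg_right h4 (Real.exp_pos _).le) ?_
  simpa using h3

theorem eventually_cofinite_lt_norm (x₀ : Fin d → ℤ) (r : ℝ) :
    ∀ᶠ x : Fin d → ℤ in cofinite, r < ‖pt x₀ - pt x‖ := by
  have h : {x : Fin d → ℤ | ‖pt x₀ - pt x‖ ≤ r}.Finite :=
    (nearSites x₀ ⌈r⌉₊).finite_toSet.subset fun x hx => mem_nearSites (hx.trans (Nat.le_ceil r))
  filter_upwards [h.compl_mem_cofinite] with x hx
  exact not_le.1 hx

/-- Borel-Cantelli: almost surely, each cube has a singular partner at only finitely many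
sites. -/
theorem HasScales.ae_finite_bad (h : HasScales b F ℙ E₁ E₂ ζ α m ℓ r₀ C) (hα : 0 < α)
    (hζ : 0 < ζ) : ∀ᵐ ω ∂ℙ, ∀ x₀ : Fin d → ℤ, ∀ᶠ x in cofinite, r₀ < ‖pt x₀ - pt x‖ →
      ω ∈ goodEvent b F m (ℓ ‖pt x₀ - pt x‖) (Ioo E₁ E₂) x₀ x := by
  obtain ⟨r₁, h1, h2⟩ := h.exists_prob_le hα hζ (p := d + 1) (by positivity)
  rw [ae_all_iff]
  intro x₀
  set s : (Fin d → ℤ) → Set Ω := fun x =>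
    {ω | r₁ < ‖pt x₀ - pt x‖ ∧
      ω ∈ (goodEvent b F m (ℓ ‖pt x₀ - pt x‖) (Ioo E₁ E₂) x₀ x)ᶜ} with hs
  have h3 : ∀ x, ℙ (s x) ≤ wt (d + 1) (x - x₀) := by
    intro x
    by_cases hx : r₁ < ‖pt x₀ - pt x‖
    · refine (measure_mono fun ω hω => hω.2).trans
        ((h.prob x₀ x (h1.trans_lt hx)).trans ?_)
      rw [wt, pt_sub, norm_sub_rev (pt x)]
      exact ENNReal.ofReal_le_ofReal (h2 _ hx)
    · have : s x = ∅ := by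
        ext ω; simp [hs, hx]
      rw [this, measure_empty]
      exact zero_le
  have h4 : ∑' x, ℙ (s x) ≠ ∞ := by
    refine ((ENNReal.tsum_le_tsum h3).trans_lt ?_).ne
    rw [tsum_wt_sub]
    exact tsum_wt_lt_top (by linarith)
  filter_upwards [ae_finite_setOfPred_mem h4] with ω hω
  have h5 : ∀ᶠ x : Fin d → ℤ in cofinite, x ∉ {x | ω ∈ s x} := hω.compl_mem_cofinite
  filter_upwards [h5, eventually_cofinite_lt_norm x₀ r₁] with x hx hx' _
  by_contra h8
  exact hx ⟨hx', h8⟩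

end Scales

/-! ### Generalized eigenfunctions and eigenfunctions -/

section GenEigBasic

variable {d n : ℕ} {ν : Measure (Fin d → ℝ)} {κ E : ℝ} {A : HSpace ν n →ₗ.[ℂ] HSpace ν n}
  {ψ : (Fin d → ℝ) → EuclideanSpace ℂ (Fin n)}

theorem IsGenEigenfunction.weightedMass_lt_top (h : IsGenEigenfunction κ A E ψ) :
    locMass ν univ (fun z => jap z ^ (-κ) • ψ z) < ∞ := by
  rw [locMass, Measure.restrict_univ, ← eLpNorm_two_sq]
  exact ENNReal.pow_lt_top h.memLp.2

theorem jap_rpow_mul_cancel (κ : ℝ) (z : Fin d → ℝ) : jap z ^ κ * jap z ^ (-κ) = 1 := by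
  rw [← Real.rpow_add (jap_pos z), add_neg_cancel, Real.rpow_zero]

theorem IsGenEigenfunction.aestronglyMeasurable (h : IsGenEigenfunction κ A E ψ) :
    AEStronglyMeasurable ψ ν := by
  have h1 : AEStronglyMeasurable (fun z => jap z ^ κ • (jap z ^ (-κ) • ψ z)) ν :=
    (measurable_jap.pow_const κ).aestronglyMeasurable.smul h.memLp.1
  refine h1.congr (Eventually.of_forall fun z => ?_)
  dsimp only
  rw [smul_smul, jap_rpow_mul_cancel, one_smul]

theorem IsGenEigenfunction.locMass_lt_top (hκ : 0 ≤ κ) (h : IsGenEigenfunction κ A E ψ)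
    (x : Fin d → ℤ) {L : ℝ} (hL : 0 ≤ L) {S : Set (Fin d → ℝ)} (hm : MeasurableSet S)
    (hS : S ⊆ box x L) : locMass ν S ψ < ∞ :=
  (locMass_box_le hκ x hL hm hS ψ).trans_lt (ENNReal.mul_lt_top ENNReal.ofReal_lt_top
    ((locMass_mono (subset_univ _) _).trans_lt h.weightedMass_lt_top))

theorem IsGenEigenfunction.locMass_belt_le (hκ : 0 ≤ κ) (h : IsGenEigenfunction κ A E ψ) (b : ℝ)
    (x : Fin d → ℤ) {L : ℝ} (hL : 0 ≤ L) : locMass ν (belt b x L) ψ ≤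
      ENNReal.ofReal (((d + 1) * (1 + ‖pt x‖ + L)) ^ (2 * κ) *
        (locMass ν univ (fun z => jap z ^ (-κ) • ψ z)).toReal) := by
  rw [ENNReal.ofReal_mul (by positivity), ENNReal.ofReal_toReal h.weightedMass_lt_top.ne]
  exact (locMass_box_le hκ x hL (measurableSet_belt _ _ _) (belt_subset_box b x L) ψ).trans
    (mul_le_mul_right (locMass_mono (subset_univ _) _) _)

/-- A nonzero eigenfunction is a generalized eigenfunction. -/
theorem isGenEigenfunction_of_mem_eigenspace (hκ : 0 ≤ κ) (hA : IsSelfAdjoint A) {φ : HSpace ν n}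
    (hφ : φ ∈ eigenspace A E) (h0 : φ ≠ 0) : IsGenEigenfunction κ A E φ where
  memLp := (memLp_congr_ae (Tinv_apply hκ φ)).1 (Lp.memLp (Tinv κ ν n φ))
  ne_zero h := h0 ((Lp.eq_zero_iff_ae_eq_zero).2 h)
  eq u η hu _ _ := by
    rw [LinearPMap.mem_graph_iff] at hu
    obtain ⟨v, hv1, hv2⟩ := hu
    dsimp only at hv1 hv2
    obtain ⟨hD, hE⟩ := mem_eigenspace_iff_apply.1 hφ
    have h1 := inner_map_symm hA v ⟨φ, hD⟩
    rw [hE, hv1, hv2, inner_smul_right, L2.inner_def, L2.inner_def] at h1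
    exact h1

/-- A square integrable generalized eigenfunction is an eigenfunction, since the equation
extends from the core `D₊` to the whole domain. -/
theorem IsGenEigenfunction.toLp_mem_eigenspace (hA : IsSelfAdjoint A)
    (hcore : A.HasCore (DPlus κ A)) (h : IsGenEigenfunction κ A E ψ) (hψ : MemLp ψ 2 ν) :
    hψ.toLp ψ ∈ eigenspace A E := by
  set Ψ : HSpace ν n := hψ.toLp ψ with hΨ
  have hint : ∀ u : HSpace ν n, ∫ z, inner ℂ (u z) (ψ z) ∂ν = inner ℂ u Ψ := by
    intro u
    rw [L2.inner_def]
    refine integral_congr_ae ?_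
    filter_upwards [hψ.coeFn_toLp] with z hz
    rw [hΨ, hz]
  refine mem_eigenspace_iff_graph.2 (mem_graph_of_inner hA fun φ => ?_)
  rw [inner_smul_right]
  have hcl : (A.domRestrict (DPlus κ A)).IsClosable :=
    LinearPMap.IsClosable.leIsClosable hA.isClosed.isClosable LinearPMap.domRestrict_le
  have hg : ((φ : HSpace ν n), A φ) ∈ A.graph := A.mem_graph φ
  have hgr : A.graph = (A.domRestrict (DPlus κ A)).graph.topologicalClosure := by
    rw [hcl.graph_closure_eq_closure_graph, hcore.closure_eq]
  rw [hgr] at hg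
  have hclosed : IsClosed {p : HSpace ν n × HSpace ν n | inner ℂ p.2 Ψ = (E : ℂ) * inner ℂ p.1 Ψ} :=
    isClosed_eq (by fun_prop) (by fun_prop)
  refine closure_minimal ?_ hclosed hg
  rintro ⟨u, η⟩ hu
  obtain ⟨v, hv1, hv2⟩ := LinearPMap.mem_graph_iff _ |>.1 hu
  dsimp only at hv1 hv2
  have hvS : (v : HSpace ν n) ∈ A.domain ⊓ DPlus κ A := ⟨v.2.2, v.2.1⟩
  obtain ⟨⟨u', η'⟩, ⟨hp1, hp2⟩, hp3⟩ := hvS.2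
  have hAv : (A.domRestrict (DPlus κ A)) v = A ⟨v, hvS.1⟩ := LinearPMap.domRestrict_apply rfl
  have hu' : u' = u := by rw [← hv1]; exact hp3
  have hη : η' = η := by
    obtain ⟨w, hw1, hw2⟩ := LinearPMap.mem_graph_iff _ |>.1 hp1
    dsimp only at hw1 hw2
    have hw3 : w = ⟨v, hvS.1⟩ := Subtype.ext (by rw [hw1, hu', ← hv1])
    rw [← hw2, hw3, ← hAv, hv2]
  subst hu' hη
  have := h.eq u' η' hp1 hp2.1 hp2.2
  rw [hint, hint] at this
  exact this

end GenEigBasic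

/-! ### Decay of generalized eigenfunctions -/

section Decay

variable {Ω : Type*} [MeasurableSpace Ω] {𝔞 : Ambient} {d n : ℕ} [VAdd (Fin d → ℤ) Ω]

/-- The eigenfunction decay inequality for one `ω`, with constant `γ`, for energies in
`[E₁, E₂]`. -/
def HasEDI (κ b γ E₁ E₂ : ℝ) (H : RandomOperator 𝔞 d n Ω) (F : FiniteVolume 𝔞 d n Ω) (ω : Ω) :
    Prop :=
  ∀ E ∈ Icc E₁ E₂, ∀ ψ, IsGenEigenfunction κ (H.op ω) E ψ →
    ∀ (x : Fin d → ℤ) (L : ℕ), 0 < L → Even L → ∀ R, IsResolventAt (F.op ω x L) E R →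
      localNorm (𝔞.measure d) (box x 1) ψ ≤
        γ * ‖cutoff _ n (belt b x L) * R * cutoff _ n (box x 1)‖ *
          localNorm (𝔞.measure d) (belt b x L) ψ

variable {κ b γ E₁ E₂ : ℝ} {H : RandomOperator 𝔞 d n Ω} {F : FiniteVolume 𝔞 d n Ω} {ω : Ω}

/-- In a regular cube a generalized eigenfunction is small at the center, by the eigenfunction
decay inequality. -/
theorem IsRegular.locMass_le {m E : ℝ} {x : Fin d → ℤ} {L : ℕ} (hreg : IsRegular b F ω m E x L)
    (hL : 6 ≤ L) (hLe : Even L) (hκ : 0 ≤ κ) (hEDI : HasEDI κ b γ E₁ E₂ H F ω)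
    (hE : E ∈ Icc E₁ E₂) {ψ : (Fin d → ℝ) → EuclideanSpace ℂ (Fin n)}
    (hψ : IsGenEigenfunction κ (H.op ω) E ψ) :
    locMass (𝔞.measure d) (box x 1) ψ ≤
      ENNReal.ofReal (γ ^ 2 * Real.exp (-(m * L))) * locMass (𝔞.measure d) (belt b x L) ψ := by
  obtain ⟨R, hR, hnorm⟩ := hreg
  have h1 := hEDI E hE ψ hψ x L (by omega) hLe R hR
  have hL6 : (6 : ℝ) ≤ L := by exact_mod_cast hL
  have hm1 := measurableSet_box x 1
  have hcut : ‖cutoff ((𝔞.measure d).restrict (box x L)) n (belt b x L) * R *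
      cutoff _ n (box x 1)‖ ≤ Real.exp (-m * ((L : ℝ) / 2)) := by
    rw [← cutoff_mul_cutoff (measurableSet_box x ((L : ℝ) / 3)) hm1
      (box_subset_box x (by linarith)), ← mul_assoc]
    refine (norm_mul_le _ _).trans ?_
    refine (mul_le_mul hnorm (norm_cutoff_le hm1) (norm_nonneg _) (Real.exp_pos _).le).trans ?_
    rw [mul_one]
  have hb0 : 0 ≤ localNorm (𝔞.measure d) (belt b x L) ψ := ENNReal.toReal_nonneg
  have h2 : localNorm (𝔞.measure d) (box x 1) ψ ≤
      |γ| * Real.exp (-m * ((L : ℝ) / 2)) * localNorm (𝔞.measure d) (belt b x L) ψ := by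
    refine h1.trans (mul_le_mul_of_nonneg_right ?_ hb0)
    exact mul_le_mul (le_abs_self γ) hcut (norm_nonneg _) (abs_nonneg _)
  have h3 : localNorm (𝔞.measure d) (box x 1) ψ ^ 2 ≤
      (γ ^ 2 * Real.exp (-(m * L))) * localNorm (𝔞.measure d) (belt b x L) ψ ^ 2 := by
    refine (pow_le_pow_left₀ ENNReal.toReal_nonneg h2 2).trans (le_of_eq ?_)
    rw [mul_pow, mul_pow, sq_abs, ← Real.exp_nat_mul]
    congr 3
    push_cast; ring
  have hf1 := hψ.locMass_lt_top hκ x zero_le_one hm1 subset_rfl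
  have hf2 := hψ.locMass_lt_top hκ x (Nat.cast_nonneg L) (measurableSet_belt b x L)
    (belt_subset_box b x L)
  rw [localNorm_eq hm1, localNorm_eq (measurableSet_belt b x L)] at h3
  rw [← ENNReal.ofReal_toReal hf1.ne, ← ENNReal.ofReal_toReal hf2.ne,
    ← ENNReal.ofReal_mul (by positivity)]
  exact ENNReal.ofReal_le_ofReal h3

theorem IsGenEigenfunction.exists_locMass_ne_zero (hκ : 0 ≤ κ) {E : ℝ}
    {A : HSpace (𝔞.measure d) n →ₗ.[ℂ] HSpace (𝔞.measure d) n}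
    {ψ : (Fin d → ℝ) → EuclideanSpace ℂ (Fin n)} (hψ : IsGenEigenfunction κ A E ψ) :
    ∃ x : Fin d → ℤ, locMass (𝔞.measure d) (box x 1) ψ ≠ 0 := by
  by_contra! h
  have h1 : ∀ x : Fin d → ℤ, locMass (𝔞.measure d) (box x 1) (fun z => jap z ^ (-κ) • ψ z) = 0 :=
    fun x => le_antisymm ((locMass_jap_smul_le hκ x ψ).trans (by rw [h x, mul_zero])) zero_le
  have h2 : locMass (𝔞.measure d) univ (fun z => jap z ^ (-κ) • ψ z) = 0 := by
    rw [locMass_univ_eq_tsum]; simp [h1]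
  rw [locMass, Measure.restrict_univ, ← eLpNorm_two_sq, sq_eq_zero_iff,
    eLpNorm_eq_zero_iff hψ.memLp.1 (by norm_num)] at h2
  refine hψ.ne_zero (h2.mono fun z hz => ?_)
  have := jap_pos z
  exact (smul_eq_zero.1 hz).resolve_left (by positivity)

variable {ζ α m : ℝ} {ℓ : ℝ → ℕ} {r₀ C : ℝ} {ℙ : Measure Ω}

/-- Generalized eigenfunctions decay: at a site `x₀` where `ψ` does not vanish, cubes of large
scale cannot be regular, hence all distant cubes are. -/
theorem IsGenEigenfunction.eventually_locMass_le (hκ : 0 ≤ κ)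
    (h : HasScales b F ℙ E₁ E₂ ζ α m ℓ r₀ C) (hα : 0 < α)
    (hgood : ∀ x₀ : Fin d → ℤ, ∀ᶠ x in cofinite, r₀ < ‖pt x₀ - pt x‖ →
      ω ∈ goodEvent b F m (ℓ ‖pt x₀ - pt x‖) (Ioo E₁ E₂) x₀ x)
    (hEDI : HasEDI κ b γ E₁ E₂ H F ω) {E : ℝ} (hE : E ∈ Ioo E₁ E₂)
    {ψ : (Fin d → ℝ) → EuclideanSpace ℂ (Fin n)} (hψ : IsGenEigenfunction κ (H.op ω) E ψ)
    {s : ℝ} (hs0 : 0 ≤ s) (hs : s < α⁻¹) :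
    ∀ᶠ x : Fin d → ℤ in cofinite, locMass (𝔞.measure d) (box x 1) ψ ≤
      ENNReal.ofReal (Real.exp (-2 * eucl (pt x) ^ s)) := by
  obtain ⟨x₀, hx₀⟩ := hψ.exists_locMass_ne_zero hκ
  have hm := h.m_pos
  set V : ℝ := (locMass (𝔞.measure d) univ (fun z => jap z ^ (-κ) • ψ z)).toReal with hV
  have hV0 : 0 ≤ V := ENNReal.toReal_nonneg
  set X : ℝ := ‖pt x₀‖ with hX
  have hX0 : 0 ≤ X := norm_nonneg _
  -- the bound at the center of a regular cube of side `ℓ r ≤ r` not further than `r` from `x₀`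
  set K : ℝ := γ ^ 2 * ((d + 1) * (3 + X)) ^ (2 * κ) * V with hK
  have hK0 : 0 ≤ K := by positivity
  have hreg : ∀ (x : Fin d → ℤ) (r : ℝ), r₀ < r → ‖pt x‖ ≤ X + r →
      IsRegular b F ω m E x (ℓ r) →
      locMass (𝔞.measure d) (box x 1) ψ ≤
        ENNReal.ofReal (K * r ^ (2 * κ) * Real.exp (-(m * ℓ r))) := by
    intro x r hr hxr hreg
    have h6 : (6 : ℝ) ≤ ℓ r := by exact_mod_cast h.six_le r hr
    have h7 := h.le r hr
    refine (hreg.locMass_le (h.six_le r hr) (h.even r hr) hκ hEDI ⟨hE.1.le, hE.2.le⟩ hψ).trans ?_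
    refine (mul_le_mul_right (hψ.locMass_belt_le hκ b x (Nat.cast_nonneg _)) _).trans ?_
    rw [← ENNReal.ofReal_mul (by positivity)]
    refine ENNReal.ofReal_le_ofReal ?_
    have h8 : (((d : ℝ) + 1) * (1 + ‖pt x‖ + ℓ r)) ^ (2 * κ) ≤
        ((d + 1) * (3 + X)) ^ (2 * κ) * r ^ (2 * κ) := by
      rw [← Real.mul_rpow (by positivity) (by linarith)]
      refine Real.rpow_le_rpow (by positivity) ?_ (by positivity)
      rw [mul_assoc]
      refine mul_le_mul_of_nonneg_left ?_ (by positivity)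
      nlinarith
    calc γ ^ 2 * Real.exp (-(m * ℓ r)) * ((((d : ℝ) + 1) * (1 + ‖pt x‖ + ℓ r)) ^ (2 * κ) * V)
        ≤ γ ^ 2 * Real.exp (-(m * ℓ r)) *
          ((((d + 1) * (3 + X)) ^ (2 * κ) * r ^ (2 * κ)) * V) := by gcongr
      _ = _ := by rw [hK]; ring
  have hx₀f : locMass (𝔞.measure d) (box x₀ 1) ψ < ∞ :=
    hψ.locMass_lt_top hκ x₀ zero_le_one (measurableSet_box _ _) subset_rfl
  set c₀ := (locMass (𝔞.measure d) (box x₀ 1) ψ).toReal with hc₀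
  have hc₀pos : 0 < c₀ := ENNReal.toReal_pos hx₀ hx₀f.ne
  -- For `r > r₁` the cube at `x₀` is not regular, since the bound at its center would be at most
  -- `c₀ / 2`; for `r > r₂` the bound at `x` implies the claim, as `|x| ≤ d (X + 1) r`.
  obtain ⟨r₁, hr₁, h1⟩ := h.exp_le hα (K * (2 / c₀)) (2 * κ) 0 m (s := 0) one_pos hm
    (by positivity)
  obtain ⟨r₂, hr₂, h2⟩ := h.exp_le hα K (2 * κ) (2 * (d * (X + 1)) ^ s) m (s := s) one_pos hm
    (by rwa [one_div])
  filter_upwards [hgood x₀, eventually_cofinite_lt_norm x₀ (max r₁ r₂)] with x hx hr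
  set r := ‖pt x₀ - pt x‖ with hrdef
  have hr1 : r₁ < r := (le_max_left _ _).trans_lt hr
  have hr2 : r₂ < r := (le_max_right _ _).trans_lt hr
  have hr0 : r₀ < r := hr₁.trans_lt hr1
  have h6 : (6 : ℝ) ≤ ℓ r := by exact_mod_cast h.six_le r hr0
  have hrge : 6 ≤ r := h6.trans (h.le r hr0)
  have hxX : ‖pt x‖ ≤ X + r := by
    have := norm_le_norm_add_norm_sub (pt x₀) (pt x)
    linarith
  rcases hx hr0 E hE with hc | hc
  · exfalso
    have h3 := hreg x₀ r hr0 (by linarith) hc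
    have h4 := ENNReal.toReal_mono ENNReal.ofReal_ne_top h3
    rw [ENNReal.toReal_ofReal (by positivity), ← hc₀] at h4
    have h5 := h1 r hr1
    rw [zero_mul, zero_sub, Real.rpow_one] at h5
    have h7 : K * r ^ (2 * κ) * Real.exp (-(m * ℓ r)) * (2 / c₀) ≤ 1 := by
      refine le_trans (le_of_eq ?_) h5; ring
    rw [← mul_div_assoc, div_le_one hc₀pos] at h7
    linarith
  · refine (hreg x r hr0 hxX hc).trans (ENNReal.ofReal_le_ofReal ?_)
    have h5 := h2 r hr2
    rw [Real.rpow_one, sub_eq_add_neg, Real.exp_add] at h5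
    have h7 : eucl (pt x) ^ s ≤ (d * (X + 1)) ^ s * r ^ s := by
      rw [← Real.mul_rpow (by positivity) (by linarith)]
      refine Real.rpow_le_rpow (eucl_nonneg _) ((eucl_le _).trans ?_) hs0
      rw [mul_assoc]
      refine mul_le_mul_of_nonneg_left ?_ (by positivity)
      nlinarith
    have h8 : K * r ^ (2 * κ) * Real.exp (-(m * ℓ r)) ≤
        Real.exp (-(2 * (d * (X + 1)) ^ s * r ^ s)) := by
      rw [Real.exp_neg (2 * _ * _), ← one_div, le_div_iff₀ (Real.exp_pos _)]
      refine le_trans (le_of_eq ?_) h5; ring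
    refine h8.trans (Real.exp_le_exp.2 ?_)
    linarith

theorem tsum_lt_top_of_eventually_le {ι : Type*} {f g : ι → ℝ≥0∞} (hf : ∀ i, f i < ∞)
    (hg : ∑' i, g i < ∞) (h : ∀ᶠ i in cofinite, f i ≤ g i) : ∑' i, f i < ∞ := by
  classical
  have hfin : {i | ¬ f i ≤ g i}.Finite := h
  have h1 : ∀ i, f i ≤ g i + if i ∈ hfin.toFinset then f i else 0 := by
    intro i
    by_cases hi : f i ≤ g i
    · exact hi.trans le_self_add
    · have : i ∈ hfin.toFinset := hfin.mem_toFinset.2 hi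
      rw [if_pos this]; exact le_add_self
  refine (ENNReal.tsum_le_tsum h1).trans_lt ?_
  rw [ENNReal.tsum_add, ENNReal.add_lt_top]
  refine ⟨hg, ?_⟩
  rw [tsum_eq_sum (s := hfin.toFinset) fun i hi => if_neg hi]
  refine ENNReal.sum_lt_top.2 fun i hi => ?_
  rw [if_pos hi]; exact hf i

/-- A generalized eigenfunction with decay is square integrable: sub-exponentials are summable
over the lattice. -/
theorem IsGenEigenfunction.memLp_two (hκ : 0 ≤ κ) {E : ℝ}
    {A : HSpace (𝔞.measure d) n →ₗ.[ℂ] HSpace (𝔞.measure d) n}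
    {ψ : (Fin d → ℝ) → EuclideanSpace ℂ (Fin n)} (hψ : IsGenEigenfunction κ A E ψ) {s : ℝ}
    (hs : 0 < s) (h : ∀ᶠ x : Fin d → ℤ in cofinite, locMass (𝔞.measure d) (box x 1) ψ ≤
      ENNReal.ofReal (Real.exp (-2 * eucl (pt x) ^ s))) : MemLp ψ 2 (𝔞.measure d) := by
  refine ⟨hψ.aestronglyMeasurable, ?_⟩
  have h1 : locMass (𝔞.measure d) univ ψ < ∞ := by
    rw [locMass_univ_eq_tsum]
    refine tsum_lt_top_of_eventually_le (g := wt (d + 1))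
      (fun x => hψ.locMass_lt_top hκ x zero_le_one (measurableSet_box _ _) subset_rfl)
      (tsum_wt_lt_top (by linarith)) ?_
    obtain ⟨R, hR⟩ := eventually_atTop.1 (eventually_rpow_mul_exp_le_one (2 ^ ((d : ℝ) + 1))
      (d + 1) 0 2 (ζ := 0) hs hs two_pos)
    filter_upwards [h, eventually_cofinite_lt_norm (0 : Fin d → ℤ) (max R 1)] with x hx hr
    refine hx.trans (ENNReal.ofReal_le_ofReal ?_)
    have h0 : pt (0 : Fin d → ℤ) = 0 := by ext; simp [pt]
    rw [h0, zero_sub, norm_neg] at hr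
    have hr1 : 1 < ‖pt x‖ := (le_max_right _ _).trans_lt hr
    have h2 := hR ‖pt x‖ ((le_max_left _ _).trans hr.le)
    rw [zero_mul, zero_sub] at h2
    have h3 : ‖pt x‖ ^ s ≤ eucl (pt x) ^ s :=
      Real.rpow_le_rpow (norm_nonneg _) (norm_le_eucl _) hs.le
    have h4 : (1 + ‖pt x‖) ^ ((d : ℝ) + 1) ≤ 2 ^ ((d : ℝ) + 1) * ‖pt x‖ ^ ((d : ℝ) + 1) := by
      rw [← Real.mul_rpow (by norm_num) (by linarith)]
      exact Real.rpow_le_rpow (by linarith) (by linarith) (by positivity)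
    rw [Real.rpow_neg (by linarith), ← one_div, le_div_iff₀ (by positivity), mul_comm]
    refine (mul_le_mul h4 (Real.exp_le_exp.2 ?_) (Real.exp_pos _).le (by positivity)).trans h2
    linarith
  rw [locMass, Measure.restrict_univ, ← eLpNorm_two_sq] at h1
  by_contra h2
  rw [not_lt, top_le_iff] at h2
  rw [h2] at h1
  simp at h1

/-- The exceptional finite set of sites only costs a constant. -/
theorem exists_localNorm_le {ψ : (Fin d → ℝ) → EuclideanSpace ℂ (Fin n)} {s : ℝ}
    (h : ∀ᶠ x : Fin d → ℤ in cofinite, locMass (𝔞.measure d) (box x 1) ψ ≤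
      ENNReal.ofReal (Real.exp (-2 * eucl (pt x) ^ s))) :
    ∃ C : ℝ, ∀ x : Fin d → ℤ, localNorm (𝔞.measure d) (box x 1) ψ ≤
      C * Real.exp (-(eucl (pt x) ^ s)) := by
  set q : (Fin d → ℤ) → ℝ := fun x =>
    localNorm (𝔞.measure d) (box x 1) ψ * Real.exp (eucl (pt x) ^ s) with hq
  have hq0 : ∀ x, 0 ≤ q x := fun x => mul_nonneg ENNReal.toReal_nonneg (Real.exp_pos _).le
  have h1 : ∀ᶠ x in cofinite, q x ≤ 1 := by
    filter_upwards [h] with x hx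
    have h2 := ENNReal.toReal_mono ENNReal.ofReal_ne_top hx
    rw [← localNorm_eq (measurableSet_box x 1), ENNReal.toReal_ofReal (Real.exp_pos _).le] at h2
    have h3 : q x ^ 2 ≤ 1 := by
      rw [hq]; dsimp only
      rw [mul_pow, ← Real.exp_nat_mul]
      calc _ ≤ Real.exp (-2 * eucl (pt x) ^ s) * Real.exp ((2 : ℕ) * eucl (pt x) ^ s) :=
            mul_le_mul_of_nonneg_right h2 (Real.exp_pos _).le
        _ = 1 := by rw [← Real.exp_add]; simp
    nlinarith [hq0 x]
  have hfin : {x | ¬ q x ≤ 1}.Finite := h1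
  refine ⟨1 + ∑ x ∈ hfin.toFinset, q x, fun x => ?_⟩
  have h4 : q x ≤ 1 + ∑ x ∈ hfin.toFinset, q x := by
    by_cases hx : q x ≤ 1
    · linarith [Finset.sum_nonneg (s := hfin.toFinset) fun x _ => hq0 x]
    · linarith [Finset.single_le_sum (f := q) (fun x _ => hq0 x) (hfin.mem_toFinset.2 hx)]
  rw [Real.exp_neg, ← div_eq_mul_inv, le_div_iff₀ (Real.exp_pos _)]
  exact h4

end Decay

/-! ### Densities of vector-valued set functions -/

section Density

/-- The real case of `exists_density`, with a square integrable density. -/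
theorem exists_density_real {α G : Type*} [MeasurableSpace α] [NormedAddCommGroup G]
    [InnerProductSpace ℝ G] [CompleteSpace G] (μ : Measure α) [IsFiniteMeasure μ]
    (m : Set α → G) (hadd : ∀ s t, MeasurableSet s → MeasurableSet t → Disjoint s t →
      m (s ∪ t) = m s + m t) {C : ℝ} (hC : 0 ≤ C)
    (hm : ∀ s, MeasurableSet s → ‖m s‖ ≤ C * μ.real s) :
    ∃ K : Lp G 2 μ, ∀ s, MeasurableSet s → m s = ∫ t in s, K t ∂μ := by
  have hT : DominatedFinMeasAdditive μ (fun s => innerSL ℝ (m s)) C := by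
    refine ⟨fun s t hs ht _ _ hst => ?_, fun s hs _ => ?_⟩
    · dsimp only; rw [hadd s t hs ht hst, map_add]
    · rw [innerSL_apply_norm]; exact hm s hs
  have hint : ∀ f : Lp G 2 μ, Integrable f μ := fun f => (Lp.memLp f).integrable (by norm_num)
  let L₀ : Lp G 2 μ →ₗ[ℝ] ℝ :=
    { toFun := fun f => setToFun μ _ hT f
      map_add' := fun f g => by
        rw [← setToFun_add hT (hint f) (hint g)]
        exact setToFun_congr_ae hT (Lp.coeFn_add f g)
      map_smul' := fun c f => by
        rw [RingHom.id_apply, ← setToFun_smul hT (fun c s x => by simp) c f]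
        exact setToFun_congr_ae hT (Lp.coeFn_smul c f) }
  have hbound : ∀ f, ‖L₀ f‖ ≤ C * (μ.real univ) ^ (1 / 2 : ℝ) * ‖f‖ := by
    intro f
    have h1 : ‖setToFun μ _ hT f‖ ≤ C * ‖(hint f).toL1 f‖ := by
      rw [setToFun_congr_ae hT (hint f).coeFn_toL1.symm]
      exact norm_setToFun_le_mul_norm hT _ hC
    have h2 : ‖(hint f).toL1 f‖ ≤ (μ.real univ) ^ (1 / 2 : ℝ) * ‖f‖ := by
      rw [L1.norm_def, ← eLpNorm_one_eq_lintegral_enorm, eLpNorm_congr_ae (hint f).coeFn_toL1,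
        Lp.norm_def]
      have h3 := eLpNorm_le_eLpNorm_mul_rpow_measure_univ (p := 1) (q := 2) (by norm_num)
        (Lp.aestronglyMeasurable f)
      have h4 := ENNReal.toReal_mono (ENNReal.mul_ne_top (Lp.eLpNorm_ne_top f)
        (ENNReal.rpow_ne_top_of_nonneg (by norm_num) (measure_ne_top _ _))) h3
      refine h4.trans (le_of_eq ?_)
      rw [ENNReal.toReal_mul, mul_comm, ← ENNReal.toReal_rpow, Measure.real]
      norm_num
    calc ‖L₀ f‖ ≤ C * ‖(hint f).toL1 f‖ := h1
      _ ≤ C * ((μ.real univ) ^ (1 / 2 : ℝ) * ‖f‖) := by gcongr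
      _ = _ := by ring
  let L : Lp G 2 μ →L[ℝ] ℝ := L₀.mkContinuous _ hbound
  refine ⟨(InnerProductSpace.toDual ℝ (Lp G 2 μ)).symm L, fun s hs => ?_⟩
  refine ext_inner_left ℝ fun u => ?_
  rw [← L2.inner_indicatorConstLp_eq_inner_setIntegral ℝ hs (measure_ne_top μ s) u,
    real_inner_comm, real_inner_comm _ (indicatorConstLp 2 hs _ u),
    InnerProductSpace.toDual_symm_apply]
  change _ = setToFun μ _ hT _
  rw [setToFun_congr_ae hT indicatorConstLp_coeFn,
    setToFun_indicator_const hT hs (measure_ne_top μ s)]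
  rfl

/-- An additive set function with values in a Hilbert space that is dominated by a finite measure
has a density.  It represents the functional that the set function induces on `L²(μ; G)`. -/
theorem exists_density {α G : Type*} [MeasurableSpace α] [NormedAddCommGroup G]
    [InnerProductSpace ℂ G] [CompleteSpace G] (μ : Measure α) [IsFiniteMeasure μ]
    (m : Set α → G) (hadd : ∀ s t, MeasurableSet s → MeasurableSet t → Disjoint s t →
      m (s ∪ t) = m s + m t) {C : ℝ} (hC : 0 ≤ C)
    (hm : ∀ s, MeasurableSet s → ‖m s‖ ≤ C * μ.real s) :
    ∃ K : α → G, Integrable K μ ∧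
      ∀ s, MeasurableSet s → ∀ u, inner ℂ u (m s) = ∫ t in s, inner ℂ u (K t) ∂μ := by
  let _ : InnerProductSpace ℝ G := InnerProductSpace.rclikeToReal ℂ G
  obtain ⟨K, hK⟩ := exists_density_real μ m hadd hC hm
  have hint : Integrable K μ := (Lp.memLp K).integrable (by norm_num)
  refine ⟨K, hint, fun s hs u => ?_⟩
  rw [hK s hs, integral_inner hint.integrableOn]

/-- An additive set function on a bounded interval vanishes if on sets of radius `ε` it is bounded
by `ε` times a finite measure. -/
theorem eq_zero_of_norm_le_mul_diam {D : Set ℝ → ℂ} {M : Measure ℝ} [IsFiniteMeasure M] {a b : ℝ}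
    (hadd : ∀ s t, MeasurableSet s → MeasurableSet t → Disjoint s t → s ⊆ Ico a b →
      t ⊆ Ico a b → D (s ∪ t) = D s + D t)
    (hD : ∀ s, MeasurableSet s → s ⊆ Ico a b → ∀ c ε, s ⊆ Icc (c - ε) (c + ε) →
      ‖D s‖ ≤ ε * M.real s) {s : Set ℝ} (hs : MeasurableSet s) (hsI : s ⊆ Ico a b) : D s = 0 := by
  -- Cut off pieces of radius `δ`, one at a time.
  have key : ∀ (δ : ℝ) (N : ℕ), ∀ s, MeasurableSet s → s ⊆ Ico a b → s ⊆ Ico a (a + N * (2 * δ)) →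
      ‖D s‖ ≤ δ * M.real s := by
    intro δ N
    induction N with
    | zero =>
      intro s hs h1 h2
      exact hD s hs h1 0 δ fun t ht => by
        have := h2 ht
        simp at this
    | succ N ih =>
      intro s hs h1 h2
      have h3 : s = (s ∩ Iio (a + N * (2 * δ))) ∪ (s ∩ (Iio (a + N * (2 * δ)))ᶜ) :=
        (inter_union_compl s _).symm
      have hm1 := hs.inter (measurableSet_Iio (a := a + N * (2 * δ)))
      have hm2 := hs.inter (measurableSet_Iio (a := a + N * (2 * δ))).compl
      have hdisj : Disjoint (s ∩ Iio (a + N * (2 * δ))) (s ∩ (Iio (a + N * (2 * δ)))ᶜ) :=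
        disjoint_compl_right.mono inter_subset_right inter_subset_right
      have h4 := ih _ hm1 (inter_subset_left.trans h1) fun t ht => ⟨(h1 ht.1).1, ht.2⟩
      have h5 := hD _ hm2 (inter_subset_left.trans h1) (a + N * (2 * δ) + δ) δ fun t ht => by
        have h6 := h2 ht.1
        have h7 : a + N * (2 * δ) ≤ t := not_lt.1 ht.2
        have h8 := h6.2
        push_cast at h8
        constructor <;> linarith
      have h9 : M.real s = M.real (s ∩ Iio (a + N * (2 * δ))) +
          M.real (s ∩ (Iio (a + N * (2 * δ)))ᶜ) := by
        rw [← measureReal_union hdisj hm2, ← h3]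
      have h10 : D s = D (s ∩ Iio (a + N * (2 * δ))) + D (s ∩ (Iio (a + N * (2 * δ)))ᶜ) := by
        rw [← hadd _ _ hm1 hm2 hdisj (inter_subset_left.trans h1) (inter_subset_left.trans h1),
          ← h3]
      rw [h10, h9, mul_add]
      exact (norm_add_le _ _).trans (add_le_add h4 h5)
  have h1 : ∀ N : ℕ, ‖D s‖ ≤ (b - a) / 2 * M.real s * (1 / ((N : ℝ) + 1)) := by
    intro N
    have hN : (0 : ℝ) < N + 1 := by positivity
    have h2 := key ((b - a) / (2 * (N + 1))) (N + 1) s hs hsI (by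
      have : a + ((N + 1 : ℕ) : ℝ) * (2 * ((b - a) / (2 * (N + 1)))) = b := by
        push_cast; field_simp; ring
      rw [this]; exact hsI)
    refine h2.trans (le_of_eq ?_)
    field_simp
  have h2 : Tendsto (fun N : ℕ => (b - a) / 2 * M.real s * (1 / ((N : ℝ) + 1))) atTop
      (𝓝 ((b - a) / 2 * M.real s * 0)) := tendsto_one_div_add_atTop_nhds_zero_nat.const_mul _
  rw [mul_zero] at h2
  exact norm_le_zero_iff.1 (ge_of_tendsto' h2 h1)

end Density

/-! ### The expansion in generalized eigenfunctions -/

section Expansion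

variable {d n : ℕ} {ν : Measure (Fin d → ℝ)}

/-- The vector measure `B ↦ T⁻¹ P_B T⁻¹ e` is dominated by the trace measure. -/
theorem enorm_Tinv_proj_Tinv_le {κ : ℝ} (P : SpectralFamily (HSpace ν n)) {B : Set ℝ}
    (hB : MeasurableSet B) (e : HSpace ν n) :
    ‖Tinv κ ν n (P.proj B (Tinv κ ν n e))‖ₑ ≤ traceMeasure κ P B * ‖e‖ₑ := by
  have h1 := enorm_apply_sq_le_hsSq (Tinv κ ν n * P.proj B) (P.proj B (Tinv κ ν n e))
  have h2 := enorm_apply_sq_le_hsSq (P.proj B * Tinv κ ν n) e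
  have h3 : hsSq (P.proj B * Tinv κ ν n) = traceMeasure κ P B := by
    rw [traceMeasure, Measure.sum_apply _ hB]
    refine tsum_congr fun i => ?_
    rw [P.measure_apply _ hB, enorm_sq_eq_ofReal]
    rfl
  rw [← traceMeasure_eq_hsSq κ P hB] at h1
  rw [h3] at h2
  have h4 : (Tinv κ ν n * P.proj B) (P.proj B (Tinv κ ν n e)) =
      Tinv κ ν n (P.proj B (Tinv κ ν n e)) := by
    change Tinv κ ν n (P.proj B (P.proj B _)) = _
    rw [P.proj_proj hB hB, inter_self]
  rw [h4] at h1
  have h5 : ‖Tinv κ ν n (P.proj B (Tinv κ ν n e))‖ₑ ^ 2 ≤ (traceMeasure κ P B * ‖e‖ₑ) ^ 2 := by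
    refine h1.trans ((mul_le_mul_right h2 _).trans (le_of_eq ?_))
    ring
  rwa [ENNReal.pow_le_pow_left_iff (by norm_num)] at h5

/-- Spectral measures of pairs of vectors: if `v` is the density of `B ↦ ⟨φ, P_B h⟩` on a bounded
interval, then `t ↦ t v(t)` is the density of `B ↦ ⟨A φ, P_B h⟩`. -/
theorem inner_map_proj_eq_integral {𝓗 : Type*} [NormedAddCommGroup 𝓗] [InnerProductSpace ℂ 𝓗]
    [CompleteSpace 𝓗] {P : SpectralFamily 𝓗} {A : 𝓗 →ₗ.[ℂ] 𝓗} (hA : IsSelfAdjoint A)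
    (hP : IsSpectralFamilyOf P A) {a b : ℝ} {μ : Measure ℝ} {v : ℝ → ℂ} (hv : Integrable v μ)
    (φ : A.domain) (h : 𝓗)
    (hvφ : ∀ B, MeasurableSet B → B ⊆ Ico a b →
      inner ℂ (φ : 𝓗) (P.proj B h) = ∫ t in B, v t ∂μ)
    {B : Set ℝ} (hB : MeasurableSet B) (hBI : B ⊆ Ico a b) :
    inner ℂ (A φ) (P.proj B h) = ∫ t in B, (t : ℂ) * v t ∂μ := by
  have htv : IntegrableOn (fun t : ℝ => (t : ℂ) * v t) (Ico a b) μ := by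
    refine hv.integrableOn.bdd_mul (c := |a| + |b|) (by fun_prop) ?_
    filter_upwards [ae_restrict_mem measurableSet_Ico] with t ht
    rw [Complex.norm_real, Real.norm_eq_abs, abs_le]
    constructor
    · linarith [ht.1, neg_abs_le a, abs_nonneg b]
    · linarith [ht.2, le_abs_self b, abs_nonneg a]
  set M : Measure ℝ := P.measure (φ : 𝓗) + P.measure h + μ.withDensity (fun t => ‖v t‖ₑ) with hM
  have hfin : IsFiniteMeasure (μ.withDensity fun t => ‖v t‖ₑ) :=
    isFiniteMeasure_withDensity hv.2.ne
  have hMreal : ∀ s, MeasurableSet s → M.real s =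
      ‖P.proj s (φ : 𝓗)‖ ^ 2 + ‖P.proj s h‖ ^ 2 + ∫ t in s, ‖v t‖ ∂μ := by
    intro s hs
    rw [hM, measureReal_add_apply, measureReal_add_apply, Measure.real, Measure.real,
      P.measure_apply _ hs, P.measure_apply _ hs, ENNReal.toReal_ofReal (by positivity),
      ENNReal.toReal_ofReal (by positivity), Measure.real, withDensity_apply _ hs,
      integral_norm_eq_lintegral_enorm hv.1.restrict]
  -- On a set within `ε` of `c`, both set functions differ from `c ⟨φ, P_s h⟩` by at most `ε M`.
  have hzero := eq_zero_of_norm_le_mul_diam (M := M) (a := a) (b := b)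
    (D := fun s => inner ℂ (A φ) (P.proj s h) - ∫ t in s, (t : ℂ) * v t ∂μ)
    (fun s t hs ht hst hsI htI => by
      rw [P.proj_union hs ht hst, inner_add_right, setIntegral_union hst ht (htv.mono_set hsI)
        (htv.mono_set htI)]
      ring)
    (fun s hs hsI c ε hsc => by
      rcases s.eq_empty_or_nonempty with rfl | ⟨t₀, ht₀⟩
      · simp [P.proj_empty]
      have hε : 0 ≤ ε := by
        have := hsc ht₀
        linarith [this.1, this.2]
      have hD := hP.proj_mem_domain_of_bounded hs hsc h
      set g : A.domain := ⟨P.proj s h, hD⟩ with hg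
      have hgp : P.proj s (g : 𝓗) = g := by rw [hg]; dsimp only; rw [P.proj_proj hs hs, inter_self]
      have e1 : inner ℂ (A φ) (P.proj s h) - (c : ℂ) * ∫ t in s, v t ∂μ =
          inner ℂ (P.proj s (φ : 𝓗)) (A g - (c : ℂ) • (g : 𝓗)) := by
        rw [← hvφ s hs hsI, inner_sub_right, inner_smul_right, ← hP.inner_map_proj hA hs φ g hgp,
          ← inner_map_symm hA φ g, P.inner_proj_left hs, hgp]
      have e2 : ‖inner ℂ (P.proj s (φ : 𝓗)) (A g - (c : ℂ) • (g : 𝓗))‖ ≤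
          ε * (‖P.proj s (φ : 𝓗)‖ ^ 2 + ‖P.proj s h‖ ^ 2) := by
        refine (norm_inner_le_norm _ _).trans ?_
        have h1 := hP.norm_map_sub_le hA hs hsc g hgp
        have h2 : ‖(g : 𝓗)‖ = ‖P.proj s h‖ := rfl
        rw [h2] at h1
        refine (mul_le_mul_of_nonneg_left h1 (norm_nonneg _)).trans ?_
        have h3 := mul_nonneg hε (sq_nonneg (‖P.proj s (φ : 𝓗)‖ - ‖P.proj s h‖))
        have h4 := mul_nonneg hε (add_nonneg (sq_nonneg ‖P.proj s (φ : 𝓗)‖)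
          (sq_nonneg ‖P.proj s h‖))
        nlinarith
      have e3 : ‖(∫ t in s, (t : ℂ) * v t ∂μ) - (c : ℂ) * ∫ t in s, v t ∂μ‖ ≤
          ε * ∫ t in s, ‖v t‖ ∂μ := by
        rw [← integral_const_mul, ← integral_sub (htv.mono_set hsI)
          (hv.integrableOn.const_mul _), ← integral_const_mul]
        refine norm_integral_le_of_norm_le (hv.integrableOn.norm.const_mul _) ?_
        filter_upwards [ae_restrict_mem hs] with t ht
        rw [← sub_mul, norm_mul, ← Complex.ofReal_sub, Complex.norm_real, Real.norm_eq_abs]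
        refine mul_le_mul_of_nonneg_right (abs_le.2 ?_) (norm_nonneg _)
        have := hsc ht
        constructor <;> linarith [this.1, this.2]
      have e4 : inner ℂ (A φ) (P.proj s h) - ∫ t in s, (t : ℂ) * v t ∂μ =
          inner ℂ (P.proj s (φ : 𝓗)) (A g - (c : ℂ) • (g : 𝓗)) -
            ((∫ t in s, (t : ℂ) * v t ∂μ) - (c : ℂ) * ∫ t in s, v t ∂μ) := by
        rw [← e1]; ring
      rw [e4, hMreal s hs, mul_add]
      exact (norm_sub_le _ _).trans (add_le_add e2 e3))
    hB hBI
  exact sub_eq_zero.1 hzero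

end Expansion

section Expansion

variable {d n : ℕ} {ν : Measure (Fin d → ℝ)}

instance secondCountableTopology_HSpace [SFinite ν] : SecondCountableTopology (HSpace ν n) := by
  have : Fact ((2 : ℝ≥0∞) ≠ ∞) := ⟨by norm_num⟩
  exact Lp.SecondCountableTopology

theorem exists_Tinv_eq {κ : ℝ} (hκ : 0 ≤ κ) {φ : HSpace ν n} (hφ : φ ∈ HPlus κ ν n) :
    ∃ p : HSpace ν n, Tinv κ ν n p = φ ∧ p =ᵐ[ν] fun z => jap z ^ κ • φ z := by
  have h : MemLp (fun z => jap z ^ κ • φ z) 2 ν := hφ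
  refine ⟨h.toLp _, Lp.ext ?_, h.coeFn_toLp⟩
  filter_upwards [Tinv_apply hκ (h.toLp _), h.coeFn_toLp] with z h1 h2
  rw [h1, h2, smul_smul, mul_comm, jap_rpow_mul_cancel, one_smul]

theorem inner_Tinv_right {κ : ℝ} (u v : HSpace ν n) :
    inner ℂ u (Tinv κ ν n v) = inner ℂ (Tinv κ ν n u) v := (inner_Tinv_left κ u v).symm

/-- The expansion in generalized eigenfunctions.  On a bounded interval of finite trace measure
`μ`, the vector-valued set function `B ↦ T⁻¹ P_B T⁻¹ e` has a density `K` with respect to `μ`, and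
`T K(t)` solves the generalized eigenvalue equation with eigenvalue `t`, for `μ`-almost every `t`.
The equation holds for a countable dense set of test vectors, hence for all of them. -/
theorem exists_genEigenfunction_density [SFinite ν] {κ : ℝ} (hκ : 0 ≤ κ)
    {A : HSpace ν n →ₗ.[ℂ] HSpace ν n} (hA : IsSelfAdjoint A) {P : SpectralFamily (HSpace ν n)}
    (hP : IsSpectralFamilyOf P A) {a b : ℝ} (hfin : traceMeasure κ P (Ico a b) < ∞)
    (e : HSpace ν n) :
    ∃ K : ℝ → HSpace ν n,
      (∀ B, MeasurableSet B → B ⊆ Ico a b → ∀ u, inner ℂ u (Tinv κ ν n (P.proj B (Tinv κ ν n e))) =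
        ∫ t in B, inner ℂ u (K t) ∂(traceMeasure κ P)) ∧
      ∀ᵐ t ∂(traceMeasure κ P).restrict (Ico a b), K t ≠ 0 →
        IsGenEigenfunction κ A t (fun z => jap z ^ κ • K t z) := by
  have hI : MeasurableSet (Ico a b) := measurableSet_Ico
  set μ := (traceMeasure κ P).restrict (Ico a b) with hμ
  have : IsFiniteMeasure μ := ⟨by rw [hμ, Measure.restrict_apply_univ]; exact hfin⟩
  obtain ⟨K, hKint, hK⟩ := exists_density μ
    (fun B => Tinv κ ν n (P.proj (B ∩ Ico a b) (Tinv κ ν n e)))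
    (fun s t hs ht hst => by
      rw [union_inter_distrib_right, P.proj_union (hs.inter hI) (ht.inter hI)
        (hst.mono inter_subset_left inter_subset_left), map_add])
    (norm_nonneg e)
    (fun s hs => by
      have h1 := enorm_Tinv_proj_Tinv_le (κ := κ) P (hs.inter hI) e
      have h2 : traceMeasure κ P (s ∩ Ico a b) = μ s := by rw [hμ, Measure.restrict_apply hs]
      rw [h2] at h1
      have h3 := ENNReal.toReal_mono (ENNReal.mul_ne_top (measure_ne_top μ s) enorm_ne_top) h1
      rw [ENNReal.toReal_mul, toReal_enorm, toReal_enorm, mul_comm] at h3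
      exact h3)
  have hKB : ∀ B, MeasurableSet B → B ⊆ Ico a b → ∀ u,
      inner ℂ u (Tinv κ ν n (P.proj B (Tinv κ ν n e))) = ∫ t in B, inner ℂ u (K t) ∂μ := by
    intro B hB hBI u
    rw [← hK B hB u, inter_eq_left.2 hBI]
  refine ⟨K, fun B hB hBI u => ?_, ?_⟩
  · rw [hKB B hB hBI u, hμ, Measure.restrict_restrict hB, inter_eq_left.2 hBI]
  -- Pairs `(T φ, T A φ)` for `φ` in `D₊`; a countable dense subset of them suffices.
  set S : Set (HSpace ν n × HSpace ν n) :=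
    {p | (Tinv κ ν n p.1, Tinv κ ν n p.2) ∈ A.graph} with hS
  obtain ⟨c, hcS, hcc, hSc⟩ :=
    (TopologicalSpace.IsSeparable.of_separableSpace S).exists_countable_dense_subset
  have hpair : ∀ p ∈ S, ∀ᵐ t ∂μ, inner ℂ p.2 (K t) = (t : ℂ) * inner ℂ p.1 (K t) := by
    rintro ⟨p, q⟩ hp
    obtain ⟨φ, hφ1, hφ2⟩ := LinearPMap.mem_graph_iff _ |>.1 hp
    dsimp only at hφ1 hφ2 ⊢
    have hv : Integrable (fun t => inner ℂ p (K t)) μ := hKint.const_inner p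
    have hw : Integrable (fun t => inner ℂ q (K t)) μ := hKint.const_inner q
    have htv : Integrable (fun t : ℝ => (t : ℂ) * inner ℂ p (K t)) μ := by
      refine hv.bdd_mul (c := |a| + |b|) (by fun_prop) ?_
      filter_upwards [ae_restrict_mem hI] with t ht
      rw [Complex.norm_real, Real.norm_eq_abs, abs_le]
      constructor
      · linarith [ht.1, neg_abs_le a, abs_nonneg b]
      · linarith [ht.2, le_abs_self b, abs_nonneg a]
    refine Integrable.ae_eq_of_forall_setIntegral_eq _ _ hw htv fun s hs _ => ?_
    have hred : ∀ f : ℝ → ℂ, ∫ t in s, f t ∂μ = ∫ t in s ∩ Ico a b, f t ∂μ := by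
      intro f
      rw [hμ, Measure.restrict_restrict hs, Measure.restrict_restrict (hs.inter hI), inter_assoc,
        inter_self]
    rw [hred, hred, ← inner_map_proj_eq_integral hA hP hv φ (Tinv κ ν n e) (fun B hB hBI => by
        rw [hφ1, ← hKB B hB hBI, inner_Tinv_right]) (hs.inter hI) inter_subset_right,
      ← hKB _ (hs.inter hI) inter_subset_right, hφ2, inner_Tinv_right]
  have hall : ∀ᵐ t ∂μ, ∀ p ∈ c, inner ℂ p.2 (K t) = (t : ℂ) * inner ℂ p.1 (K t) :=
    (ae_ball_iff hcc).2 fun p hp => hpair p (hcS hp)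
  filter_upwards [hall] with t ht hKt
  have hall' : ∀ p ∈ S, inner ℂ p.2 (K t) = (t : ℂ) * inner ℂ p.1 (K t) := by
    have hcl : IsClosed {p : HSpace ν n × HSpace ν n |
        inner ℂ p.2 (K t) = (t : ℂ) * inner ℂ p.1 (K t)} :=
      isClosed_eq (by fun_prop) (by fun_prop)
    exact fun p hp => closure_minimal (fun p hp => ht p hp) hcl (hSc hp)
  have hcancel : ∀ z, jap z ^ (-κ) • jap z ^ κ • K t z = K t z := fun z => by
    rw [smul_smul, mul_comm, jap_rpow_mul_cancel, one_smul]
  refine ⟨?_, fun h0 => hKt ?_, fun φ η hg hφ hη => ?_⟩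
  · simp_rw [hcancel]
    exact Lp.memLp (K t)
  · rw [Lp.eq_zero_iff_ae_eq_zero]
    filter_upwards [h0] with z hz
    have := jap_pos z
    exact (smul_eq_zero.1 hz).resolve_left (by positivity)
  · obtain ⟨p, hp1, hp2⟩ := exists_Tinv_eq hκ hφ
    obtain ⟨q, hq1, hq2⟩ := exists_Tinv_eq hκ hη
    have h1 := hall' (p, q) (by
      change (Tinv κ ν n p, Tinv κ ν n q) ∈ A.graph
      rw [hp1, hq1]; exact hg)
    have h2 : ∀ (φ p : HSpace ν n), p =ᵐ[ν] (fun z => jap z ^ κ • φ z) →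
        ∫ z, inner ℂ (φ z) (jap z ^ κ • K t z) ∂ν = inner ℂ p (K t) := by
      intro φ p hp
      rw [L2.inner_def]
      refine integral_congr_ae (hp.mono fun z hz => ?_)
      dsimp only at hz ⊢
      rw [hz, ← Complex.coe_smul, ← Complex.coe_smul, inner_smul_left, inner_smul_right,
        Complex.conj_ofReal]
    rw [h2 η q hq2, h2 φ p hp2]
    exact h1

end Expansion

/-! ### Pure point spectrum -/

section PurePoint

variable {d n : ℕ} {ν : Measure (Fin d → ℝ)}

/-- Eigenvalues are atoms of the trace measure, because `T⁻¹` is injective. -/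
theorem traceMeasure_singleton_pos {κ : ℝ} (hκ : 0 ≤ κ) {A : HSpace ν n →ₗ.[ℂ] HSpace ν n}
    (hA : IsSelfAdjoint A) {P : SpectralFamily (HSpace ν n)} (hP : IsSpectralFamilyOf P A) {E : ℝ}
    {φ : HSpace ν n} (hφ : φ ∈ eigenspace A E) (h0 : φ ≠ 0) : 0 < traceMeasure κ P {E} := by
  rw [pos_iff_ne_zero]
  intro h
  rw [traceMeasure_eq_hsSq κ P (measurableSet_singleton E)] at h
  have h1 := enorm_apply_sq_le_hsSq (Tinv κ ν n * P.proj {E}) φ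
  rw [h, zero_mul] at h1
  have h2 : Tinv κ ν n φ = 0 := by
    have h3 : (Tinv κ ν n * P.proj {E}) φ = Tinv κ ν n φ := by
      change Tinv κ ν n (P.proj {E} φ) = _
      rw [(hP.mem_eigenspace_iff hA).1 hφ]
    rw [h3] at h1
    have h4 : ‖Tinv κ ν n φ‖ₑ ^ 2 = 0 := le_antisymm h1 zero_le
    simpa using h4
  exact h0 (Tinv_injective hκ (by rw [h2, map_zero]))

/-- If all generalized eigenvalues in a bounded interval of finite trace measure are eigenvalues,
then the spectral measure of the interval lives on the countable set of eigenvalues. -/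
theorem exists_countable_proj_diff_eq_zero [SFinite ν] {κ : ℝ} (hκ : 0 ≤ κ)
    {A : HSpace ν n →ₗ.[ℂ] HSpace ν n} (hA : IsSelfAdjoint A) {P : SpectralFamily (HSpace ν n)}
    (hP : IsSpectralFamilyOf P A) {a b : ℝ} (hfin : traceMeasure κ P (Ico a b) < ∞)
    {J : Set ℝ} (hJ : MeasurableSet J) (hJI : J ⊆ Ico a b)
    (heig : ∀ E ∈ J, ∀ ψ, IsGenEigenfunction κ A E ψ → ∃ φ ∈ eigenspace A E, φ ≠ 0) :
    ∃ S : Set ℝ, S.Countable ∧ P.proj (J \ S) = 0 := by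
  set μ := (traceMeasure κ P).restrict (Ico a b) with hμ
  have : IsFiniteMeasure μ := ⟨by rw [hμ, Measure.restrict_apply_univ]; exact hfin⟩
  -- `S` is the set of atoms of the trace measure, which contains all eigenvalues.
  set S : Set ℝ := {t | 0 < μ {s | s = t}} with hSdef
  have hS : S.Countable := Measure.countable_meas_level_set_pos (μ := μ) measurable_id
  have hm : MeasurableSet (J \ S) := hJ.diff hS.measurableSet
  refine ⟨S, hS, ?_⟩
  have hzero : ∀ e : HSpace ν n, Tinv κ ν n (P.proj (J \ S) (Tinv κ ν n e)) = 0 := by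
    intro e
    obtain ⟨K, hK1, hK2⟩ := exists_genEigenfunction_density hκ hA hP hfin e
    refine ext_inner_left ℂ fun u => ?_
    rw [inner_zero_right, hK1 _ hm (sdiff_subset.trans hJI)]
    refine setIntegral_eq_zero_of_ae_eq_zero ?_
    rw [ae_restrict_iff' measurableSet_Ico] at hK2
    filter_upwards [hK2] with t ht htJ
    have hKt : K t = 0 := by
      by_contra h
      obtain ⟨φ, hφ, hφ0⟩ := heig t htJ.1 _ (ht (hJI htJ.1) h)
      refine htJ.2 ?_
      have h1 := traceMeasure_singleton_pos hκ hA hP hφ hφ0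
      have hmt : MeasurableSet {s : ℝ | s = t} := measurableSet_singleton t
      change 0 < μ {s | s = t}
      rw [hμ, Measure.restrict_apply hmt]
      have h2 : {s | s = t} ∩ Ico a b = {t} := by
        ext s
        constructor
        · exact fun h => h.1
        · intro h
          rw [mem_singleton_iff] at h
          subst h
          exact ⟨rfl, hJI htJ.1⟩
      rwa [h2]
    rw [hKt, inner_zero_right]
  have h1 : ∀ e : HSpace ν n, P.proj (J \ S) (Tinv κ ν n e) = 0 := fun e =>
    Tinv_injective hκ (by rw [hzero, map_zero])
  ext1 φ
  refine Tinv_injective hκ ?_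
  rw [zero_apply, map_zero]
  refine ext_inner_left ℂ fun u => ?_
  rw [inner_Tinv_right, ← P.inner_proj_left hm, h1, inner_zero_left, inner_zero_right]

/-- A countable union of sets whose spectral measure lives on countable sets gives pure point
spectrum. -/
theorem hasPurePointSpectrumIn_of_countable {𝓗 : Type*} [NormedAddCommGroup 𝓗]
    [InnerProductSpace ℂ 𝓗] [CompleteSpace 𝓗] {A : 𝓗 →ₗ.[ℂ] 𝓗} (hA : IsSelfAdjoint A)
    {P : SpectralFamily 𝓗} (hP : IsSpectralFamilyOf P A) {X : Set ℝ} (hX : MeasurableSet X)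
    {ι : Type*} [Countable ι] {J S : ι → Set ℝ} (hJ : ∀ i, MeasurableSet (J i))
    (hXJ : X ⊆ ⋃ i, J i) (hS : ∀ i, (S i).Countable) (hz : ∀ i, P.proj (J i \ S i) = 0) :
    HasPurePointSpectrumIn A P X := by
  -- The spectral measure of a vector orthogonal to all eigenvectors has no atoms in `X`, and
  -- nothing else.
  intro φ
  set M : Submodule ℂ 𝓗 := ⨆ E ∈ X, eigenspace A E with hM
  rw [← Submodule.orthogonal_orthogonal_eq_closure, Submodule.mem_orthogonal']
  intro v hv
  rw [Submodule.mem_orthogonal] at hv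
  have hpoint : ∀ E ∈ X, P.measure v {E} = 0 := by
    intro E hE
    have hm : MeasurableSet ({E} : Set ℝ) := measurableSet_singleton E
    rw [← P.proj_eq_zero_iff_measure hm]
    have h1 : P.proj {E} v ∈ M := by
      refine Submodule.mem_iSup_of_mem E (Submodule.mem_iSup_of_mem hE ?_)
      rw [hP.mem_eigenspace_iff hA, P.proj_proj hm hm, inter_self]
    have h2 := hv _ h1
    rw [P.inner_proj_left hm, P.inner_proj_eq hm] at h2
    have h3 : ‖P.proj {E} v‖ ^ 2 = 0 := by exact_mod_cast h2
    simpa using h3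
  have hnull : P.measure v X = 0 := by
    have hsub : X ⊆ (⋃ i, (J i \ S i)) ∪ ⋃ E ∈ X ∩ ⋃ i, S i, {E} := by
      intro t ht
      obtain ⟨i, hi⟩ := mem_iUnion.1 (hXJ ht)
      by_cases h : t ∈ S i
      · exact Or.inr (mem_biUnion ⟨ht, mem_iUnion.2 ⟨i, h⟩⟩ rfl)
      · exact Or.inl (mem_iUnion.2 ⟨i, hi, h⟩)
    refine measure_mono_null hsub (measure_union_null ?_ ?_)
    · refine measure_iUnion_null fun i => ?_
      rw [← P.proj_eq_zero_iff_measure ((hJ i).diff (hS i).measurableSet), hz i]; rfl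
    · exact (measure_biUnion_null_iff ((countable_iUnion hS).mono inter_subset_right)).2
        fun E hE => hpoint E hE.1
  rw [P.inner_proj_left hX, (P.proj_eq_zero_iff_measure hX v).2 hnull, inner_zero_right]

end PurePoint

/-! ### A deterministic bound on the trace measure -/

section TraceBound

theorem isResolventAt_iff_graph {𝓗 : Type*} [NormedAddCommGroup 𝓗] [InnerProductSpace ℂ 𝓗]
    [CompleteSpace 𝓗] {A : 𝓗 →ₗ.[ℂ] 𝓗} {E : ℝ} {R : 𝓗 →L[ℂ] 𝓗} :
    IsResolventAt A E R ↔ (∀ φ, (R φ, φ + (E : ℂ) • R φ) ∈ A.graph) ∧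
      ∀ φ η, (φ, η) ∈ A.graph → R (η - (E : ℂ) • φ) = φ := by
  constructor
  · rintro ⟨h1, h2⟩
    refine ⟨fun φ => ?_, fun φ η hg => ?_⟩
    · obtain ⟨h, hφ⟩ := h1 φ
      exact LinearPMap.mem_graph_iff _ |>.2 ⟨⟨R φ, h⟩, rfl, sub_eq_iff_eq_add.1 hφ⟩
    · obtain ⟨v, hv1, hv2⟩ := LinearPMap.mem_graph_iff _ |>.1 hg
      dsimp only at hv1 hv2
      rw [← hv1, ← hv2]
      exact h2 v
  · rintro ⟨h1, h2⟩
    refine ⟨fun φ => ?_, fun φ => h2 _ _ (A.mem_graph φ)⟩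
    obtain ⟨v, hv1, hv2⟩ := LinearPMap.mem_graph_iff _ |>.1 (h1 φ)
    dsimp only at hv1 hv2
    refine ⟨hv1 ▸ v.2, ?_⟩
    have : (⟨R φ, hv1 ▸ v.2⟩ : A.domain) = v := Subtype.ext hv1.symm
    rw [this, hv2]; simp

variable {Ω : Type*} [MeasurableSpace Ω] {𝔞 : Ambient} {d n : ℕ} [AddAction (Fin d → ℤ) Ω]

theorem RandomOperator.realSpectrum_vadd_subset (H : RandomOperator 𝔞 d n Ω) (y : Fin d → ℤ)
    (ω : Ω) : realSpectrum (H.op (y +ᵥ ω)) ⊆ realSpectrum (H.op ω) := by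
  rintro E hE ⟨R, hR⟩
  refine hE ⟨(H.transl y).toContinuousLinearEquiv.toContinuousLinearMap ∘L R ∘L
    (H.transl y).symm.toContinuousLinearEquiv.toContinuousLinearMap, ?_⟩
  rw [isResolventAt_iff_graph] at hR ⊢
  refine ⟨fun φ => ?_, fun φ η hg => ?_⟩
  · obtain ⟨u, rfl⟩ := (H.transl y).surjective φ
    have h1 := (H.covariance y ω _ _).1 (hR.1 u)
    rw [map_add, map_smul] at h1
    simpa using h1
  · obtain ⟨u, rfl⟩ := (H.transl y).surjective φ
    obtain ⟨v, rfl⟩ := (H.transl y).surjective η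
    have h1 := hR.2 _ _ ((H.covariance y ω _ _).2 hg)
    have h2 : (H.transl y).symm (H.transl y v - (E : ℂ) • H.transl y u) = v - (E : ℂ) • u := by
      rw [← map_smul, ← map_sub, LinearIsometryEquiv.symm_apply_apply]
    change H.transl y (R ((H.transl y).symm (H.transl y v - (E : ℂ) • H.transl y u))) = _
    rw [h2, h1]

/-- The spectrum is invariant under translations of the disorder. -/
theorem RandomOperator.realSpectrum_vadd (H : RandomOperator 𝔞 d n Ω) (y : Fin d → ℤ) (ω : Ω) :
    realSpectrum (H.op (y +ᵥ ω)) = realSpectrum (H.op ω) := by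
  refine (H.realSpectrum_vadd_subset y ω).antisymm ?_
  have := H.realSpectrum_vadd_subset (-y) (y +ᵥ ω)
  rwa [neg_vadd_vadd] at this

theorem RandomOperator.measurable_measure (H : RandomOperator 𝔞 d n Ω)
    (φ : HSpace (𝔞.measure d) n) {B : Set ℝ} (hB : MeasurableSet B) :
    Measurable fun ω => (H.spec ω).measure φ B := by
  have h := H.measurable_inner (B.indicator 1) (measurable_const.indicator hB)
    ⟨1, fun t => by by_cases ht : t ∈ B <;> simp [ht]⟩ φ
  have h2 : (fun ω => (H.spec ω).measure φ B) =
      fun ω => ENNReal.ofReal (∫ t, B.indicator 1 t ∂((H.spec ω).measure φ)) := by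
    ext ω
    rw [integral_indicator_one hB, ofReal_measureReal]
  rw [h2]
  exact h.ennreal_ofReal

theorem RandomOperator.measurableSet_proj_eq_zero (H : RandomOperator 𝔞 d n Ω) {B : Set ℝ}
    (hB : MeasurableSet B) : MeasurableSet {ω | (H.spec ω).proj B = 0} := by
  set u := TopologicalSpace.denseSeq (HSpace (𝔞.measure d) n)
  have h : {ω | (H.spec ω).proj B = 0} = ⋂ k, {ω | (H.spec ω).measure (u k) B = 0} := by
    ext ω
    rw [mem_iInter]
    constructor
    · intro h k
      have h' : (H.spec ω).proj B = 0 := h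
      change (H.spec ω).measure (u k) B = 0
      rw [← (H.spec ω).proj_eq_zero_iff_measure hB, h']; rfl
    · intro h
      change (H.spec ω).proj B = 0
      have h1 : ((H.spec ω).proj B : HSpace (𝔞.measure d) n → HSpace (𝔞.measure d) n) =
          fun _ => 0 := by
        refine Continuous.ext_on (TopologicalSpace.denseRange_denseSeq _)
          ((H.spec ω).proj B).continuous continuous_const ?_
        rintro _ ⟨k, rfl⟩
        exact ((H.spec ω).proj_eq_zero_iff_measure hB _).2 (h k)
      ext1 φ
      exact congrFun h1 φ
  rw [h]
  exact MeasurableSet.iInter fun k => H.measurable_measure (u k) hB (measurableSet_singleton 0)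

/-- The trace measure of a compact subinterval is almost surely bounded by a constant.  The lower
bound on `f` over the spectrum may be taken deterministic, because the event that no spectrum
lies where `f < δ` is invariant and hence has probability `0` or `1`. -/
theorem exists_traceMeasure_le [MeasurableConstVAdd (Fin d → ℤ) Ω] {ℙ : Measure Ω}
    [IsProbabilityMeasure ℙ] [ErgodicVAdd (Fin d → ℤ) Ω ℙ] {κ : ℝ} {𝓘 : Set ℝ} (h𝓘 : IsOpen 𝓘)
    {H : RandomOperator 𝔞 d n Ω} (htrace : TraceAssumption κ 𝓘 H ℙ) {E₁ E₂ : ℝ}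
    (hI : Icc E₁ E₂ ⊆ 𝓘) :
    ∃ M : ℝ≥0, ∀ᵐ ω ∂ℙ, traceMeasure κ (H.spec ω) (Icc E₁ E₂) ≤ M := by
  rcases lt_or_ge E₂ E₁ with hlt | hle
  · exact ⟨0, Eventually.of_forall fun ω => by rw [Icc_eq_empty (not_le.2 hlt)]; simp⟩
  obtain ⟨f, hfc, -, hf0, C, hC⟩ := htrace
  obtain ⟨ε₁, hε₁, hb₁⟩ := Metric.isOpen_iff.1 h𝓘 E₁ (hI (left_mem_Icc.2 hle))
  obtain ⟨ε₂, hε₂, hb₂⟩ := Metric.isOpen_iff.1 h𝓘 E₂ (hI (right_mem_Icc.2 hle))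
  rw [Real.ball_eq_Ioo] at hb₁ hb₂
  -- `Icc a b` is a neighborhood of `Icc E₁ E₂` in `𝓘`, so that the sets `V k` of its interior
  -- points with small `f` are open and the criterion for vanishing spectral projections applies.
  set a := E₁ - ε₁ / 2 with ha
  set b := E₂ + ε₂ / 2 with hb
  have hab : Icc a b ⊆ 𝓘 := by
    intro t ht
    rcases lt_or_ge t E₁ with h1 | h1
    · exact hb₁ ⟨by linarith [ht.1], by linarith⟩
    · rcases le_or_gt t E₂ with h2 | h2
      · exact hI ⟨h1, h2⟩
      · exact hb₂ ⟨by linarith, by linarith [ht.2]⟩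
  set V : ℕ → Set ℝ := fun k => Ioo a b ∩ f ⁻¹' Iio (1 / ((k : ℝ) + 1)) with hV
  have hVo : ∀ k, IsOpen (V k) := fun k => isOpen_Ioo.inter (isOpen_Iio.preimage hfc)
  set X : ℕ → Set Ω := fun k => {ω | (H.spec ω).proj (V k) = 0} with hX
  have hXiff : ∀ k ω, ω ∈ X k ↔ Disjoint (V k) (realSpectrum (H.op ω)) := fun k ω =>
    (H.isSpectralFamilyOf ω).proj_eq_zero_iff_disjoint (H.isSelfAdjoint ω) (hVo k)
  have hconst : ∀ k, (∀ᵐ ω ∂ℙ, ω ∈ X k) ∨ ∀ᵐ ω ∂ℙ, ω ∉ X k := by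
    intro k
    have h1 : EventuallyConst (X k) (ae ℙ) :=
      aeconst_of_forall_preimage_vadd_ae_eq (Fin d → ℤ)
        (H.measurableSet_proj_eq_zero (hVo k).measurableSet).nullMeasurableSet fun y => by
          have : (fun ω => y +ᵥ ω) ⁻¹' X k = X k := by
            ext ω
            rw [mem_preimage, hXiff, hXiff, H.realSpectrum_vadd]
          rw [this]
          exact EventuallyEq.rfl
    exact eventuallyConst_set.1 h1
  -- `f` is bounded below on the compact part of the spectrum in `Icc a b`.
  have hex : ∀ᵐ ω ∂ℙ, ∃ k, ω ∈ X k := by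
    filter_upwards [hC] with ω hω
    have hcomp : IsCompact (Icc a b ∩ realSpectrum (H.op ω)) :=
      isCompact_Icc.inter_right
        ((H.isSpectralFamilyOf ω).isClosed_realSpectrum (H.isSelfAdjoint ω))
    rcases (Icc a b ∩ realSpectrum (H.op ω)).eq_empty_or_nonempty with h0 | h0
    · refine ⟨0, (hXiff 0 ω).2 (Set.disjoint_left.2 fun t ht ht' => ?_)⟩
      have : t ∈ Icc a b ∩ realSpectrum (H.op ω) := ⟨Ioo_subset_Icc_self ht.1, ht'⟩
      rw [h0] at this
      exact this
    · obtain ⟨t₀, ht₀, hmin⟩ := hcomp.exists_isMinOn h0 hfc.continuousOn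
      have hpos : 0 < f t₀ := hω.1 t₀ ⟨hab ht₀.1, ht₀.2⟩
      obtain ⟨k, hk⟩ := exists_nat_one_div_lt hpos
      refine ⟨k, (hXiff k ω).2 (Set.disjoint_left.2 fun t ht ht' => ?_)⟩
      have h1 : f t₀ ≤ f t := hmin ⟨Ioo_subset_Icc_self ht.1, ht'⟩
      have h2 : f t < 1 / ((k : ℝ) + 1) := ht.2
      linarith
  obtain ⟨k, hk⟩ : ∃ k, ∀ᵐ ω ∂ℙ, ω ∈ X k := by
    by_contra h
    rw [not_exists] at h
    have h1 : ∀ᵐ ω ∂ℙ, ∀ k, ω ∉ X k := ae_all_iff.2 fun k =>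
      (hconst k).resolve_left (h k)
    obtain ⟨ω, ⟨k, h2⟩, h3⟩ := (hex.and h1).exists
    exact h3 k h2
  refine ⟨(k + 1) * C, ?_⟩
  filter_upwards [hC, hk] with ω hω hωk
  set μ := traceMeasure κ (H.spec ω) with hμ
  have hVnull : μ (V k) = 0 := by
    rw [hμ, traceMeasure, Measure.sum_apply _ (hVo k).measurableSet]
    refine ENNReal.tsum_eq_zero.2 fun i => ?_
    rw [← (H.spec ω).proj_eq_zero_iff_measure (hVo k).measurableSet]
    have : (H.spec ω).proj (V k) = 0 := hωk
    rw [this]; rfl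
  have hsub : Icc E₁ E₂ ⊆ V k ∪ (Icc E₁ E₂ ∩ f ⁻¹' Ici (1 / ((k : ℝ) + 1))) := by
    intro t ht
    rcases lt_or_ge (f t) (1 / ((k : ℝ) + 1)) with h | h
    · exact Or.inl ⟨⟨by linarith [ht.1], by linarith [ht.2]⟩, h⟩
    · exact Or.inr ⟨ht, h⟩
  have hmS : MeasurableSet (Icc E₁ E₂ ∩ f ⁻¹' Ici (1 / ((k : ℝ) + 1))) :=
    measurableSet_Icc.inter (hfc.measurable measurableSet_Ici)
  calc μ (Icc E₁ E₂) ≤ μ (V k) + μ (Icc E₁ E₂ ∩ f ⁻¹' Ici (1 / ((k : ℝ) + 1))) :=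
        (measure_mono hsub).trans (measure_union_le _ _)
    _ = ∫⁻ _ in Icc E₁ E₂ ∩ f ⁻¹' Ici (1 / ((k : ℝ) + 1)), 1 ∂μ := by
        rw [hVnull, zero_add, setLIntegral_one]
    _ ≤ ∫⁻ t in Icc E₁ E₂ ∩ f ⁻¹' Ici (1 / ((k : ℝ) + 1)),
          ENNReal.ofReal (k + 1) * ENNReal.ofReal (f t) ∂μ := by
        refine setLIntegral_mono' hmS fun t ht => ?_
        rw [← ENNReal.ofReal_mul (by positivity), ← ENNReal.ofReal_one]
        refine ENNReal.ofReal_le_ofReal ?_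
        have h1 : 1 / ((k : ℝ) + 1) ≤ f t := ht.2
        rw [div_le_iff₀ (by positivity)] at h1
        linarith
    _ ≤ ENNReal.ofReal (k + 1) * C := by
        rw [lintegral_const_mul' _ _ ENNReal.ofReal_ne_top]
        refine mul_le_mul_right ((setLIntegral_le_lintegral _ _).trans hω.2) _
    _ = (((k + 1) * C : ℝ≥0) : ℝ≥0∞) := by
        rw [ENNReal.coe_mul, ENNReal.ofReal_add (by positivity) zero_le_one]
        simp

end TraceBound

/-! ### Almost sure localization -/

section Localization

variable {Ω : Type*} [MeasurableSpace Ω] {𝔞 : Ambient} {d n : ℕ}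
  {b ϱ κ : ℝ} {𝓘 : Set ℝ} {ℙ : Measure Ω}

/-- The energies of the region of complete localization are covered by rational intervals, hence
by countably many of them. -/
theorem exists_rat_isLocInterval {F : FiniteVolume 𝔞 d n Ω} {E : ℝ}
    (hE : E ∈ regionCL b ϱ 𝓘 F ℙ) : ∃ q : ℚ × ℚ, E ∈ Ioo (q.1 : ℝ) q.2 ∧
      Icc (q.1 : ℝ) q.2 ⊆ 𝓘 ∧ IsLocInterval b ϱ F ℙ q.1 q.2 := by
  obtain ⟨E₁, E₂, hE, hI, h⟩ := hE
  obtain ⟨q₁, h1, h2⟩ := exists_rat_btwn hE.1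
  obtain ⟨q₂, h3, h4⟩ := exists_rat_btwn hE.2
  exact ⟨(q₁, q₂), ⟨h2, h3⟩, fun t ht => hI ⟨h1.trans_le ht.1, ht.2.trans_lt h4⟩,
    IsLocInterval.mono h (Ioo_subset_Ioo h1.le h4.le)⟩

theorem isOpen_regionCL {F : FiniteVolume 𝔞 d n Ω} : IsOpen (regionCL b ϱ 𝓘 F ℙ) := by
  rw [isOpen_iff_mem_nhds]
  rintro E ⟨E₁, E₂, hE, hI, h⟩
  exact mem_of_superset (isOpen_Ioo.mem_nhds hE) fun E' hE' => ⟨E₁, E₂, hE', hI, h⟩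

variable [AddAction (Fin d → ℤ) Ω] {H : RandomOperator 𝔞 d n Ω} {F : FiniteVolume 𝔞 d n Ω}

/-- Almost surely, all generalized eigenfunctions with generalized eigenvalue in a localization
interval decay faster than any sub-exponential. -/
theorem IsLocInterval.ae_eventually_locMass_le (hκ : 0 ≤ κ) (hϱ : 0 < ϱ) {q₁ q₂ : ℝ}
    (h : IsLocInterval b ϱ F ℙ q₁ q₂) (hEDI : EDIAssumption κ b 𝓘 H F ℙ)
    (hI : Icc q₁ q₂ ⊆ 𝓘) :
    ∀ᵐ ω ∂ℙ, ∀ E ∈ Ioo q₁ q₂, ∀ ψ, IsGenEigenfunction κ (H.op ω) E ψ → ∀ s : ℝ, 0 < s → s < 1 →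
      ∀ᶠ x : Fin d → ℤ in cofinite, locMass (𝔞.measure d) (box x 1) ψ ≤
        ENNReal.ofReal (Real.exp (-2 * eucl (pt x) ^ s)) := by
  -- For `ζ = s j`, any admissible `α` is less than `1 / s j`, so that the scales give decay with
  -- exponent `s j < 1 / α`.  Countably many exponents suffice, as `s j` tends to `1`.
  set s : ℕ → ℝ := fun j => 1 - 1 / ((j : ℝ) + 2) with hs
  have hs0 : ∀ j, 0 < s j := fun j => by
    have : 1 / ((j : ℝ) + 2) < 1 := by
      rw [div_lt_one (by positivity)]
      linarith [j.cast_nonneg (α := ℝ)]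
    simp only [hs]; linarith
  have hs1 : ∀ j, s j < 1 := fun j => by
    have : 0 < 1 / ((j : ℝ) + 2) := by positivity
    simp only [hs]; linarith
  have hsinv : ∀ j, 1 < (s j)⁻¹ := fun j => (one_lt_inv₀ (hs0 j)).2 (hs1 j)
  have hsc : ∀ j, ∃ m ℓ r₀ C, HasScales b F ℙ q₁ q₂ (s j) ((1 + (s j)⁻¹) / 2) m ℓ r₀ C := fun j =>
    h.exists_hasScales hϱ (hs0 j) (hs1 j) (by linarith [hsinv j]) (by linarith [hsinv j])
  choose m ℓ r₀ C hsc using hsc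
  obtain ⟨γ, hγ⟩ := hEDI q₁ q₂ hI
  have hbad := ae_all_iff.2 fun j =>
    (hsc j).ae_finite_bad (by linarith [hsinv j]) (hs0 j)
  filter_upwards [hγ, hbad] with ω hω hgood E hE ψ hψ t ht0 ht1
  obtain ⟨j, hj⟩ := exists_nat_one_div_lt (sub_pos.2 ht1)
  have htj : t ≤ s j := by
    have : 1 / ((j : ℝ) + 2) ≤ 1 / ((j : ℝ) + 1) :=
      one_div_le_one_div_of_le (by positivity) (by linarith)
    simp only [hs]; linarith
  have hlt : s j < ((1 + (s j)⁻¹) / 2)⁻¹ := by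
    rw [lt_inv_comm₀ (hs0 j) (by linarith [hsinv j])]
    linarith [hsinv j]
  filter_upwards [hψ.eventually_locMass_le hκ (hsc j) (by linarith [hsinv j]) (hgood j) hω hE
    (hs0 j).le hlt, eventually_cofinite_lt_norm 0 1] with x hx hx1
  refine hx.trans (ENNReal.ofReal_le_ofReal (Real.exp_le_exp.2 ?_))
  have h1 : 1 ≤ eucl (pt x) := by
    have h2 : pt (0 : Fin d → ℤ) = 0 := by ext i; simp [pt]
    rw [h2, zero_sub, norm_neg] at hx1
    exact hx1.le.trans (norm_le_eucl _)
  linarith [Real.rpow_le_rpow_of_exponent_le h1 htj]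

/-- Almost surely, all generalized eigenfunctions with generalized eigenvalue in the region of
complete localization decay faster than any sub-exponential. -/
theorem ae_regionCL_eventually_locMass_le (hκ : 0 ≤ κ) (hϱ : 0 < ϱ)
    (hEDI : EDIAssumption κ b 𝓘 H F ℙ) :
    ∀ᵐ ω ∂ℙ, ∀ E ∈ regionCL b ϱ 𝓘 F ℙ, ∀ ψ, IsGenEigenfunction κ (H.op ω) E ψ →
      ∀ s : ℝ, 0 < s → s < 1 → ∀ᶠ x : Fin d → ℤ in cofinite,
        locMass (𝔞.measure d) (box x 1) ψ ≤
          ENNReal.ofReal (Real.exp (-2 * eucl (pt x) ^ s)) := by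
  have h : ∀ᵐ ω ∂ℙ, ∀ q : ℚ × ℚ, Icc (q.1 : ℝ) q.2 ⊆ 𝓘 → IsLocInterval b ϱ F ℙ q.1 q.2 →
      ∀ E ∈ Ioo (q.1 : ℝ) q.2, ∀ ψ, IsGenEigenfunction κ (H.op ω) E ψ →
        ∀ s : ℝ, 0 < s → s < 1 → ∀ᶠ x : Fin d → ℤ in cofinite,
          locMass (𝔞.measure d) (box x 1) ψ ≤
            ENNReal.ofReal (Real.exp (-2 * eucl (pt x) ^ s)) := by
    rw [ae_all_iff]
    intro q
    rw [eventually_imp_distrib_left]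
    intro hq
    rw [eventually_imp_distrib_left]
    exact fun hl => hl.ae_eventually_locMass_le hκ hϱ hEDI hq
  filter_upwards [h] with ω hω E hE
  obtain ⟨q, h1, h2, h3⟩ := exists_rat_isLocInterval hE
  exact hω q h2 h3 E h1

theorem ae_hasPurePointSpectrumIn_regionCL [MeasurableConstVAdd (Fin d → ℤ) Ω]
    [IsProbabilityMeasure ℙ] [ErgodicVAdd (Fin d → ℤ) Ω ℙ] (hκ : 0 ≤ κ) (hϱ : 0 < ϱ)
    (h𝓘 : IsOpen 𝓘) (hcore : HasCoreAssumption κ H ℙ) (htrace : TraceAssumption κ 𝓘 H ℙ)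
    (hEDI : EDIAssumption κ b 𝓘 H F ℙ) :
    ∀ᵐ ω ∂ℙ, HasPurePointSpectrumIn (H.op ω) (H.spec ω) (regionCL b ϱ 𝓘 F ℙ) := by
  have htr : ∀ᵐ ω ∂ℙ, ∀ q : ℚ × ℚ, Icc (q.1 : ℝ) q.2 ⊆ 𝓘 →
      traceMeasure κ (H.spec ω) (Icc (q.1 : ℝ) q.2) < ∞ := by
    rw [ae_all_iff]
    intro q
    rw [eventually_imp_distrib_left]
    intro hq
    obtain ⟨M, hM⟩ := exists_traceMeasure_le h𝓘 htrace hq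
    filter_upwards [hM] with ω hω using hω.trans_lt ENNReal.coe_lt_top
  filter_upwards [hcore, htr, ae_regionCL_eventually_locMass_le hκ hϱ hEDI] with ω hc ht hloc
  have hA := H.isSelfAdjoint ω
  have hP := H.isSpectralFamilyOf ω
  have heig : ∀ E ∈ regionCL b ϱ 𝓘 F ℙ, ∀ ψ, IsGenEigenfunction κ (H.op ω) E ψ →
      ∃ φ ∈ eigenspace (H.op ω) E, φ ≠ 0 := by
    intro E hE ψ hψ
    have hm := hψ.memLp_two hκ one_half_pos (hloc E hE ψ hψ _ one_half_pos one_half_lt_one)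
    refine ⟨_, hψ.toLp_mem_eigenspace hA hc.1 hm, fun h0 => hψ.ne_zero ?_⟩
    exact hm.coeFn_toLp.symm.trans (Lp.eq_zero_iff_ae_eq_zero.1 h0)
  have hX : MeasurableSet (regionCL b ϱ 𝓘 F ℙ) := isOpen_regionCL.measurableSet
  set J : {q : ℚ × ℚ // Icc (q.1 : ℝ) q.2 ⊆ 𝓘} → Set ℝ := fun q =>
    Ico (q.1.1 : ℝ) q.1.2 ∩ regionCL b ϱ 𝓘 F ℙ with hJ
  have hS : ∀ q, ∃ S : Set ℝ, S.Countable ∧ (H.spec ω).proj (J q \ S) = 0 := fun q =>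
    exists_countable_proj_diff_eq_zero hκ hA hP
      ((measure_mono Ico_subset_Icc_self).trans_lt (ht q.1 q.2)) (measurableSet_Ico.inter hX)
      inter_subset_left fun E hE ψ hψ => heig E hE.2 ψ hψ
  choose S hS1 hS2 using hS
  refine hasPurePointSpectrumIn_of_countable hA hP hX (J := J)
    (fun q => measurableSet_Ico.inter hX) (fun E hE => ?_) hS1 hS2
  obtain ⟨q, h1, h2, -⟩ := exists_rat_isLocInterval hE
  exact mem_iUnion.2 ⟨⟨q, h2⟩, Ioo_subset_Ico_self h1, hE⟩

theorem ae_regionCL_exists_localNorm_le (hκ : 0 ≤ κ) (hϱ : 0 < ϱ)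
    (hEDI : EDIAssumption κ b 𝓘 H F ℙ) :
    ∀ᵐ ω ∂ℙ, ∀ E ∈ regionCL b ϱ 𝓘 F ℙ, ∀ φ ∈ eigenspace (H.op ω) E,
      ∀ ζ : ℝ, 0 < ζ → ζ < 1 → ∃ C : ℝ, ∀ x : Fin d → ℤ,
        localNorm (𝔞.measure d) (box x 1) φ ≤ C * Real.exp (-(eucl (pt x) ^ ζ)) := by
  filter_upwards [ae_regionCL_eventually_locMass_le hκ hϱ hEDI] with ω hloc E hE φ hφ ζ h0 h1
  rcases eq_or_ne φ 0 with rfl | hne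
  · refine exists_localNorm_le (Eventually.of_forall fun x => ?_)
    rw [locMass_congr (Lp.coeFn_zero _ _ _), locMass]
    simp
  · exact exists_localNorm_le (hloc E hE φ
      (isGenEigenfunction_of_mem_eigenspace hκ (H.isSelfAdjoint ω) hφ hne) ζ h0 h1)

end Localization

/-! ### The expectation of the eigenvalue masses -/

section Expectation

variable {Ω : Type*} [MeasurableSpace Ω] {𝔞 : Ambient} {d n : ℕ}

theorem locMass_box_le_sum (𝔞 : Ambient) (x : Fin d → ℤ) {N : ℕ} (hN : 1 ≤ N)
    (ψ : (Fin d → ℝ) → EuclideanSpace ℂ (Fin n)) :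
    locMass (𝔞.measure d) (box x N) ψ ≤
      ∑ z ∈ nearSites x N, locMass (𝔞.measure d) (box z 1) ψ := by
  unfold locMass
  rw [← lintegral_biUnion_finset (fun i _ j _ hij => pairwise_disjoint_box hij)
    fun z _ => measurableSet_box z 1]
  refine lintegral_mono_set' ?_
  have hN' : (1 : ℝ) ≤ N := by exact_mod_cast hN
  filter_upwards [ae_exists_mem_box 𝔞 d] with w hw hwx
  obtain ⟨z, hz⟩ := hw
  refine mem_iUnion₂.2 ⟨z, mem_nearSites ?_, hz⟩
  have h1 : w ∈ box x N := hwx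
  rw [mem_box] at h1 hz
  have h2 : ‖pt x - pt z‖ ≤ ‖w - pt x‖ + ‖w - pt z‖ := by
    rw [← norm_neg (w - pt x), neg_sub, ← sub_add_sub_cancel (pt x) w (pt z)]
    exact norm_add_le _ _
  linarith

variable {b ϱ κ γ : ℝ} {𝓘 : Set ℝ} {ℙ : Measure Ω} [AddAction (Fin d → ℤ) Ω]
  {H : RandomOperator 𝔞 d n Ω} {F : FiniteVolume 𝔞 d n Ω}

/-- The local trace of an eigenprojection is bounded at the origin by the trace measure, and by
covariance at every site. -/
theorem ae_blockMass_le [MeasurableConstVAdd (Fin d → ℤ) Ω]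
    [IsProbabilityMeasure ℙ] [ErgodicVAdd (Fin d → ℤ) Ω ℙ] (hκ : 0 ≤ κ)
    (h𝓘 : IsOpen 𝓘) (htrace : TraceAssumption κ 𝓘 H ℙ) {E₁ E₂ : ℝ} (hI : Icc E₁ E₂ ⊆ 𝓘) :
    ∃ A : ℝ≥0, ∀ᵐ ω ∂ℙ, ∀ x : Fin d → ℤ, ∀ E ∈ Icc E₁ E₂,
      blockMass (box x 1) ((H.spec ω).proj {E}) ≤ A := by
  obtain ⟨M, hM⟩ := exists_traceMeasure_le h𝓘 htrace hI
  refine ⟨Real.toNNReal (((d + 1) * 2) ^ (2 * κ)) * M, ae_all_iff.2 fun x => ?_⟩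
  have h1 := (measurePreserving_vadd (-x) ℙ).quasiMeasurePreserving.ae hM
  filter_upwards [h1] with ω hω E hE
  have h2 := H.blockMass_vadd 0 (-x) ω E
  rw [zero_sub, neg_neg] at h2
  rw [← h2, ENNReal.coe_mul]
  exact (blockMass_zero_le hκ _ E).trans
    (mul_le_mul_right ((measure_mono (singleton_subset_iff.2 hE)).trans hω) _)

/-- At a regular cube the local trace of the eigenprojection is exponentially small. -/
theorem IsRegular.blockMass_le {m E E₁ E₂ : ℝ} {x : Fin d → ℤ} {L : ℕ} {ω : Ω}
    (hreg : IsRegular b F ω m E x L) (hL : 6 ≤ L) (hLe : Even L) (hκ : 0 ≤ κ)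
    (hEDI : HasEDI κ b γ E₁ E₂ H F ω) (hE : E ∈ Icc E₁ E₂) {A : ℝ≥0∞}
    (hA : ∀ x, blockMass (box x 1) ((H.spec ω).proj {E}) ≤ A) :
    blockMass (box x 1) ((H.spec ω).proj {E}) ≤
      ENNReal.ofReal (γ ^ 2 * Real.exp (-(m * L)) * (2 * L + 1) ^ d) * A := by
  set c := ENNReal.ofReal (γ ^ 2 * Real.exp (-(m * L))) with hc
  have h1 : ∀ φ : HSpace (𝔞.measure d) n,
      locMass (𝔞.measure d) (box x 1) ((H.spec ω).proj {E} φ) ≤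
        c * ∑ z ∈ nearSites x L, locMass (𝔞.measure d) (box z 1) ((H.spec ω).proj {E} φ) := by
    intro φ
    rcases eq_or_ne ((H.spec ω).proj {E} φ) 0 with h0 | h0
    · rw [h0, locMass_congr (Lp.coeFn_zero _ _ _), locMass]
      simp
    · have heig : (H.spec ω).proj {E} φ ∈ eigenspace (H.op ω) E :=
        ((H.isSpectralFamilyOf ω).mem_eigenspace_iff (H.isSelfAdjoint ω)).2
          (by
            rw [(H.spec ω).proj_proj (measurableSet_singleton E) (measurableSet_singleton E),
              inter_self])
      refine (hreg.locMass_le hL hLe hκ hEDI hE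
        (isGenEigenfunction_of_mem_eigenspace hκ (H.isSelfAdjoint ω) heig h0)).trans
        (mul_le_mul_right ((locMass_mono (belt_subset_box b x L) _).trans
          (locMass_box_le_sum 𝔞 x (by omega) _)) _)
  calc blockMass (box x 1) ((H.spec ω).proj {E})
      ≤ ∑' i, c * ∑ z ∈ nearSites x L, locMass (𝔞.measure d) (box z 1)
          ((H.spec ω).proj {E} (stdBasis (HSpace (𝔞.measure d) n) i)) :=
        ENNReal.tsum_le_tsum fun i => h1 _
    _ = c * ∑ z ∈ nearSites x L, blockMass (box z 1) ((H.spec ω).proj {E}) := by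
        rw [ENNReal.tsum_mul_left, Summable.tsum_finsetSum fun _ _ => ENNReal.summable]
        rfl
    _ ≤ c * ∑ z ∈ nearSites x L, A :=
        mul_le_mul_right (Finset.sum_le_sum fun z _ => hA z) _
    _ = _ := by
        rw [Finset.sum_const, card_nearSites, nsmul_eq_mul, ← mul_assoc, hc,
          ENNReal.ofReal_mul (q := (2 * (L : ℝ) + 1) ^ d) (by positivity),
          ← ENNReal.ofReal_natCast]
        push_cast
        rfl

/-- The local traces at two sites are not both large unless both cubes are singular, an event
whose probability is summable in the distance. -/
theorem IsLocInterval.exists_blockMass_mul_le [MeasurableConstVAdd (Fin d → ℤ) Ω]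
    [IsProbabilityMeasure ℙ] [ErgodicVAdd (Fin d → ℤ) Ω ℙ] (hκ : 0 ≤ κ) (hϱ : 0 < ϱ)
    (h𝓘 : IsOpen 𝓘) (htrace : TraceAssumption κ 𝓘 H ℙ) (hEDI : EDIAssumption κ b 𝓘 H F ℙ)
    {q₁ q₂ : ℝ} (hI : Icc q₁ q₂ ⊆ 𝓘) (h : IsLocInterval b ϱ F ℙ q₁ q₂) :
    ∃ (A K : ℝ≥0) (B : (Fin d → ℤ) → (Fin d → ℤ) → Set Ω),
      (∀ x y, MeasurableSet (B x y)) ∧ (∀ x y, ℙ (B x y) ≤ K * wt (d + 1) (x - y)) ∧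
      ∀ᵐ ω ∂ℙ, ∀ E ∈ Ioo q₁ q₂, ∀ x y,
        blockMass (box x 1) ((H.spec ω).proj {E}) * blockMass (box y 1) ((H.spec ω).proj {E}) ≤
          A ^ 2 * (wt (d + 1) (x - y) + (B x y).indicator 1 ω) := by
  obtain ⟨A, hA⟩ := ae_blockMass_le hκ h𝓘 htrace hI
  obtain ⟨γ, hγ⟩ := hEDI q₁ q₂ hI
  -- Any admissible pair of exponents will do here.
  obtain ⟨m, ℓ, r₀, C, hsc⟩ := h.exists_hasScales hϱ (ζ := 1 / 2) (α := 3 / 2) (by norm_num)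
    (by norm_num) (by norm_num) (by norm_num)
  obtain ⟨r₁, hr₁, hprob⟩ := hsc.exists_prob_le (by norm_num) (by norm_num) (p := d + 1)
    (by positivity)
  obtain ⟨r₂, hr₂, hexp⟩ := hsc.exp_le (by norm_num) (γ ^ 2 * 3 ^ d * 2 ^ (d + 1))
    (d + (d + 1) : ℕ) 0 m (s := 0) one_pos hsc.m_pos (by norm_num)
  set R := max r₁ r₂ with hR
  -- The event of two singular cubes need not be measurable.  For close sites `B x y` is everything.
  set B : (Fin d → ℤ) → (Fin d → ℤ) → Set Ω := fun x y =>
    {ω | R < ‖pt x - pt y‖ →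
      ω ∈ toMeasurable ℙ (goodEvent b F m (ℓ ‖pt x - pt y‖) (Ioo q₁ q₂) x y)ᶜ} with hB
  have hwt : ∀ x y : Fin d → ℤ, wt (d + 1) (x - y) =
      ENNReal.ofReal ((1 + ‖pt x - pt y‖) ^ (-((d : ℝ) + 1))) := fun x y => by rw [wt, pt_sub]
  refine ⟨A, max 1 (Real.toNNReal ((1 + R) ^ ((d : ℝ) + 1))), B, fun x y => ?_, fun x y => ?_, ?_⟩
  · by_cases hxy : R < ‖pt x - pt y‖
    · simp only [hB, hxy, true_imp_iff]
      exact measurableSet_toMeasurable _ _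
    · simp [hB, hxy]
  · rw [hwt]
    by_cases hxy : R < ‖pt x - pt y‖
    · have h1 : B x y = toMeasurable ℙ (goodEvent b F m (ℓ ‖pt x - pt y‖) (Ioo q₁ q₂) x y)ᶜ := by
        ext ω; simp [hB, hxy]
      have hxy1 : r₁ < ‖pt x - pt y‖ := (le_max_left _ _).trans_lt hxy
      rw [h1, measure_toMeasurable]
      refine ((hsc.prob x y (hr₁.trans_lt hxy1)).trans
        (ENNReal.ofReal_le_ofReal (hprob _ hxy1))).trans ?_
      refine le_mul_of_one_le_left' ?_
      exact_mod_cast le_max_left _ _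
    · have hR0 : 0 ≤ R := (norm_nonneg _).trans (not_lt.1 hxy)
      have h1 : (1 : ℝ) ≤ (1 + R) ^ ((d : ℝ) + 1) * (1 + ‖pt x - pt y‖) ^ (-((d : ℝ) + 1)) := by
        rw [Real.rpow_neg (by positivity), ← div_eq_mul_inv, one_le_div (by positivity)]
        exact Real.rpow_le_rpow (by positivity) (by linarith [not_lt.1 hxy]) (by positivity)
      calc ℙ (B x y) ≤ 1 := prob_le_one
        _ ≤ ENNReal.ofReal ((1 + R) ^ ((d : ℝ) + 1) * (1 + ‖pt x - pt y‖) ^ (-((d : ℝ) + 1))) := by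
            rw [← ENNReal.ofReal_one]; exact ENNReal.ofReal_le_ofReal h1
        _ ≤ _ := by
            rw [ENNReal.ofReal_mul (by positivity)]
            refine mul_le_mul_left ?_ _
            exact ENNReal.coe_le_coe.2 (le_max_right _ _)
  · filter_upwards [hA, hγ] with ω hAω hω E hE x y
    have hEI := Ioo_subset_Icc_self hE
    set a : (Fin d → ℤ) → ℝ≥0∞ := fun x => blockMass (box x 1) ((H.spec ω).proj {E}) with ha
    have haA : ∀ x, a x ≤ A := fun x => hAω x E hEI
    change a x * a y ≤ _
    by_cases hBxy : ω ∈ B x y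
    · rw [indicator_of_mem hBxy, pow_two]
      calc a x * a y ≤ A * A := mul_le_mul' (haA x) (haA y)
        _ ≤ _ := le_mul_of_one_le_right' le_add_self
    · rw [indicator_of_notMem hBxy, add_zero]
      have hBxy' : ¬ (R < ‖pt x - pt y‖ →
        ω ∈ toMeasurable ℙ (goodEvent b F m (ℓ ‖pt x - pt y‖) (Ioo q₁ q₂) x y)ᶜ) := hBxy
      rw [Classical.not_imp] at hBxy'
      obtain ⟨hxy, hgood⟩ := hBxy'
      have hgood' : ω ∈ goodEvent b F m (ℓ ‖pt x - pt y‖) (Ioo q₁ q₂) x y := by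
        by_contra hc
        exact hgood (subset_toMeasurable _ _ hc)
      set r := ‖pt x - pt y‖ with hr
      have hxy1 : r₁ < r := (le_max_left _ _).trans_lt hxy
      have hxy2 : r₂ < r := (le_max_right _ _).trans_lt hxy
      have hxy0 : r₀ < r := hr₁.trans_lt hxy1
      have h6 := hsc.six_le r hxy0
      have h6' : (6 : ℝ) ≤ ℓ r := by exact_mod_cast h6
      have hle := hsc.le r hxy0
      have hsmall : ENNReal.ofReal (γ ^ 2 * Real.exp (-(m * ℓ r)) * (2 * ℓ r + 1) ^ d) ≤
          wt (d + 1) (x - y) := by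
        rw [hwt]
        refine ENNReal.ofReal_le_ofReal ?_
        have h1 := hexp r hxy2
        rw [Real.rpow_natCast, Real.rpow_one, zero_mul, zero_sub] at h1
        have h2 : (2 * (ℓ r : ℝ) + 1) ^ d ≤ (3 * r) ^ d :=
          pow_le_pow_left₀ (by positivity) (by linarith) d
        have h3 : (1 + r) ^ (d + 1) ≤ (2 * r) ^ (d + 1) :=
          pow_le_pow_left₀ (by linarith) (by linarith) _
        have h4 : (1 + r) ^ ((d : ℝ) + 1) = (1 + r) ^ (d + 1) := by
          rw [← Real.rpow_natCast]; push_cast; rfl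
        have hr1 : 0 < 1 + r := by linarith
        rw [Real.rpow_neg hr1.le, h4, ← one_div, le_div_iff₀ (by positivity)]
        calc γ ^ 2 * Real.exp (-(m * ℓ r)) * (2 * ℓ r + 1) ^ d * (1 + r) ^ (d + 1)
            ≤ γ ^ 2 * Real.exp (-(m * ℓ r)) * (3 * r) ^ d * (2 * r) ^ (d + 1) := by
              gcongr
          _ = γ ^ 2 * 3 ^ d * 2 ^ (d + 1) * r ^ (d + (d + 1)) * Real.exp (-(m * ℓ r)) := by
              rw [mul_pow, mul_pow, pow_add]; ring
          _ ≤ 1 := h1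
      have hfin : ∀ u v, IsRegular b F ω m E u (ℓ r) → a u * a v ≤ A ^ 2 * wt (d + 1) (x - y) := by
        intro u v hu
        have h1 := hu.blockMass_le h6 (hsc.even r hxy0) hκ hω hEI haA
        calc a u * a v ≤ (wt (d + 1) (x - y) * A) * A :=
              mul_le_mul' (h1.trans (mul_le_mul_left hsmall _)) (haA v)
          _ = _ := by ring
      rcases hgood' E hE with hreg | hreg
      · exact hfin x y hreg
      · rw [mul_comm (a x)]; exact hfin y x hreg

/-- The product of the mass of an eigenvalue and its multiplicity is bounded by an integrable
random variable, uniformly in the eigenvalue. -/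
theorem IsLocInterval.exists_traceMeasure_mul_posTrace_le [MeasurableConstVAdd (Fin d → ℤ) Ω]
    [IsProbabilityMeasure ℙ] [ErgodicVAdd (Fin d → ℤ) Ω ℙ] (hκ : (d : ℝ) / 2 < κ) (hϱ : 0 < ϱ)
    (h𝓘 : IsOpen 𝓘) (htrace : TraceAssumption κ 𝓘 H ℙ) (hEDI : EDIAssumption κ b 𝓘 H F ℙ)
    {q₁ q₂ : ℝ} (hI : Icc q₁ q₂ ⊆ 𝓘) (h : IsLocInterval b ϱ F ℙ q₁ q₂) :
    ∃ G : Ω → ℝ≥0∞, Measurable G ∧ ∫⁻ ω, G ω ∂ℙ < ∞ ∧ ∀ᵐ ω ∂ℙ, ∀ E ∈ Ioo q₁ q₂,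
      traceMeasure κ (H.spec ω) {E} * posTrace ((H.spec ω).proj {E}) ≤ G ω := by
  have hκ0 : 0 ≤ κ := (by positivity : (0 : ℝ) ≤ (d : ℝ) / 2).trans hκ.le
  obtain ⟨A, K, B, hBm, hBp, hAB⟩ := h.exists_blockMass_mul_le hκ0 hϱ h𝓘 htrace hEDI hI
  set c := ENNReal.ofReal (4 ^ (2 * κ)) with hc
  -- Both `wt (2 * κ)` and `wt (d + 1)` are summable over the lattice, as `2 * κ > d`.
  have hmeas' : ∀ x y, Measurable fun ω => wt (d + 1) (x - y) + (B x y).indicator 1 ω :=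
    fun x y => (measurable_one.indicator (hBm x y)).const_add _
  have hmeas : ∀ x y, Measurable fun ω =>
      wt (2 * κ) y * (A ^ 2 * (wt (d + 1) (x - y) + (B x y).indicator 1 ω)) := fun x y =>
    ((hmeas' x y).const_mul _).const_mul _
  refine ⟨fun ω => c * ∑' y, ∑' x,
    wt (2 * κ) y * (A ^ 2 * (wt (d + 1) (x - y) + (B x y).indicator 1 ω)),
    (Measurable.tsum fun y => Measurable.tsum fun x => hmeas x y).const_mul _,
    ?_, ?_⟩
  · rw [lintegral_const_mul _ (Measurable.tsum fun y =>
      Measurable.tsum fun x => hmeas x y),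
      lintegral_tsum fun y => (Measurable.tsum fun x => hmeas x y).aemeasurable]
    simp_rw [lintegral_tsum fun x => (hmeas x _).aemeasurable]
    have h1 : ∀ x y, ∫⁻ ω, wt (2 * κ) y *
        (A ^ 2 * (wt (d + 1) (x - y) + (B x y).indicator 1 ω)) ∂ℙ ≤
          wt (2 * κ) y * (A ^ 2 * ((1 + K) * wt (d + 1) (x - y))) := by
      intro x y
      rw [lintegral_const_mul _ ((hmeas' x y).const_mul _), lintegral_const_mul _ (hmeas' x y),
        lintegral_add_left measurable_const, lintegral_indicator_one (hBm x y), lintegral_const,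
        measure_univ, mul_one]
      refine mul_le_mul_right (mul_le_mul_right ?_ _) _
      rw [add_mul, one_mul]
      exact add_le_add_right (hBp x y) _
    refine ENNReal.mul_lt_top ENNReal.ofReal_lt_top ?_
    refine (ENNReal.tsum_le_tsum fun y => ENNReal.tsum_le_tsum fun x => h1 x y).trans_lt ?_
    simp_rw [ENNReal.tsum_mul_left, tsum_wt_sub]
    rw [ENNReal.tsum_mul_right]
    refine ENNReal.mul_lt_top (tsum_wt_lt_top (by linarith)) (ENNReal.mul_lt_top ?_
      (ENNReal.mul_lt_top ?_ (tsum_wt_lt_top (by linarith))))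
    · exact ENNReal.pow_lt_top ENNReal.coe_lt_top
    · exact ENNReal.add_lt_top.2 ⟨ENNReal.one_lt_top, ENNReal.coe_lt_top⟩
  · filter_upwards [hAB] with ω hω E hE
    rw [posTrace_proj _ (measurableSet_singleton E), hsSq_eq_tsum_blockMass]
    refine (mul_le_mul_left (traceMeasure_singleton_le 𝔞 hκ0 _ E) _).trans ?_
    rw [mul_assoc, ← ENNReal.tsum_mul_right]
    refine mul_le_mul_right (ENNReal.tsum_le_tsum fun y => ?_) _
    rw [← ENNReal.tsum_mul_left]
    refine ENNReal.tsum_le_tsum fun x => ?_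
    rw [mul_assoc, mul_comm (blockMass (box y 1) _)]
    exact mul_le_mul_right (hω E hE x y) _

end Expectation

/-! ### Measurability of the essential supremum -/

section Measurability

/-- The supremum over all points of a product of masses of points is approximated by small balls
with rational centers.  A sequence of balls with products above `c` accumulates, by compactness,
at a point where the product of masses is at least `c`. -/
theorem iSup_singleton_mul_eq (ρ₁ ρ₂ : Measure ℝ) [IsFiniteMeasure ρ₁] [IsFiniteMeasure ρ₂]
    {a b : ℝ} (h : ρ₁ (Icc a b)ᶜ = 0) :
    ⨆ t, ρ₁ {t} * ρ₂ {t} = ⨅ k : ℕ, ⨆ q : ℚ, ρ₁ (Metric.closedBall (q : ℝ) (1 / ((k : ℝ) + 1))) *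
      ρ₂ (Metric.closedBall (q : ℝ) (1 / ((k : ℝ) + 1))) := by
  refine le_antisymm (iSup_le fun t => le_iInf fun k => ?_) (le_of_forall_lt fun c hc => ?_)
  · have hk : 0 < 1 / ((k : ℝ) + 1) := by positivity
    obtain ⟨q, h1, h2⟩ := exists_rat_btwn (show t < t + 1 / ((k : ℝ) + 1) by linarith)
    have hsub : ({t} : Set ℝ) ⊆ Metric.closedBall (q : ℝ) (1 / ((k : ℝ) + 1)) := by
      rw [singleton_subset_iff, Metric.mem_closedBall, Real.dist_eq, abs_le]
      constructor <;> linarith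
    exact le_iSup_of_le q (mul_le_mul' (measure_mono hsub) (measure_mono hsub))
  · obtain ⟨c', hcc', hc'⟩ := exists_between hc
    refine hcc'.trans_le ?_
    have hq : ∀ k : ℕ, ∃ q : ℚ, c' < ρ₁ (Metric.closedBall (q : ℝ) (1 / ((k : ℝ) + 1))) *
        ρ₂ (Metric.closedBall (q : ℝ) (1 / ((k : ℝ) + 1))) := fun k =>
      lt_iSup_iff.1 (hc'.trans_le (iInf_le _ k))
    choose q hq using hq
    have hbd : ∀ k, (q k : ℝ) ∈ Icc (a - 1) (b + 1) := by
      intro k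
      by_contra hk
      have hr : 1 / ((k : ℝ) + 1) ≤ 1 := by
        rw [div_le_one (by positivity)]; linarith [k.cast_nonneg (α := ℝ)]
      have hsub : Metric.closedBall (q k : ℝ) (1 / ((k : ℝ) + 1)) ⊆ (Icc a b)ᶜ := by
        intro t ht ht'
        rw [Metric.mem_closedBall, Real.dist_eq, abs_le] at ht
        exact hk ⟨by linarith [ht'.1], by linarith [ht'.2]⟩
      have h1 := hq k
      rw [measure_mono_null hsub h, zero_mul] at h1
      exact not_lt_zero h1
    obtain ⟨t, -, φ, hφ, hlim⟩ := isCompact_Icc.tendsto_subseq hbd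
    refine le_iSup_of_le t ?_
    have hr : Tendsto (fun j => 1 / ((φ j : ℝ) + 1)) atTop (𝓝 0) :=
      tendsto_one_div_add_atTop_nhds_zero_nat.comp hφ.tendsto_atTop
    have hball : ∀ ε : ℝ, 0 < ε →
        c' ≤ ρ₁ (Metric.cthickening ε {t}) * ρ₂ (Metric.cthickening ε {t}) := by
      intro ε hε
      obtain ⟨j, hj1, hj2⟩ := ((hlim.eventually (Metric.ball_mem_nhds t (half_pos hε))).and
        (hr.eventually_lt_const (half_pos hε))).exists
      have hsub : Metric.closedBall (q (φ j) : ℝ) (1 / ((φ j : ℝ) + 1)) ⊆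
          Metric.cthickening ε {t} := by
        rw [Metric.cthickening_singleton _ hε.le]
        refine Metric.closedBall_subset_closedBall' ?_
        have : dist (q (φ j) : ℝ) t < ε / 2 := hj1
        linarith
      exact (hq _).le.trans (mul_le_mul' (measure_mono hsub) (measure_mono hsub))
    have htend : ∀ (ρ : Measure ℝ) [IsFiniteMeasure ρ],
        Tendsto (fun ε => ρ (Metric.cthickening ε {t})) (𝓝[>] 0) (𝓝 (ρ {t})) := fun ρ _ =>
      (tendsto_measure_cthickening_of_isClosed ⟨1, one_pos, measure_ne_top _ _⟩
        isClosed_singleton).mono_left nhdsWithin_le_nhds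
    refine ge_of_tendsto (ENNReal.Tendsto.mul (htend ρ₁) (Or.inr (measure_ne_top _ _)) (htend ρ₂)
      (Or.inr (measure_ne_top _ _))) ?_
    filter_upwards [self_mem_nhdsWithin] with ε hε using hball ε hε

/-- Distinct elements of an orthonormal family have distance `√2`. -/
theorem countable_basisIndex (𝓗 : Type*) [NormedAddCommGroup 𝓗] [InnerProductSpace ℂ 𝓗]
    [CompleteSpace 𝓗] [SecondCountableTopology 𝓗] : Countable (basisIndex 𝓗) := by
  set e := stdBasis 𝓗
  have hdist : ∀ i j, i ≠ j → 1 ≤ dist (e i) (e j) := by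
    intro i j hij
    have h1 : ‖e i - e j‖ ^ 2 = 2 := by
      rw [@norm_sub_sq ℂ, e.orthonormal.1 i, e.orthonormal.1 j, e.orthonormal.2 hij]
      norm_num
    rw [dist_eq_norm]
    nlinarith [norm_nonneg (e i - e j)]
  have : DiscreteTopology (range e) := by
    refine DiscreteTopology.of_forall_le_dist one_pos ?_
    rintro ⟨_, i, rfl⟩ ⟨_, j, rfl⟩ hij
    exact hdist i j fun h => hij (by rw [h])
  have h2 : Countable (range e) := TopologicalSpace.separableSpace_iff_countable.1 inferInstance
  have hinj : Function.Injective e := fun i j hij => by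
    by_contra h
    have h3 := hdist i j h
    rw [hij, dist_self] at h3
    linarith
  exact (Set.rangeFactorization_injective.2 hinj).countable

variable {Ω : Type*} [MeasurableSpace Ω] {𝔞 : Ambient} {d n : ℕ}

/-- Only the atoms contribute to the essential supremum, and they are not null sets. -/
theorem essSup_restrict_eq_iSup (μ : Measure ℝ) (f : ℝ → ℝ≥0∞) {I : Set ℝ}
    (hI : MeasurableSet I) :
    essSup (fun t => μ {t} * f t) (μ.restrict I) = ⨆ t, μ.restrict I {t} * f t := by
  refine le_antisymm (essSup_le_of_ae_le _ ?_) (iSup_le fun t => ?_)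
  · refine ae_restrict_of_forall_mem hI fun t ht => ?_
    refine le_trans (le_of_eq ?_) (le_iSup (fun t => μ.restrict I {t} * f t) t)
    rw [Measure.restrict_apply (measurableSet_singleton t),
      inter_eq_left.2 (singleton_subset_iff.2 ht)]
  · rcases eq_or_ne (μ.restrict I {t}) 0 with h0 | h0
    · rw [h0, zero_mul]; exact zero_le
    · have h1 : ¬ μ {t} * f t > essSup (fun t => μ {t} * f t) (μ.restrict I) := fun hgt =>
        h0 (measure_mono_null (singleton_subset_iff.2 (not_le.2 hgt))
          (ENNReal.ae_le_essSup (μ := μ.restrict I) fun t => μ {t} * f t))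
      exact (mul_le_mul_left (Measure.restrict_apply_le _ _) _).trans (not_lt.1 h1)

variable [AddAction (Fin d → ℤ) Ω] (H : RandomOperator 𝔞 d n Ω)

theorem RandomOperator.measurable_traceMeasure (κ : ℝ) {B : Set ℝ} (hB : MeasurableSet B) :
    Measurable fun ω => traceMeasure κ (H.spec ω) B := by
  have := countable_basisIndex (HSpace (𝔞.measure d) n)
  simp_rw [traceMeasure, Measure.sum_apply _ hB]
  exact Measurable.tsum fun i => H.measurable_measure _ hB

/-- The essential supremum is a countable supremum, over finite parts of the trace, of infima over
radii of suprema over balls with rational centers. -/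
theorem RandomOperator.aemeasurable_essSup {ℙ : Measure Ω} {κ E₁ E₂ : ℝ}
    (h : ∀ᵐ ω ∂ℙ, traceMeasure κ (H.spec ω) (Icc E₁ E₂) < ∞) :
    AEMeasurable (fun ω => essSup
        (fun t => traceMeasure κ (H.spec ω) {t} * posTrace ((H.spec ω).proj {t}))
        ((traceMeasure κ (H.spec ω)).restrict (Ioo E₁ E₂))) ℙ := by
  have := countable_basisIndex (HSpace (𝔞.measure d) n)
  set e := stdBasis (HSpace (𝔞.measure d) n)
  have hsum : ∀ ω t, posTrace ((H.spec ω).proj {t}) =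
      ⨆ s : Finset (basisIndex (HSpace (𝔞.measure d) n)),
        (∑ i ∈ s, (H.spec ω).measure (e i)) {t} := by
    intro ω t
    rw [posTrace, ENNReal.tsum_eq_iSup_sum]
    refine iSup_congr fun s => ?_
    rw [Measure.finsetSum_apply]
    refine Finset.sum_congr rfl fun i _ => ?_
    rw [(H.spec ω).measure_apply _ (measurableSet_singleton t),
      (H.spec ω).inner_proj_self (measurableSet_singleton t)]
  have hball : ∀ (q : ℚ) (k : ℕ), MeasurableSet (Metric.closedBall (q : ℝ) (1 / ((k : ℝ) + 1))) :=
    fun q k => Metric.isClosed_closedBall.measurableSet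
  refine ⟨fun ω => ⨆ s : Finset (basisIndex (HSpace (𝔞.measure d) n)), ⨅ k : ℕ, ⨆ q : ℚ,
    (traceMeasure κ (H.spec ω)).restrict (Ioo E₁ E₂)
        (Metric.closedBall (q : ℝ) (1 / ((k : ℝ) + 1))) *
      (∑ i ∈ s, (H.spec ω).measure (e i)) (Metric.closedBall (q : ℝ) (1 / ((k : ℝ) + 1))), ?_, ?_⟩
  · refine Measurable.iSup fun s => Measurable.iInf fun k => Measurable.iSup fun q =>
      Measurable.mul ?_ ?_
    · simp_rw [Measure.restrict_apply (hball q k)]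
      exact H.measurable_traceMeasure κ ((hball q k).inter measurableSet_Ioo)
    · simp_rw [Measure.finsetSum_apply]
      exact Finset.measurable_fun_sum _ fun i _ => H.measurable_measure _ (hball q k)
  · filter_upwards [h] with ω hω
    set ρ := (traceMeasure κ (H.spec ω)).restrict (Ioo E₁ E₂) with hρ
    have hfin : IsFiniteMeasure ρ := ⟨by
      rw [hρ, Measure.restrict_apply_univ]
      exact (measure_mono Ioo_subset_Icc_self).trans_lt hω⟩
    have hnull : ρ (Icc E₁ E₂)ᶜ = 0 := by
      have h0 : (Icc E₁ E₂)ᶜ ∩ Ioo E₁ E₂ = ∅ :=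
        (disjoint_compl_left.mono_right Ioo_subset_Icc_self).inter_eq
      rw [hρ, Measure.restrict_apply measurableSet_Icc.compl, h0, measure_empty]
    rw [essSup_restrict_eq_iSup _ _ measurableSet_Ioo]
    simp_rw [hsum, ENNReal.mul_iSup]
    rw [iSup_comm]
    refine iSup_congr fun s => ?_
    have hfs : IsFiniteMeasure (∑ i ∈ s, (H.spec ω).measure (e i)) := ⟨by
      rw [Measure.finsetSum_apply]
      refine ENNReal.sum_lt_top.2 fun i _ => ?_
      have := (H.spec ω).isFiniteMeasure_measure (e i)
      exact measure_lt_top _ _⟩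
    exact iSup_singleton_mul_eq ρ _ hnull

end Measurability

/-! ### Finite multiplicity and the expectation over compact sets of energies -/

section Conclusion

variable {Ω : Type*} [MeasurableSpace Ω] {𝔞 : Ambient} {d n : ℕ}
  {b ϱ κ : ℝ} {𝓘 : Set ℝ} {ℙ : Measure Ω} [AddAction (Fin d → ℤ) Ω]
  [MeasurableConstVAdd (Fin d → ℤ) Ω] [IsProbabilityMeasure ℙ] [ErgodicVAdd (Fin d → ℤ) Ω ℙ]
  {H : RandomOperator 𝔞 d n Ω} {F : FiniteVolume 𝔞 d n Ω}

/-- The product of the mass of an eigenvalue and its multiplicity is finite, and the mass is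
positive. -/
theorem ae_regionCL_finiteDimensional_eigenspace (hκ : (d : ℝ) / 2 < κ) (hϱ : 0 < ϱ)
    (h𝓘 : IsOpen 𝓘) (htrace : TraceAssumption κ 𝓘 H ℙ) (hEDI : EDIAssumption κ b 𝓘 H F ℙ) :
    ∀ᵐ ω ∂ℙ, ∀ E ∈ regionCL b ϱ 𝓘 F ℙ, FiniteDimensional ℂ (eigenspace (H.op ω) E) := by
  have hκ0 : 0 ≤ κ := (by positivity : (0 : ℝ) ≤ (d : ℝ) / 2).trans hκ.le
  have h : ∀ᵐ ω ∂ℙ, ∀ q : ℚ × ℚ, Icc (q.1 : ℝ) q.2 ⊆ 𝓘 → IsLocInterval b ϱ F ℙ q.1 q.2 →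
      ∀ E ∈ Ioo (q.1 : ℝ) q.2,
        traceMeasure κ (H.spec ω) {E} * posTrace ((H.spec ω).proj {E}) < ∞ := by
    rw [ae_all_iff]
    intro q
    rw [eventually_imp_distrib_left]
    intro hq
    rw [eventually_imp_distrib_left]
    intro hl
    obtain ⟨G, hGm, hGfin, hG⟩ :=
      hl.exists_traceMeasure_mul_posTrace_le hκ hϱ h𝓘 htrace hEDI hq
    filter_upwards [hG, ae_lt_top hGm hGfin.ne] with ω hω hlt E hE
    exact (hω E hE).trans_lt hlt
  filter_upwards [h] with ω hω E hE
  obtain ⟨q, h1, h2, h3⟩ := exists_rat_isLocInterval hE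
  have hlt := hω q h2 h3 E h1
  have hA := H.isSelfAdjoint ω
  have hP := H.isSpectralFamilyOf ω
  by_cases hbot : eigenspace (H.op ω) E = ⊥
  · rw [hbot]; infer_instance
  · obtain ⟨φ, hφ, h0⟩ := Submodule.exists_mem_ne_zero_of_ne_bot hbot
    have hpos := traceMeasure_singleton_pos hκ0 hA hP hφ h0
    refine finiteDimensional_of_hsSq_lt_top hA hP ?_
    rw [← posTrace_proj _ (measurableSet_singleton E)]
    exact ENNReal.lt_top_of_mul_ne_top_right hlt.ne hpos.ne'

/-- Finitely many localization intervals cover a compact subset of the region. -/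
theorem exists_lintegral_essSup_le (hκ : (d : ℝ) / 2 < κ) (hϱ : 0 < ϱ)
    (h𝓘 : IsOpen 𝓘) (htrace : TraceAssumption κ 𝓘 H ℙ) (hEDI : EDIAssumption κ b 𝓘 H F ℙ)
    {E₁ E₂ : ℝ} (hI : Icc E₁ E₂ ⊆ regionCL b ϱ 𝓘 F ℙ) :
    ∃ C : ℝ≥0, ∫⁻ ω, essSup
      (fun t => traceMeasure κ (H.spec ω) {t} * posTrace ((H.spec ω).proj {t}))
      ((traceMeasure κ (H.spec ω)).restrict (Ioo E₁ E₂)) ∂ℙ ≤ C := by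
  set Q := {q : ℚ × ℚ // Icc (q.1 : ℝ) q.2 ⊆ 𝓘 ∧ IsLocInterval b ϱ F ℙ q.1 q.2} with hQ
  have hG : ∀ q : Q, ∃ G : Ω → ℝ≥0∞, Measurable G ∧ ∫⁻ ω, G ω ∂ℙ < ∞ ∧ ∀ᵐ ω ∂ℙ,
      ∀ E ∈ Ioo (q.1.1 : ℝ) q.1.2,
        traceMeasure κ (H.spec ω) {E} * posTrace ((H.spec ω).proj {E}) ≤ G ω := fun q =>
    q.2.2.exists_traceMeasure_mul_posTrace_le hκ hϱ h𝓘 htrace hEDI q.2.1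
  choose G hGm hGfin hG using hG
  obtain ⟨s, hs⟩ := isCompact_Icc.elim_finite_subcover (fun q : Q => Ioo (q.1.1 : ℝ) q.1.2)
    (fun _ => isOpen_Ioo) (s := Icc E₁ E₂) fun E hE => by
      obtain ⟨q, h1, h2, h3⟩ := exists_rat_isLocInterval (hI hE)
      exact mem_iUnion.2 ⟨⟨q, h2, h3⟩, h1⟩
  have hbound : ∀ᵐ ω ∂ℙ, essSup
      (fun t => traceMeasure κ (H.spec ω) {t} * posTrace ((H.spec ω).proj {t}))
      ((traceMeasure κ (H.spec ω)).restrict (Ioo E₁ E₂)) ≤ ∑ q ∈ s, G q ω := by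
    filter_upwards [ae_all_iff.2 hG] with ω hω
    refine essSup_le_of_ae_le _ (ae_restrict_of_forall_mem measurableSet_Ioo fun t ht => ?_)
    obtain ⟨q, hqs, htq⟩ := mem_iUnion₂.1 (hs (Ioo_subset_Icc_self ht))
    exact (hω q t htq).trans (Finset.single_le_sum (f := fun q => G q ω) (fun _ _ => zero_le) hqs)
  have hfin : ∫⁻ ω, ∑ q ∈ s, G q ω ∂ℙ < ∞ := by
    rw [lintegral_finsetSum _ fun q _ => hGm q]
    exact ENNReal.sum_lt_top.2 fun q _ => hGfin q
  refine ⟨(∫⁻ ω, ∑ q ∈ s, G q ω ∂ℙ).toNNReal, ?_⟩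
  rw [ENNReal.coe_toNNReal hfin.ne]
  exact lintegral_mono_ae hbound

end Conclusion
end RandomLoc
theorem corollary3p3 (𝔞 : RandomLoc.Ambient) (d n : ℕ) (hd : 1 ≤ d)
    (κ : ℝ) (hκ : (d : ℝ) / 2 < κ) (b : ℝ) (hb : 3 ≤ b) (ϱ : ℝ) (hϱ : 0 < ϱ)
    {Ω : Type*} [MeasurableSpace Ω] [AddAction (Fin d → ℤ) Ω]
    [MeasurableConstVAdd (Fin d → ℤ) Ω]
    (ℙ : Measure Ω) [IsProbabilityMeasure ℙ] [ErgodicVAdd (Fin d → ℤ) Ω ℙ]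
    (𝓘 : Set ℝ) (h𝓘 : IsOpen 𝓘) (h𝓘' : 𝓘.OrdConnected)
    (H : RandomLoc.RandomOperator 𝔞 d n Ω) (F : RandomLoc.FiniteVolume 𝔞 d n Ω)
    (hcore : RandomLoc.HasCoreAssumption κ H ℙ)
    (htrace : RandomLoc.TraceAssumption κ 𝓘 H ℙ)
    (hEDI : RandomLoc.EDIAssumption κ b 𝓘 H F ℙ) :
    IsOpen (RandomLoc.regionCL b ϱ 𝓘 F ℙ) ∧
    (∀ᵐ ω ∂ℙ,
      RandomLoc.HasPurePointSpectrumIn (H.op ω) (H.spec ω) (RandomLoc.regionCL b ϱ 𝓘 F ℙ) ∧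
      ∀ E ∈ RandomLoc.regionCL b ϱ 𝓘 F ℙ, ∀ φ ∈ RandomLoc.eigenspace (H.op ω) E,
        ∀ ζ : ℝ, 0 < ζ → ζ < 1 → ∃ C : ℝ, ∀ x : Fin d → ℤ,
          RandomLoc.localNorm (𝔞.measure d) (RandomLoc.box x 1) φ ≤
            C * Real.exp (-(RandomLoc.eucl (RandomLoc.pt x) ^ ζ))) ∧
    (∀ E₁ E₂ : ℝ, E₁ < E₂ → Icc E₁ E₂ ⊆ RandomLoc.regionCL b ϱ 𝓘 F ℙ →
      AEMeasurable (fun ω => essSup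
        (fun t => RandomLoc.traceMeasure κ (H.spec ω) {t} *
          RandomLoc.posTrace ((H.spec ω).proj {t}))
        ((RandomLoc.traceMeasure κ (H.spec ω)).restrict (Ioo E₁ E₂))) ℙ ∧
      ∃ C : ℝ≥0, ∫⁻ ω, essSup
        (fun t => RandomLoc.traceMeasure κ (H.spec ω) {t} *
          RandomLoc.posTrace ((H.spec ω).proj {t}))
        ((RandomLoc.traceMeasure κ (H.spec ω)).restrict (Ioo E₁ E₂)) ∂ℙ ≤ C) ∧
    (∀ᵐ ω ∂ℙ, ∀ E ∈ RandomLoc.regionCL b ϱ 𝓘 F ℙ,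
      FiniteDimensional ℂ (RandomLoc.eigenspace (H.op ω) E)) := by
  have hκ0 : 0 ≤ κ := (by positivity : (0 : ℝ) ≤ (d : ℝ) / 2).trans hκ.le
  refine ⟨RandomLoc.isOpen_regionCL, ?_, fun E₁ E₂ _ hI => ⟨?_, ?_⟩, ?_⟩
  · exact (RandomLoc.ae_hasPurePointSpectrumIn_regionCL hκ0 hϱ h𝓘 hcore htrace hEDI).and
      (RandomLoc.ae_regionCL_exists_localNorm_le hκ0 hϱ hEDI)
  · have hI𝓘 : Icc E₁ E₂ ⊆ 𝓘 := fun E hE => by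
      obtain ⟨q, h1, h2, -⟩ := RandomLoc.exists_rat_isLocInterval (hI hE)
      exact h2 (Ioo_subset_Icc_self h1)
    obtain ⟨M, hM⟩ := RandomLoc.exists_traceMeasure_le h𝓘 htrace hI𝓘
    refine H.aemeasurable_essSup ?_
    filter_upwards [hM] with ω hω using hω.trans_lt ENNReal.coe_lt_top
  · exact RandomLoc.exists_lintegral_essSup_le hκ hϱ h𝓘 htrace hEDI hI
  · exact RandomLoc.ae_regionCL_finiteDimensional_eigenspace hκ hϱ h𝓘 htrace hEDI
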